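/- Let $N\ge 1$, let $\Omega\subset\mathbb{R}^N$ be a bounded open set of class $C^{2,\alpha}$, $0<\alpha<1$, let $p>1$, with $p<\frac{N+2}{N-2}$ if $N\ge 3$, let $T>0$, and put $\mathbf{c}=\frac{p}{(p-1)T}$. Let $V>0$ be a bounded weak solution in $H^1_0(\Omega)$ (equivalently, a classical solution) of $-\Delta V=\mathbf{c}V^p$ in $\Omega$, $V=0$ on $\partial\Omega$. Let $L^2_V=L^2(\Omega,V^{p-1}dx)$ and let $0<\lambda_{V,1}<\lambda_{V,2}<\cdots$ be the distinct eigenvalues of the Dirichlet Laplacian on $L^2_V$, that is, the numbers $\lambda$ for which $-\Delta\varphi=\lambda V^{p-1}\varphi$ has a nonzero solution $\varphi\in H^1_0(\Omega)$. Let $\mathtt{V}_k\subset L^2_V$ be the eigenspace of $\lambda_{V,k}$, $N_k$ its dimension, and $\phi_{k,1},\dots,\phi_{k,N_k}$ an $L^2_V$-orthonormal basis of it. Assume (H2) the problem $-\Delta\varphi=\mathbf{c}\,p\,V^{p-1}\varphi$ in $\Omega$, $\varphi=0$ on $\partial\Omega$, has no nontrivial solution, and let $k_p\ge 1$ be the largest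 $k$ with $\lambda_{V,k}<p\,\mathbf{c}$. For $v\ge 0$ on $\Omega$ define the nonlinear Rayleigh quotients $$\mathcal{Q}_{k,j}[v]=\frac{\left|\int_\Omega (v^p-V^p)\,\phi_{k,j}\,dx\right|}{\mathcal{E}[v]^{1/2}},\qquad \mathcal{E}[v]=\int_\Omega\Big[(v^{p+1}-V^{p+1})-\tfrac{p+1}{p}(v^p-V^p)V\Big]dx,$$ with $\mathcal{Q}_{k,j}[V]=0$. Let $v\ge0$ denote any weak (energy) solution of the rescaled fast diffusion problem $$\partial_t v^p=\Delta v+\mathbf{c}\,v^p\ \text{ in }(0,\infty)\times\Omega,\qquad v=0\ \text{ on }(0,\infty)\times\partial\Omega,\qquad v(0,\cdot)^p=u_0,$$ with $0\le u_0\in L^q(\Omega)$, $q\ge1$, and $q>\frac{N(1-1/p)}{2}$ if $\frac1p<\frac{N-2}{N}$. (Weak energy solution means: $v^p\in C([0,\infty);L^1(\Omega))$, $v\in L^2_{\rm loc}((0,\infty);H^1_0(\Omega))$, and the equation holds against all test functions in $C_c^\infty((0,\infty)\times\Omega)$.) For $\delta>0$ and $t_0\ge0$ consider the condition (H1')$_\delta$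 $\quad |v(t,x)-V(x)|\le\delta\,V(x)$ for a.e. $(t,x)\in[t_0,\infty)\times\Omega$. Then there are constants $\kappa_0>0$ and $\varepsilon_0>0$, depending only on $N,\Omega,p,T,V$ (in particular not on $v$, $u_0$, $\varepsilon$, $\delta$, $t_0$ or the choice of the bases), such that for every such $v$, every $0<\varepsilon<\varepsilon_0$ and every $t_0\ge0$ there is a time $t_\varepsilon\ge t_0$ with the following property: if (H1')$_\delta$ holds for some $0<\delta<\kappa_0\varepsilon$, then $$\mathcal{Q}_{k,j}[v(t)]\le\varepsilon\qquad\text{for all } t\ge t_\varepsilon,\ k=1,\dots,k_p,\ j=1,\dots,N_k.$$ -/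

import Mathlib

open MeasureTheory Set Filter Topology
open scoped ContDiff NNReal ENNReal

noncomputable section

namespace FastDiffusion

/-- `ℝ^N` with its Euclidean structure. -/
abbrev Space (N : ℕ) : Type := EuclideanSpace ℝ (Fin N)

/-! ### Domains and test functions -/

/-- Bounded open sets of class `C^{2,α}`: near each boundary point, `Ω` is a strict sublevel set of a
function of class `C^{2,α}` with nonvanishing differential. -/
def IsC2AlphaDomain {N : ℕ} (α : ℝ≥0) (Ω : Set (Space N)) : Prop :=
  IsOpen Ω ∧ Bornology.IsBounded Ω ∧
    ∀ x₀ ∈ frontier Ω, ∃ (U : Set (Space N)) (Φ : Space N → ℝ),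
      IsOpen U ∧ x₀ ∈ U ∧ ContDiffOn ℝ 2 Φ U ∧
      (∃ C : ℝ≥0, HolderOnWith C α (fderiv ℝ (fderiv ℝ Φ)) U) ∧
      fderiv ℝ Φ x₀ ≠ 0 ∧ Ω ∩ U = {x ∈ U | Φ x < 0}

/-- `ψ ∈ C_c^∞(U)`. -/
def IsTestFunction {F : Type*} [NormedAddCommGroup F] [NormedSpace ℝ F] (U : Set F) (ψ : F → ℝ) :
    Prop :=
  ContDiff ℝ ∞ ψ ∧ HasCompactSupport ψ ∧ tsupport ψ ⊆ U

/-! ### The space `H^1_0(Ω)` -/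

/-- `u ∈ H^1_0(Ω)` with weak gradient `g`: the pair `(u, g)` is the limit in `L²(Ω)` of pairs
`(φₙ, ∇φₙ)` with `φₙ ∈ C_c^∞(Ω)`. -/
def HasH10Gradient {N : ℕ} (Ω : Set (Space N)) (u : Space N → ℝ) (g : Space N → Space N) : Prop :=
  MemLp u 2 (volume.restrict Ω) ∧ MemLp g 2 (volume.restrict Ω) ∧
    ∃ φ : ℕ → Space N → ℝ, (∀ n, IsTestFunction Ω (φ n)) ∧
      Tendsto (fun n => eLpNorm (φ n - u) 2 (volume.restrict Ω)) atTop (𝓝 0) ∧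
      Tendsto (fun n => eLpNorm (gradient (φ n) - g) 2 (volume.restrict Ω)) atTop (𝓝 0)

/-- `u ∈ H^1_0(Ω)`, with weak gradient `g`, is a weak solution of the homogeneous Dirichlet problem
`-Δu = h` in `Ω`, `u = 0` on `∂Ω`. -/
def IsWeakDirichletSolution {N : ℕ} (Ω : Set (Space N)) (u : Space N → ℝ) (g : Space N → Space N)
    (h : Space N → ℝ) : Prop :=
  HasH10Gradient Ω u g ∧
    ∀ ψ : Space N → ℝ, IsTestFunction Ω ψ →
      ∫ x in Ω, inner ℝ (g x) (gradient ψ x) = ∫ x in Ω, h x * ψ x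

/-! ### Stationary profiles and solutions of the rescaled problem -/

/-- The constant `𝐜 = p / ((p - 1) T) = 1 / ((1 - m) T)`, where `m = 1 / p`. -/
def cConst (p T : ℝ) : ℝ := p / ((p - 1) * T)

/-- Positive bounded solutions of `-ΔV = 𝐜 V^p` in `Ω`, `V = 0` on `∂Ω`. -/
def IsStationaryProfile {N : ℕ} (Ω : Set (Space N)) (p c : ℝ) (V : Space N → ℝ) : Prop :=
  (∀ᵐ x ∂(volume.restrict Ω), 0 < V x) ∧
  (∃ M : ℝ, ∀ᵐ x ∂(volume.restrict Ω), V x ≤ M) ∧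
  ∃ DV : Space N → Space N, IsWeakDirichletSolution Ω V DV (fun x => c * V x ^ p)

/-- The condition on the initial datum `u₀`: `0 ≤ u₀ ∈ L^q(Ω)`, where `q ≥ 1`, and
`q > N (1 - m) / 2` if `m < (N - 2) / N`; here `m = 1 / p`. -/
def IsAdmissibleDatum {N : ℕ} (Ω : Set (Space N)) (p : ℝ) (u₀ : Space N → ℝ) : Prop :=
  (∀ᵐ x ∂(volume.restrict Ω), 0 ≤ u₀ x) ∧
  ∃ q : ℝ, 1 ≤ q ∧ (1 / p < ((N : ℝ) - 2) / N → (N : ℝ) * (1 - 1 / p) / 2 < q) ∧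
    MemLp u₀ (ENNReal.ofReal q) (volume.restrict Ω)

/-- Nonnegative weak (energy) solutions `v` of the rescaled Cauchy-Dirichlet problem
`∂ₜ v^p = Δv + 𝐜 v^p` in `(0,∞) × Ω`, `v = 0` on `(0,∞) × ∂Ω`, `v(0)^p = u₀`. In terms of
`w = v^p` and `m = 1/p` the equation is `∂ₜ w = Δ w^m + 𝐜 w`. Only the values `v t x` with `0 < t`
and `x ∈ Ω` matter. -/
structure IsRCDPSolution {N : ℕ} (Ω : Set (Space N)) (p c : ℝ) (u₀ : Space N → ℝ)
    (v : ℝ → Space N → ℝ) : Prop where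
  measurable : AEStronglyMeasurable (fun z : ℝ × Space N => v z.1 z.2)
    ((volume.restrict (Ioi (0 : ℝ))).prod (volume.restrict Ω))
  nonneg : ∀ t : ℝ, 0 < t → ∀ᵐ x ∂(volume.restrict Ω), 0 ≤ v t x
  /-- `v^p` is a continuous curve in `L^1(Ω)` for positive times -/
  integrable : ∀ t : ℝ, 0 < t → IntegrableOn (fun x => v t x ^ p) Ω
  continuous : ∀ t : ℝ, 0 < t →
    Tendsto (fun s : ℝ => ∫ x in Ω, |v s x ^ p - v t x ^ p|) (𝓝 t) (𝓝 0)
  /-- the initial datum is attained in `L^1(Ω)` -/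
  initial : IntegrableOn u₀ Ω ∧
    Tendsto (fun s : ℝ => ∫ x in Ω, |v s x ^ p - u₀ x|) (𝓝[>] (0 : ℝ)) (𝓝 0)
  /-- `v ∈ L²_loc((0,∞); H^1_0(Ω))`, and the equation holds against test functions -/
  weak : ∃ Dv : ℝ → Space N → Space N,
    AEStronglyMeasurable (fun z : ℝ × Space N => Dv z.1 z.2)
      ((volume.restrict (Ioi (0 : ℝ))).prod (volume.restrict Ω)) ∧
    (∀ᵐ t ∂(volume.restrict (Ioi (0 : ℝ))), HasH10Gradient Ω (v t) (Dv t)) ∧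
    (∀ a b : ℝ, 0 < a → a < b →
      Integrable (fun z : ℝ × Space N => v z.1 z.2 ^ 2 + ‖Dv z.1 z.2‖ ^ 2)
        ((volume.restrict (Icc a b)).prod (volume.restrict Ω))) ∧
    ∀ ψ : ℝ × Space N → ℝ, IsTestFunction (Ioi (0 : ℝ) ×ˢ Ω) ψ →
      ∫ z, (v z.1 z.2 ^ p * deriv (fun s => ψ (s, z.2)) z.1
            - inner ℝ (Dv z.1 z.2) (gradient (fun y => ψ (z.1, y)) z.2)
            + c * v z.1 z.2 ^ p * ψ z)
        ∂((volume.restrict (Ioi (0 : ℝ))).prod (volume.restrict Ω)) = 0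

/-- `|v - V| ≤ δ V` almost everywhere in `[t₀,∞) × Ω`. -/
def RelativelyClose {N : ℕ} (Ω : Set (Space N)) (V : Space N → ℝ) (δ t₀ : ℝ)
    (v : ℝ → Space N → ℝ) : Prop :=
  ∀ᵐ z ∂((volume.restrict (Ici t₀)).prod (volume.restrict Ω)),
    |v z.1 z.2 - V z.2| ≤ δ * V z.2

/-- There is no nontrivial solution of `-Δφ = 𝐜 p V^{p-1} φ` in `Ω`, `φ = 0` on `∂Ω`. -/
def Nondegenerate {N : ℕ} (Ω : Set (Space N)) (p c : ℝ) (V : Space N → ℝ) : Prop :=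
  ∀ (φ : Space N → ℝ) (Dφ : Space N → Space N),
    IsWeakDirichletSolution Ω φ Dφ (fun x => c * p * V x ^ (p - 1) * φ x) →
      φ =ᵐ[volume.restrict Ω] 0

/-! ### The Dirichlet Laplacian on `L²_V` -/

/-- The measure `V^{p-1} dx` on `Ω`. -/
def weightedMeasure {N : ℕ} (Ω : Set (Space N)) (p : ℝ) (V : Space N → ℝ) : Measure (Space N) :=
  (volume.restrict Ω).withDensity fun x => ENNReal.ofReal (V x ^ (p - 1))

/-- The Hilbert space `L²_V = L²(Ω, V^{p-1} dx)`. -/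
abbrev L2V {N : ℕ} (Ω : Set (Space N)) (p : ℝ) (V : Space N → ℝ) : Type :=
  Lp ℝ 2 (weightedMeasure Ω p V)

/-- `φ ∈ L²_V` lies in `H^1_0(Ω)` and satisfies `-Δφ = μ V^{p-1} φ`. -/
def SolvesEigenvalueEquation {N : ℕ} (Ω : Set (Space N)) (p : ℝ) (V : Space N → ℝ) (μ : ℝ)
    (φ : L2V Ω p V) : Prop :=
  ∃ Dφ : Space N → Space N,
    IsWeakDirichletSolution Ω (φ : Space N → ℝ) Dφ (fun x => μ * V x ^ (p - 1) * φ x)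

/-- The eigenvalues of `-Δ` on `L²_V`. -/
def eigenvalues {N : ℕ} (Ω : Set (Space N)) (p : ℝ) (V : Space N → ℝ) : Set ℝ :=
  {μ | ∃ φ : L2V Ω p V, φ ≠ 0 ∧ SolvesEigenvalueEquation Ω p V μ φ}

/-- The increasing enumeration `0 < λ_{V,1} < λ_{V,2} < ⋯` of the eigenvalues, without multiplicity;
the index `0` is a placeholder with value `0`. -/
def eigenvalue {N : ℕ} (Ω : Set (Space N)) (p : ℝ) (V : Space N → ℝ) : ℕ → ℝ
  | 0 => 0
  | k + 1 => sInf {μ | μ ∈ eigenvalues Ω p V ∧ eigenvalue Ω p V k < μ}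

/-- The space `𝚅_k ⊆ L²_V` generated by the eigenfunctions of the `k`-th eigenvalue `λ_{V,k}`. -/
def eigenspace {N : ℕ} (Ω : Set (Space N)) (p : ℝ) (V : Space N → ℝ) (k : ℕ) :
    Submodule ℝ (L2V Ω p V) :=
  Submodule.span ℝ {φ | SolvesEigenvalueEquation Ω p V (eigenvalue Ω p V k) φ}

/-- `N_k`, the dimension of `𝚅_k`. -/
def eigenDim {N : ℕ} (Ω : Set (Space N)) (p : ℝ) (V : Space N → ℝ) (k : ℕ) : ℕ :=
  Module.finrank ℝ (eigenspace Ω p V k)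

/-- The largest integer `k_p ≥ 1` such that `λ_{V,k_p} < p 𝐜`. -/
def kMax {N : ℕ} (Ω : Set (Space N)) (p c : ℝ) (V : Space N → ℝ) : ℕ :=
  sSup {k : ℕ | 1 ≤ k ∧ eigenvalue Ω p V k < p * c}

/-! ### Nonlinear entropy and nonlinear Rayleigh quotients -/

/-- The nonlinear entropy `ℰ[v]`. -/
def entropy {N : ℕ} (Ω : Set (Space N)) (p : ℝ) (V v : Space N → ℝ) : ℝ :=
  ∫ x in Ω, ((v x ^ (p + 1) - V x ^ (p + 1)) - (p + 1) / p * (v x ^ p - V x ^ p) * V x)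

/-- The nonlinear Rayleigh quotient `𝒬[v] = |∫ (v^p - V^p) φ| / ℰ[v]^{1/2}` in the direction `φ`.
It is `0` when `v = V`. -/
def nonlinearQuotient {N : ℕ} (Ω : Set (Space N)) (p : ℝ) (V φ v : Space N → ℝ) : ℝ :=
  |∫ x in Ω, (v x ^ p - V x ^ p) * φ x| / Real.sqrt (entropy Ω p V v)

end FastDiffusion

end

open FastDiffusion

/-! ### Spectral gap of a compact symmetric operator -/

section SpectralSplitting

variable {H : Type*} [NormedAddCommGroup H] [InnerProductSpace ℝ H]

/-! Let J be the embedding of H^1_0(Ω), normed by the gradient, into L²_V, and T = J J*, so that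
-Δ(T q) = V^{p-1} q. Put q = (v^p - V^p) / V^{p-1} and f = v - V. Subtracting the equation of V from
that of v and inverting the Laplacian gives (T q)' = c T q - f, and (H1') makes f equal to q / p up
to a relative error O(δ). On an eigenvector of T with eigenvalue 1/λ the linear equation (T q)' = c
T q - q / p reads q' = (c - λ / p) q, so the modes with λ < p c are exactly the growing ones. The
quotients measure this unstable part of q, and a solution that stays close to V forever cannot carry
much of it.

By (H2), θ = 1 / (p c) is not an eigenvalue of the compact operator T, which leaves a gap g on both
sides of θ (`exists_spectral_splitting`). Let P be the orthogonal projection onto the unstable modes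
and Z = ⟨T q, P q - ε² (q - P q)⟩. If the relative error between q and p f is at most a small
multiple of ε, the gap yields Z' ≥ b Z with b > 0. A positive value of Z would then grow
exponentially, although q is bounded; so Z ≤ 0, which implies ‖P q‖ ≤ ε ‖q‖
(`norm_projection_le_of_evolution`). This holds at every t > t₀: the argument looks at the future of
the solution, and no waiting time is needed. Since P φ = φ for the eigenfunctions in question, |⟨q,
φ⟩| ≤ ‖P q‖, and ‖q‖ is bounded by a multiple of ℰ^{1/2} (`norm_bounds_of_relativelyClose`).

The remaining work makes this rigorous for weak solutions. Compactness of J comes from averaging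
over fine grids (`isCompactOperator_gradientToL2`). The evolution equation comes from the weak
formulation by density and a du Bois-Reymond argument (`evolution_identity`); q is only known to be
continuous in time, but T q is differentiable, and this suffices for Z because T commutes with P.
Closeness at almost every time is upgraded to every time by L¹ continuity
(`ae_abs_sub_le_of_relativelyClose`). -/

/-- Spectral bound for a symmetric operator on the closed span of some of its eigenspaces. -/
theorem LinearMap.IsSymmetric.quadratic_lower_bound_of_mem_closure_iSup_eigenspace
    {T : H →L[ℝ] H} (hs : T.IsSymmetric) (I : Set ℝ) (σ θ g : ℝ)
    (hI : ∀ μ ∈ I, Module.End.eigenspace (T : Module.End ℝ H) μ ≠ ⊥ → g ≤ σ * (μ - θ)) {x : H}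
    (hx : x ∈ (⨆ μ : I, Module.End.eigenspace (T : Module.End ℝ H) μ).topologicalClosure) :
    g * ‖x‖ ^ 2 ≤ σ * (inner ℝ (T x) x - θ * ‖x‖ ^ 2) := by
  have key : ∀ x ∈ (⨆ μ : I, Module.End.eigenspace (T : Module.End ℝ H) μ),
      g * ‖x‖ ^ 2 ≤ σ * (inner ℝ (T x) x - θ * ‖x‖ ^ 2) := by
    intro x hx
    have hV : OrthogonalFamily ℝ
        (fun μ : I => Module.End.eigenspace (T : Module.End ℝ H) (μ : ℝ)) fun μ =>
        (Module.End.eigenspace (T : Module.End ℝ H) (μ : ℝ)).subtypeₗᵢ :=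
      hs.orthogonalFamily_eigenspaces.comp Subtype.val_injective
    classical
    obtain ⟨l, rfl⟩ := (Submodule.mem_iSup_iff_exists_dfinsupp' _ x).1 hx
    have hsum : (l.sum fun i xi => (xi : H)) = ∑ i ∈ l.support,
        (Module.End.eigenspace (T : Module.End ℝ H) (i : ℝ)).subtypeₗᵢ (l i) := rfl
    have hT : T (l.sum fun i xi => (xi : H)) = ∑ i ∈ l.support,
        (Module.End.eigenspace (T : Module.End ℝ H) (i : ℝ)).subtypeₗᵢ ((i : ℝ) • l i) := by
      rw [hsum, map_sum]
      refine Finset.sum_congr rfl fun i _ => ?_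
      have := Module.End.mem_eigenspace_iff.1 (l i).2
      simpa using this
    have hn : ‖(l.sum fun i xi => (xi : H))‖ ^ 2 = ∑ i ∈ l.support, ‖l i‖ ^ 2 := by
      rw [hsum]; exact hV.norm_sum _ _
    have hin : inner ℝ (T (l.sum fun i xi => (xi : H))) (l.sum fun i xi => (xi : H))
        = ∑ i ∈ l.support, (i : ℝ) * ‖l i‖ ^ 2 := by
      rw [hT, hsum, hV.inner_sum]
      refine Finset.sum_congr rfl fun i _ => ?_
      rw [real_inner_smul_left, real_inner_self_eq_norm_sq]
    rw [hin, hn, Finset.mul_sum, Finset.mul_sum, ← Finset.sum_sub_distrib, Finset.mul_sum]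
    refine Finset.sum_le_sum fun i hi => ?_
    have hne : Module.End.eigenspace (T : Module.End ℝ H) (i : ℝ) ≠ ⊥ := by
      intro h
      have h0 : (l i : H) = 0 := (Submodule.eq_bot_iff _).1 h _ (l i).2
      exact (DFinsupp.mem_support_iff.1 hi) (Subtype.ext h0)
    have := hI i i.2 hne
    nlinarith [mul_le_mul_of_nonneg_right this (sq_nonneg ‖l i‖)]
  have hcl : IsClosed {x : H | g * ‖x‖ ^ 2 ≤ σ * (inner ℝ (T x) x - θ * ‖x‖ ^ 2)} :=
    isClosed_le (by fun_prop) (by fun_prop)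
  exact closure_minimal key hcl hx

/-- By the Fredholm alternative T - θ is bounded below by some g > 0, so every eigenvalue is at
distance at least g from θ. P projects onto the closed span of the eigenspaces above θ; by the
spectral theorem its orthogonal complement is the closed span of those below. -/
theorem exists_spectral_splitting [CompleteSpace H] {T : H →L[ℝ] H} (hc : IsCompactOperator T)
    (hs : T.IsSymmetric) {θ : ℝ} (hθ : θ ≠ 0) (hn : ∀ x, T x = θ • x → x = 0) :
    ∃ (P : H →L[ℝ] H) (g : ℝ), 0 < g ∧ (∀ x, P (P x) = P x) ∧
      (∀ x y, inner ℝ (P x) y = inner ℝ x (P y)) ∧ (∀ x, T (P x) = P (T x)) ∧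
      (∀ x, (θ + g) * ‖P x‖ ^ 2 ≤ inner ℝ (T (P x)) (P x)) ∧
      (∀ x, inner ℝ (T (x - P x)) (x - P x) ≤ (θ - g) * ‖x - P x‖ ^ 2) ∧
      ∀ μ, θ < μ → ∀ x, T x = μ • x → P x = x := by
  have hE : ¬ Module.End.HasEigenvalue (T : Module.End ℝ H) θ := by
    intro h
    obtain ⟨x, hx⟩ := h.exists_hasEigenvector
    exact hx.2 (hn x (Module.End.mem_eigenspace_iff.1 hx.1))
  obtain ⟨K, hK⟩ := hc.antilipschitz_of_not_hasEigenvalue hθ hE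
  obtain ⟨g, hg, hgT⟩ := antilipschitzWith_iff_exists_mul_le_norm.1 ⟨K, hK⟩
  have hgap : ∀ μ, Module.End.eigenspace (T : Module.End ℝ H) μ ≠ ⊥ → g ≤ |μ - θ| := by
    intro μ hμ
    obtain ⟨x, hx, hx0⟩ := Submodule.exists_mem_ne_zero_of_ne_bot hμ
    have h1 : T x = μ • x := Module.End.mem_eigenspace_iff.1 hx
    have h2 := hgT x
    have h3 : (T - θ • (1 : H →L[ℝ] H)) x = (μ - θ) • x := by
      simp [h1, sub_smul]
    rw [h3, norm_smul, Real.norm_eq_abs] at h2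
    exact le_of_mul_le_mul_right h2 (norm_pos_iff.2 hx0)
  set W := (⨆ μ : Ioi θ, Module.End.eigenspace (T : Module.End ℝ H) (μ : ℝ)).topologicalClosure
    with hW
  set W' := (⨆ μ : Iio θ, Module.End.eigenspace (T : Module.End ℝ H) (μ : ℝ)).topologicalClosure
    with hW'
  have hWE : ∀ μ, θ < μ → Module.End.eigenspace (T : Module.End ℝ H) μ ≤ W := fun μ hμ =>
    (le_iSup (fun μ : Ioi θ => Module.End.eigenspace (T : Module.End ℝ H) (μ : ℝ)) ⟨μ, hμ⟩).trans
      (Submodule.le_topologicalClosure _)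
  have hWE' : ∀ μ, μ < θ → Module.End.eigenspace (T : Module.End ℝ H) μ ≤ W' := fun μ hμ =>
    (le_iSup (fun μ : Iio θ => Module.End.eigenspace (T : Module.End ℝ H) (μ : ℝ)) ⟨μ, hμ⟩).trans
      (Submodule.le_topologicalClosure _)
  have : CompleteSpace W := (Submodule.isClosed_topologicalClosure _).completeSpace_coe
  have : CompleteSpace W' := (Submodule.isClosed_topologicalClosure _).completeSpace_coe
  have hinv : ∀ x ∈ W, T x ∈ W := by
    have h1 : ∀ x ∈ (⨆ μ : Ioi θ, Module.End.eigenspace (T : Module.End ℝ H) (μ : ℝ)),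
        T x ∈ W := by
      intro x hx
      induction hx using Submodule.iSup_induction' with
      | mem μ x hx =>
        rw [show T x = (μ : ℝ) • x from Module.End.mem_eigenspace_iff.1 hx]
        exact W.smul_mem _ (hWE μ μ.2 hx)
      | zero => simp
      | add x y _ _ h1 h2 => rw [map_add]; exact W.add_mem h1 h2
    intro x hx
    exact closure_minimal h1
      ((Submodule.isClosed_topologicalClosure _).preimage T.continuous) hx
  have hinv' : ∀ x ∈ Wᗮ, T x ∈ Wᗮ := by
    intro x hx
    rw [Submodule.mem_orthogonal] at hx ⊢
    intro u hu
    rw [← hx _ (hinv u hu)]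
    exact (hs u x).symm
  have hWW' : W' ≤ Wᗮ := by
    have h0 : (⨆ μ : Iio θ, Module.End.eigenspace (T : Module.End ℝ H) (μ : ℝ)) ≤ Wᗮ := by
      rw [hW, Submodule.orthogonal_closure]
      rw [← Submodule.isOrtho_iff_le, Submodule.isOrtho_iSup_left]
      intro μ
      rw [Submodule.isOrtho_iSup_right]
      intro ν
      exact hs.orthogonalFamily_eigenspaces.isOrtho (ne_of_lt (lt_trans μ.2 ν.2))
    exact Submodule.topologicalClosure_minimal _ h0 (Submodule.isClosed_orthogonal _)
  -- The part of an element of `Wᗮ` orthogonal to `W'` is orthogonal to every eigenspace (the one at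
  -- θ is trivial), hence zero.
  have hperp : Wᗮ ≤ W' := by
    intro x hx
    have hy : x - W'.starProjection x ∈
        (⨆ μ, Module.End.eigenspace (T : Module.End ℝ H) μ)ᗮ := by
      have e1 : x - W'.starProjection x ∈ Wᗮ :=
        Submodule.sub_mem _ hx (hWW' (Submodule.starProjection_apply_mem _ _))
      have e2 : x - W'.starProjection x ∈ W'ᗮ := Submodule.sub_starProjection_mem_orthogonal x
      rw [← Submodule.iInf_orthogonal, Submodule.mem_iInf]
      intro μ
      rcases lt_trichotomy μ θ with h | h | h
      · exact Submodule.orthogonal_le (hWE' μ h) e2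
      · have : Module.End.eigenspace (T : Module.End ℝ H) μ = ⊥ := by
          rw [h]; simpa [Module.End.hasEigenvalue_iff] using hE
        rw [this]; simp
      · exact Submodule.orthogonal_le (hWE μ h) e1
    rw [T.orthogonalComplement_iSup_eigenspaces_eq_bot hc hs, Submodule.mem_bot, sub_eq_zero] at hy
    rw [hy]; exact Submodule.starProjection_apply_mem _ _
  refine ⟨W.starProjection, g, hg, fun x => ?_, fun x y => ?_, fun x => ?_, fun x => ?_,
    fun x => ?_, fun μ hμ x hx => ?_⟩
  · exact Submodule.starProjection_eq_self_iff.2 (Submodule.starProjection_apply_mem _ _)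
  · exact Submodule.inner_starProjection_left_eq_right W x y
  · have e1 : T x = T (W.starProjection x) + T (x - W.starProjection x) := by
      rw [← map_add]; simp
    have e2 : W.starProjection (T (x - W.starProjection x)) = 0 :=
      W.starProjection_apply_eq_zero_iff.2
        (hinv' _ (Submodule.sub_starProjection_mem_orthogonal x))
    rw [e1, map_add, e2, add_zero]
    exact (Submodule.starProjection_eq_self_iff.2
      (hinv _ (Submodule.starProjection_apply_mem _ _))).symm
  -- The sign σ is 1 above θ and -1 below, where the lower bound becomes an upper bound.
  · have := hs.quadratic_lower_bound_of_mem_closure_iSup_eigenspace (Ioi θ) 1 θ g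
      (fun μ hμ h => by
        have := hgap μ h
        rw [abs_of_pos (sub_pos.2 hμ)] at this
        linarith) (Submodule.starProjection_apply_mem W x)
    linarith
  · have := hs.quadratic_lower_bound_of_mem_closure_iSup_eigenspace (Iio θ) (-1) θ g
      (fun μ hμ h => by
        have := hgap μ h
        rw [abs_of_neg (sub_neg.2 hμ)] at this
        linarith) (hperp (Submodule.sub_starProjection_mem_orthogonal x))
    linarith
  · exact Submodule.starProjection_eq_self_iff.2
      (hWE μ hμ (Module.End.mem_eigenspace_iff.2 hx))

end SpectralSplitting

/-! ### Bounded trajectories stay out of the unstable cone -/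

section ConeInvariance

variable {H : Type*} [NormedAddCommGroup H] [InnerProductSpace ℝ H]

/-- A bounded function whose derivative dominates a positive multiple of it is nonpositive. -/
theorem nonpos_of_hasDerivAt_of_bddAbove {Z Z' : ℝ → ℝ} {t₀ b B : ℝ} (hb : 0 < b)
    (hZ : ∀ t, t₀ < t → HasDerivAt Z (Z' t) t) (hZ' : ∀ t, t₀ < t → b * Z t ≤ Z' t)
    (hB : ∀ t, t₀ < t → Z t ≤ B) {t : ℝ} (ht : t₀ < t) : Z t ≤ 0 := by
  by_contra! hpos
  -- The function e^{-bs} Z(s) is nondecreasing; positive at t, it would stay above a positive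
  -- constant, while it is at most e^{-bs} B, which tends to 0.
  have hd : ∀ s, t₀ < s → HasDerivAt (fun s => Real.exp (-(b * s)) * Z s)
      (Real.exp (-(b * s)) * (Z' s - b * Z s)) s := by
    intro s hs
    have h1 : HasDerivAt (fun s => Real.exp (-(b * s))) (Real.exp (-(b * s)) * (-b)) s := by
      have := ((hasDerivAt_id s).const_mul b).neg.exp
      simpa using this
    exact (h1.mul (hZ s hs)).congr_deriv (by ring)
  have hmono : MonotoneOn (fun s => Real.exp (-(b * s)) * Z s) (Ioi t₀) := by
    refine monotoneOn_of_deriv_nonneg (convex_Ioi t₀)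
      (fun s hs => (hd s hs).continuousAt.continuousWithinAt) ?_ ?_
    · rw [interior_Ioi]
      exact fun s hs => (hd s hs).differentiableAt.differentiableWithinAt
    · rw [interior_Ioi]
      intro s hs
      rw [(hd s hs).deriv]
      exact mul_nonneg (Real.exp_pos _).le (by linarith [hZ' s hs])
  have hle : ∀ s, t ≤ s → Real.exp (-(b * t)) * Z t ≤ Real.exp (-(b * s)) * B := by
    intro s hs
    exact (hmono ht (lt_of_lt_of_le ht hs) hs).trans
      (mul_le_mul_of_nonneg_left (hB s (lt_of_lt_of_le ht hs)) (Real.exp_pos _).le)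
  have hlim : Tendsto (fun s => Real.exp (-(b * s)) * B) atTop (𝓝 (0 * B)) :=
    ((Real.tendsto_exp_neg_atTop_nhds_zero.comp (tendsto_id.const_mul_atTop hb))).mul_const B
  have := ge_of_tendsto hlim (eventually_ge_atTop t |>.mono hle)
  rw [zero_mul] at this
  exact absurd this (not_le.2 (mul_pos (Real.exp_pos _) hpos))

/-- Weak form of the evolution equation `(T q)' = c T q - f` implies the strong form. -/
theorem hasDerivAt_of_forall_inner_eq_integral [CompleteSpace H] {T : H →L[ℝ] H}
    (hs : T.IsSymmetric) {c t₀ : ℝ} {q f : ℝ → H} (hq : ContinuousOn q (Ioi t₀))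
    (hf : ContinuousOn f (Ioi t₀))
    (heq : ∀ h : H, ∀ s t : ℝ, t₀ < s → s ≤ t → inner ℝ (q t) (T h) - inner ℝ (q s) (T h)
      = ∫ τ in s..t, (c * inner ℝ (q τ) (T h) - inner ℝ (f τ) h)) {t : ℝ} (ht : t₀ < t) :
    HasDerivAt (fun t => T (q t)) (c • T (q t) - f t) t := by
  obtain ⟨s, hs0, hst⟩ := exists_between ht
  have hG : ContinuousOn (fun τ => c • T (q τ) - f τ) (Ioi t₀) := by fun_prop
  have hint : ∀ t', s ≤ t' → IntervalIntegrable (fun τ => c • T (q τ) - f τ) volume s t' := by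
    intro t' ht'
    refine (hG.mono ?_).intervalIntegrable
    rw [uIcc_of_le ht']
    exact fun x hx => lt_of_lt_of_le hs0 hx.1
  -- Symmetry moves T off the test vector, so the scalar identities amount to one identity of vector
  -- integrals.
  have hrep : ∀ t', s ≤ t' → T (q t') = T (q s) + ∫ τ in s..t', (c • T (q τ) - f τ) := by
    intro t' ht'
    refine ext_inner_right ℝ fun h => ?_
    have h1 := heq h s t' hs0 ht'
    have e1 : inner ℝ (∫ τ in s..t', (c • T (q τ) - f τ)) h
        = ∫ τ in s..t', (c * inner ℝ (q τ) (T h) - inner ℝ (f τ) h) := by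
      rw [real_inner_comm]
      have := (innerSL ℝ h).intervalIntegral_comp_comm (hint t' ht')
      simp only [innerSL_apply_apply] at this
      rw [← this]
      refine intervalIntegral.integral_congr fun τ _ => ?_
      simp only [inner_sub_right, inner_smul_right]
      rw [real_inner_comm, real_inner_comm (f τ)]
      congr 2
      exact hs _ _
    rw [inner_add_left, e1, ← h1]
    have e2 : ∀ x, inner ℝ (T x) h = inner ℝ x (T h) := fun x => hs x h
    rw [e2, e2]; ring
  have hd : HasDerivAt (fun t' => T (q s) + ∫ τ in s..t', (c • T (q τ) - f τ))
      (c • T (q t) - f t) t := by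
    refine (intervalIntegral.integral_hasDerivAt_right (hint t hst.le) ?_ ?_).const_add _
    · exact hG.stronglyMeasurableAtFilter isOpen_Ioi t ht
    · exact hG.continuousAt (Ioi_mem_nhds ht)
  exact hd.congr_of_eventuallyEq
    ((eventually_gt_nhds hst).mono fun t' ht' => hrep t' ht'.le)

/-- For ε ≤ 1 the product is at most (x + ε y)². This lets an error of relative size ε be absorbed
by x² + ε² y², the weights with which the spectral gap enters. -/
theorem mul_add_mul_add_sq_le {ε x y : ℝ} (hε : 0 ≤ ε) (hε1 : ε ≤ 1) (hx : 0 ≤ x) (hy : 0 ≤ y) :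
    ε * (x + y) * (x + ε ^ 2 * y) ≤ 2 * x ^ 2 + 2 * ε ^ 2 * y ^ 2 := by
  have a0 : ε ^ 2 ≤ 1 := pow_le_one₀ hε hε1
  have a1 : ε * x ^ 2 ≤ x ^ 2 := mul_le_of_le_one_left (sq_nonneg x) hε1
  have a2 : ε ^ 3 * (x * y) ≤ ε * (x * y) :=
    mul_le_mul_of_nonneg_right (by nlinarith) (mul_nonneg hx hy)
  have a3 : ε ^ 3 * y ^ 2 ≤ ε ^ 2 * y ^ 2 :=
    mul_le_mul_of_nonneg_right (by nlinarith [sq_nonneg ε]) (sq_nonneg y)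
  nlinarith [sq_nonneg (x - ε * y)]

/-- Since c θ = 1 / p, the terms without g cancel and the gap leaves c g (x² + ε² y²) inside the
bracket. The error I consumes at most half of it. Here x and y are the norms of the unstable and
stable parts, L and M their quadratic forms under T. -/
theorem cone_growth_le {c g p θ ε x y L M I : ℝ} (hc : 0 < c) (hg : 0 < g) (hp : 0 < p)
    (hθ : c * θ = 1 / p) (hL : (θ + g) * x ^ 2 ≤ L) (hM : M ≤ (θ - g) * y ^ 2)
    (hI : -(p * c * g / 4 * (2 * x ^ 2 + 2 * ε ^ 2 * y ^ 2)) ≤ I) :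
    c * g * x ^ 2 ≤ 2 * (c * (L - ε ^ 2 * M) - 1 / p * (x ^ 2 - ε ^ 2 * y ^ 2) + 1 / p * I) := by
  have b1 := mul_le_mul_of_nonneg_left hL hc.le
  have b2 := mul_le_mul_of_nonneg_left hM (mul_nonneg hc.le (sq_nonneg ε))
  have b3 := mul_le_mul_of_nonneg_left hI (one_div_pos.2 hp).le
  have b4 : 1 / p * -(p * c * g / 4 * (2 * x ^ 2 + 2 * ε ^ 2 * y ^ 2))
      = -(c * g / 2 * (x ^ 2 + ε ^ 2 * y ^ 2)) := by field_simp; ring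
  have b5 : 0 ≤ c * g * (ε ^ 2 * y ^ 2) := by positivity
  have b6 : c * ((θ + g) * x ^ 2) = 1 / p * x ^ 2 + c * g * x ^ 2 := by rw [← hθ]; ring
  have b7 : c * ε ^ 2 * ((θ - g) * y ^ 2) = 1 / p * (ε ^ 2 * y ^ 2) - c * g * (ε ^ 2 * y ^ 2) := by
    rw [← hθ]; ring
  rw [b4] at b3
  rw [b6] at b1
  rw [b7] at b2
  linarith

/-- Bounded solutions of `(T q)' = c T q - f` with `f ≈ q / p` cannot enter the unstable cone. -/
theorem norm_projection_le_of_evolution [CompleteSpace H] {T P : H →L[ℝ] H} (hs : T.IsSymmetric)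
    (hpos : ∀ x, 0 ≤ inner ℝ (T x) x) {θ g c p : ℝ} (hg : 0 < g) (hp : 0 < p) (hc : 0 < c)
    (hθ : c * θ = 1 / p) (hPP : ∀ x, P (P x) = P x)
    (hPs : ∀ x y, inner ℝ (P x) y = inner ℝ x (P y)) (hTP : ∀ x, T (P x) = P (T x))
    (hlow : ∀ x, (θ + g) * ‖P x‖ ^ 2 ≤ inner ℝ (T (P x)) (P x))
    (hhigh : ∀ x, inner ℝ (T (x - P x)) (x - P x) ≤ (θ - g) * ‖x - P x‖ ^ 2)
    {t₀ B η ε : ℝ} {q f : ℝ → H} (hq : ContinuousOn q (Ioi t₀)) (hf : ContinuousOn f (Ioi t₀))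
    (hB : ∀ t, t₀ < t → ‖q t‖ ≤ B) (hε : 0 < ε) (hε1 : ε ≤ 1) (hη0 : 0 ≤ η)
    (hη : η ≤ p * c * g / 4 * ε)
    (hqf : ∀ t, t₀ < t → ‖q t - p • f t‖ ≤ η * ‖q t‖)
    (heq : ∀ h : H, ∀ s t : ℝ, t₀ < s → s ≤ t → inner ℝ (q t) (T h) - inner ℝ (q s) (T h)
      = ∫ τ in s..t, (c * inner ℝ (q τ) (T h) - inner ℝ (f τ) h)) {t : ℝ} (ht : t₀ < t) :
    ‖P (q t)‖ ≤ ε * ‖q t‖ := by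
  have hTs : ∀ x y, inner ℝ (T x) y = inner ℝ x (T y) := fun x y => hs x y
  -- The quadratic form of T A is positive inside a cone around the range of P whose aperture is
  -- governed by ε.
  set A : H →L[ℝ] H := P - ε ^ 2 • (ContinuousLinearMap.id ℝ H - P) with hA
  have hAx : ∀ x, A x = P x - ε ^ 2 • (x - P x) := fun x => by simp [hA]
  have hAs : ∀ x y, inner ℝ (A x) y = inner ℝ x (A y) := by
    intro x y
    simp only [hAx, inner_sub_left, inner_sub_right, real_inner_smul_left, real_inner_smul_right,
      hPs]
  have hTA : ∀ x, T (A x) = A (T x) := by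
    intro x; simp only [hAx, map_sub, map_smul, hTP]
  -- splitting of mixed quadratic expressions
  have hort : ∀ x y, inner ℝ (P x) (y - P y) = 0 := by
    intro x y; rw [hPs, map_sub, hPP, sub_self, inner_zero_right]
  have hort' : ∀ x y, inner ℝ (x - P x) (P y) = 0 := by
    intro x y; rw [real_inner_comm, hort]
  have hsplit : ∀ x, inner ℝ (T x) (A x)
      = inner ℝ (T (P x)) (P x) - ε ^ 2 * inner ℝ (T (x - P x)) (x - P x) := by
    intro x
    have e : T x = T (P x) + T (x - P x) := by rw [← map_add]; simp
    have e1 : inner ℝ (T (x - P x)) (P x) = 0 := by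
      rw [map_sub, hTP, hort']
    have e2 : inner ℝ (T (P x)) (x - P x) = 0 := by rw [hTP, hort]
    rw [hAx, inner_sub_right, real_inner_smul_right, e, inner_add_left, inner_add_left, e1, e2]
    ring
  have hnsplit : ∀ x, inner ℝ x (A x) = ‖P x‖ ^ 2 - ε ^ 2 * ‖x - P x‖ ^ 2 := by
    intro x
    have e1 : inner ℝ x (P x) = ‖P x‖ ^ 2 := by
      rw [← real_inner_self_eq_norm_sq, hPs, hPP]
    have e2 : inner ℝ x (x - P x) = ‖x - P x‖ ^ 2 := by
      have := hort x x
      rw [← real_inner_self_eq_norm_sq, inner_sub_left x, this, sub_zero]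
    rw [hAx, inner_sub_right, real_inner_smul_right, e1, e2]
  set Z : ℝ → ℝ := fun t => inner ℝ (T (q t)) (A (q t)) with hZ
  -- Only T q is differentiable. As T A is symmetric, Z(s) - Z(t) = ⟨T q(s) - T q(t), A (q(s) +
  -- q(t))⟩, so the product rule needs no more than continuity of q.
  have hZd : ∀ t, t₀ < t → HasDerivAt Z (inner ℝ (c • T (q t) - f t) (A (q t + q t))) t := by
    intro t ht
    have h1 := hasDerivAt_of_forall_inner_eq_integral hs hq hf heq ht
    rw [hasDerivAt_iff_tendsto_slope] at h1 ⊢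
    have h2 : Tendsto (fun s => A (q s + q t)) (𝓝[≠] t) (𝓝 (A (q t + q t))) := by
      have hqt : Tendsto q (𝓝[≠] t) (𝓝 (q t)) :=
        (hq.continuousAt (Ioi_mem_nhds ht)).tendsto.mono_left nhdsWithin_le_nhds
      exact (A.continuous.tendsto _).comp (hqt.add_const _)
    refine (h1.inner h2).congr fun s => ?_
    simp only [slope_def_module, hZ]
    rw [real_inner_smul_left, smul_eq_mul]
    congr 1
    rw [map_add, inner_add_right, inner_sub_left, inner_sub_left]
    have : inner ℝ (T (q s)) (A (q t)) = inner ℝ (T (q t)) (A (q s)) := by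
      rw [hTs, hTA, ← hAs, real_inner_comm]
    linarith
  have hlowpos : ∀ x, inner ℝ (T (P x)) (P x) ≤ ‖T‖ * ‖P x‖ ^ 2 := by
    intro x
    calc inner ℝ (T (P x)) (P x) ≤ ‖T (P x)‖ * ‖P x‖ := real_inner_le_norm _ _
      _ ≤ (‖T‖ * ‖P x‖) * ‖P x‖ := by gcongr; exact T.le_opNorm _
      _ = _ := by ring
  -- Positivity of T allows the stable term to be dropped.
  have hZle : ∀ t, Z t ≤ (‖T‖ + 1) * ‖P (q t)‖ ^ 2 := by
    intro t
    have h1 := hlowpos (q t)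
    have h2 := mul_nonneg (sq_nonneg ε) (hpos (q t - P (q t)))
    simp only [hZ]
    rw [hsplit]
    nlinarith [sq_nonneg ‖P (q t)‖]
  have hPle : ∀ x, ‖P x‖ ≤ ‖x‖ := by
    intro x
    have h1 : ‖P x‖ ^ 2 ≤ ‖x‖ * ‖P x‖ := by
      rw [← real_inner_self_eq_norm_sq, hPs, hPP]
      exact real_inner_le_norm _ _
    by_contra! h
    nlinarith [norm_nonneg x, norm_nonneg (P x)]
  have hZ0 : Z t ≤ 0 := by
    refine nonpos_of_hasDerivAt_of_bddAbove (b := c * g / (‖T‖ + 1)) (B := (‖T‖ + 1) * B ^ 2)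
      (by positivity) hZd ?_ ?_ ht
    · intro t ht
      have hT1 : 0 < ‖T‖ + 1 := by positivity
      have hb : c * g / (‖T‖ + 1) * Z t ≤ c * g * ‖P (q t)‖ ^ 2 := by
        rw [div_mul_eq_mul_div, div_le_iff₀ hT1]
        have := mul_le_mul_of_nonneg_left (hZle t) (mul_pos hc hg).le
        linarith
      refine hb.trans ?_
      set x := ‖P (q t)‖ with hx
      set y := ‖q t - P (q t)‖ with hy
      set r := q t - p • f t with hr
      -- The error term r = q - p f separates the linearised equation from the remainder.
      have hfr : f t = (1 / p) • q t - (1 / p) • r := by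
        rw [hr, smul_sub, smul_smul, one_div, inv_mul_cancel₀ hp.ne', one_smul]; simp
      have e1 : inner ℝ (c • T (q t) - f t) (A (q t + q t))
          = 2 * (c * inner ℝ (T (q t)) (A (q t)) - (1 / p) * inner ℝ (q t) (A (q t))
            + (1 / p) * inner ℝ r (A (q t))) := by
        rw [hfr, map_add, inner_add_right, inner_sub_left, inner_sub_left, real_inner_smul_left,
          real_inner_smul_left, real_inner_smul_left]
        ring
      have hAn : ‖A (q t)‖ ≤ x + ε ^ 2 * y := by
        rw [hAx]
        refine (norm_sub_le _ _).trans ?_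
        rw [norm_smul, Real.norm_eq_abs, abs_of_nonneg (sq_nonneg ε)]
      have hqn : ‖q t‖ ≤ x + y := by
        calc ‖q t‖ = ‖P (q t) + (q t - P (q t))‖ := by simp
          _ ≤ _ := norm_add_le _ _
      have hx0 : 0 ≤ x := norm_nonneg _
      have hy0 : 0 ≤ y := norm_nonneg _
      have hrA : -(p * c * g / 4 * (2 * x ^ 2 + 2 * ε ^ 2 * y ^ 2)) ≤ inner ℝ r (A (q t)) := by
        have h1 : |inner ℝ r (A (q t))| ≤ ‖r‖ * ‖A (q t)‖ := abs_real_inner_le_norm _ _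
        have h2 : ‖r‖ * ‖A (q t)‖ ≤ (η * (x + y)) * (x + ε ^ 2 * y) := by
          gcongr
          exact (hqf t ht).trans (by gcongr)
        have h3 : (η * (x + y)) * (x + ε ^ 2 * y)
            ≤ (p * c * g / 4 * ε * (x + y)) * (x + ε ^ 2 * y) := by gcongr
        have h4 := mul_add_mul_add_sq_le hε.le hε1 hx0 hy0
        have hk : 0 ≤ p * c * g / 4 := by positivity
        have h5 := mul_le_mul_of_nonneg_left h4 hk
        have := neg_abs_le (inner ℝ r (A (q t)))
        linarith
      have hL := hlow (q t)
      have hH := hhigh (q t)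
      rw [e1, hsplit, hnsplit]
      exact cone_growth_le hc hg hp hθ hL hH hrA
    · intro t ht
      refine (hZle t).trans ?_
      gcongr
      exact (hPle _).trans (hB t ht)
  -- With Z ≤ 0, the gap bounds give θ ‖P q‖² ≤ ε² (θ - g) ‖q - P q‖² ≤ ε² θ ‖q‖².
  have h1 := hlow (q t)
  have h2 := hhigh (q t)
  have h3 : inner ℝ (T (P (q t))) (P (q t)) - ε ^ 2 * inner ℝ (T (q t - P (q t))) (q t - P (q t))
      ≤ 0 := by rw [← hsplit]; exact hZ0
  have hθ0 : 0 < θ := by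
    have : 0 < c * θ := by rw [hθ]; positivity
    exact pos_of_mul_pos_right this hc.le
  have hle : ‖q t - P (q t)‖ ^ 2 ≤ ‖q t‖ ^ 2 := by
    have e : ‖q t‖ ^ 2 = ‖P (q t)‖ ^ 2 + ‖q t - P (q t)‖ ^ 2 := by
      have := norm_add_sq_real (P (q t)) (q t - P (q t))
      rw [hort] at this
      simpa using this
    nlinarith [sq_nonneg ‖P (q t)‖]
  have h4 : θ * ‖P (q t)‖ ^ 2 ≤ θ * (ε * ‖q t‖) ^ 2 := by
    have c1 := mul_le_mul_of_nonneg_left h2 (sq_nonneg ε)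
    have c2 : (θ - g) * ‖q t - P (q t)‖ ^ 2 ≤ θ * ‖q t‖ ^ 2 := by
      nlinarith [sq_nonneg ‖q t - P (q t)‖]
    have c3 := mul_le_mul_of_nonneg_left c2 (sq_nonneg ε)
    nlinarith [sq_nonneg ‖P (q t)‖]
  exact abs_le_of_sq_le_sq' (le_of_mul_le_mul_left h4 hθ0) (by positivity) |>.2

end ConeInvariance

/-! ### Gradients of test functions -/

section Gradient

variable {F : Type*} [NormedAddCommGroup F] [InnerProductSpace ℝ F] [CompleteSpace F]

theorem ContDiff.continuous_gradient {φ : F → ℝ} {n : WithTop ℕ∞} (h : ContDiff ℝ n φ)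
    (hn : n ≠ 0) : Continuous (gradient φ) :=
  (InnerProductSpace.toDual ℝ F).symm.continuous.comp (h.continuous_fderiv hn)

theorem tsupport_gradient_subset (φ : F → ℝ) : tsupport (gradient φ) ⊆ tsupport φ := by
  refine closure_minimal (fun x hx => ?_) (isClosed_tsupport φ)
  refine support_fderiv_subset ℝ (fun h => hx ?_)
  simp [gradient, h]

theorem HasCompactSupport.gradient {φ : F → ℝ} (h : HasCompactSupport φ) :
    HasCompactSupport (gradient φ) :=
  h.of_isClosed_subset (isClosed_tsupport _) (tsupport_gradient_subset φ)

end Gradient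

/-! ### Cauchy–Schwarz on a finite measure space -/

section CauchySchwarz

/-- The integral of (m g - I)² is nonnegative and equals m (m ∫ g² - I²), where m is the total mass
and I = ∫ g; m = 0 is treated apart. -/
theorem sq_integral_le_measureReal_univ_mul {X : Type*} [MeasurableSpace X] {ν : Measure X}
    [IsFiniteMeasure ν] {g : X → ℝ} (hg : Integrable g ν) (hg2 : Integrable (fun x => g x ^ 2) ν) :
    (∫ x, g x ∂ν) ^ 2 ≤ ν.real univ * ∫ x, g x ^ 2 ∂ν := by
  set m := ν.real univ
  set I := ∫ x, g x ∂ν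
  have h : 0 ≤ ∫ x, (m * g x - I) ^ 2 ∂ν := integral_nonneg fun x => sq_nonneg _
  have e : ∫ x, (m * g x - I) ^ 2 ∂ν
      = m ^ 2 * (∫ x, g x ^ 2 ∂ν) - 2 * m * I * I + I ^ 2 * m := by
    have : ∀ x, (m * g x - I) ^ 2 = m ^ 2 * g x ^ 2 - 2 * m * I * g x + I ^ 2 := fun x => by ring
    simp_rw [this]
    have h12 : Integrable (fun x => m ^ 2 * g x ^ 2 - 2 * m * I * g x) ν :=
      (hg2.const_mul _).sub (hg.const_mul _)
    rw [integral_add h12 (integrable_const _), integral_sub (hg2.const_mul _) (hg.const_mul _), integral_const_mul, integral_const_mul,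
      integral_const, smul_eq_mul]
    ring
  rw [e] at h
  have hm : 0 ≤ m := measureReal_nonneg
  rcases hm.eq_or_lt with hm0 | hm0
  · have : ν = 0 := by
      rw [← Measure.measure_univ_eq_zero]
      exact (measureReal_eq_zero_iff).1 hm0.symm
    have hI : I = 0 := by simp [I, this]
    rw [hI, ← hm0]; simp
  · have : 0 ≤ m * (m * (∫ x, g x ^ 2 ∂ν) - I ^ 2) := by nlinarith
    have := nonneg_of_mul_nonneg_right this hm0
    linarith

end CauchySchwarz

/-! ### Translation estimates and the Poincaré inequality -/

section Translation

variable {N : ℕ} {φ : Space N → ℝ}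

/-- The fundamental theorem of calculus on the segment from x to x + h, then Cauchy–Schwarz on the
unit interval. -/
theorem sq_sub_translate_le (hφ : ContDiff ℝ 1 φ) (x h : Space N) :
    (φ (x + h) - φ x) ^ 2 ≤ ‖h‖ ^ 2 * ∫ s in Ioc (0 : ℝ) 1, ‖gradient φ (x + s • h)‖ ^ 2 := by
  have hgc := hφ.continuous_gradient one_ne_zero
  have hd : ∀ s : ℝ, HasDerivAt (fun s : ℝ => φ (x + s • h))
      (inner ℝ (gradient φ (x + s • h)) h) s := by
    intro s
    have h1 : HasDerivAt (fun s : ℝ => x + s • h) h s := by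
      simpa using ((hasDerivAt_id s).smul_const h).const_add x
    have h2 := (hφ.differentiable one_ne_zero (x + s • h)).hasFDerivAt.comp_hasDerivAt s h1
    rw [inner_gradient_left]
    exact h2
  have hcont : Continuous fun s : ℝ => inner ℝ (gradient φ (x + s • h)) h := by fun_prop
  have hcont2 : Continuous fun s : ℝ => ‖gradient φ (x + s • h)‖ ^ 2 := by fun_prop
  have hftc : ∫ s in Ioc (0 : ℝ) 1, inner ℝ (gradient φ (x + s • h)) h = φ (x + h) - φ x := by
    rw [← intervalIntegral.integral_of_le zero_le_one,
      intervalIntegral.integral_eq_sub_of_hasDerivAt (fun s _ => hd s)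
        (hcont.intervalIntegrable _ _)]
    simp
  have hint : ∀ g : ℝ → ℝ, Continuous g → Integrable g (volume.restrict (Ioc (0 : ℝ) 1)) :=
    fun g hg => (hg.continuousOn.integrableOn_Icc).mono_set Ioc_subset_Icc_self
  have := sq_integral_le_measureReal_univ_mul (hint _ hcont) (hint _ (hcont.pow 2))
  rw [hftc] at this
  refine this.trans ?_
  rw [show (volume.restrict (Ioc (0 : ℝ) 1)).real univ = 1 by simp, one_mul,
    ← integral_const_mul]
  refine integral_mono (hint _ (hcont.pow 2)) ((hint _ hcont2).const_mul _) fun s => ?_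
  have h1 := abs_real_inner_le_norm (gradient φ (x + s • h)) h
  have h2 : |inner ℝ (gradient φ (x + s • h)) h| ^ 2 ≤ (‖gradient φ (x + s • h)‖ * ‖h‖) ^ 2 := by
    gcongr
  rw [sq_abs] at h2
  simp only
  nlinarith

theorem HasCompactSupport.sq {φ : Space N → ℝ} (h : HasCompactSupport φ) :
    HasCompactSupport fun x => φ x ^ 2 :=
  h.mono fun x hx hx' => hx (by simp [hx'])

/-- `‖φ(· + h) - φ‖₂ ≤ ‖h‖ ‖∇φ‖₂`. -/
theorem integral_sq_sub_translate_le (hφ : ContDiff ℝ 1 φ) (hc : HasCompactSupport φ)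
    (h : Space N) :
    ∫ x, (φ (x + h) - φ x) ^ 2 ≤ ‖h‖ ^ 2 * ∫ x, ‖gradient φ x‖ ^ 2 := by
  have hgc := hφ.continuous_gradient one_ne_zero
  have hgi : Integrable fun x => ‖gradient φ x‖ ^ 2 :=
    (hgc.norm.pow 2).integrable_of_hasCompactSupport hc.gradient.norm.sq
  have hprod : Integrable (Function.uncurry fun (x : Space N) (s : ℝ) =>
      ‖gradient φ (x + s • h)‖ ^ 2) (volume.prod (volume.restrict (Ioc (0 : ℝ) 1))) := by
    rw [integrable_prod_iff']
    · refine ⟨Eventually.of_forall fun s => hgi.comp_add_right (s • h), ?_⟩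
      have : (fun s : ℝ => ∫ x : Space N, ‖Function.uncurry (fun (x : Space N) (s : ℝ) =>
          ‖gradient φ (x + s • h)‖ ^ 2) (x, s)‖) = fun _ => ∫ x, ‖gradient φ x‖ ^ 2 := by
        funext s
        simp only [Function.uncurry, norm_pow, norm_norm]
        exact integral_add_right_eq_self (fun x => ‖gradient φ x‖ ^ 2) (s • h)
      rw [this]
      exact integrable_const _
    · have : Continuous (Function.uncurry fun (x : Space N) (s : ℝ) =>
          ‖gradient φ (x + s • h)‖ ^ 2) := by
        unfold Function.uncurry; fun_prop
      exact this.aestronglyMeasurable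
  have hsub : Integrable fun x => (φ (x + h) - φ x) ^ 2 := by
    refine Continuous.integrable_of_hasCompactSupport (by have := hφ.continuous; fun_prop) ?_
    have h1 : HasCompactSupport fun x => φ (x + h) := hc.comp_homeomorph (Homeomorph.addRight h)
    exact (h1.sub hc).sq
  calc ∫ x, (φ (x + h) - φ x) ^ 2
      ≤ ∫ x, ‖h‖ ^ 2 * ∫ s in Ioc (0 : ℝ) 1, ‖gradient φ (x + s • h)‖ ^ 2 :=
        integral_mono hsub (hprod.integral_prod_left.const_mul _)
          fun x => sq_sub_translate_le hφ x h
    _ = ‖h‖ ^ 2 * ∫ s in Ioc (0 : ℝ) 1, ∫ x, ‖gradient φ (x + s • h)‖ ^ 2 := by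
        rw [integral_const_mul, integral_integral_swap hprod]
    _ = ‖h‖ ^ 2 * ∫ x, ‖gradient φ x‖ ^ 2 := by
        congr 1
        have : (fun s : ℝ => ∫ x : Space N, ‖gradient φ (x + s • h)‖ ^ 2)
            = fun _ => ∫ x, ‖gradient φ x‖ ^ 2 := by
          funext s
          exact integral_add_right_eq_self (fun x => ‖gradient φ x‖ ^ 2) (s • h)
        rw [this]; simp

/-- Poincaré inequality on bounded sets. -/
theorem exists_poincare (hN : 1 ≤ N) {Ω : Set (Space N)} (hΩ : Bornology.IsBounded Ω) :
    ∃ C : ℝ, 0 < C ∧ ∀ φ : Space N → ℝ, ContDiff ℝ 1 φ → HasCompactSupport φ →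
      tsupport φ ⊆ Ω → ∫ x, φ x ^ 2 ≤ C ^ 2 * ∫ x, ‖gradient φ x‖ ^ 2 := by
  obtain ⟨R, hR⟩ := hΩ.subset_closedBall 0
  set R' := |R| + 1
  have hR' : 0 < R' := by positivity
  have hi : Fin N := ⟨0, hN⟩
  -- This translation is longer than the diameter of a ball containing Ω, so φ and its translate
  -- have disjoint supports and the translation estimate controls 2 ∫ φ².
  set h : Space N := EuclideanSpace.single hi (2 * R') with hh
  have hnorm : ‖h‖ = 2 * R' := by simp [hh, abs_of_pos hR']
  refine ⟨2 * R', by positivity, fun φ hφ hc hs => ?_⟩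
  have htr := integral_sq_sub_translate_le hφ hc h
  have hsq : Integrable fun x => φ x ^ 2 :=
    (hφ.continuous.pow 2).integrable_of_hasCompactSupport hc.sq
  have hz : ∀ x, φ x ≠ 0 → ‖x‖ ≤ |R| := fun x hx => by
    have := hR (hs (subset_tsupport _ hx))
    rw [mem_closedBall_zero_iff] at this
    exact this.trans (le_abs_self R)
  have hcross : ∀ x, (φ (x + h) - φ x) ^ 2 = φ (x + h) ^ 2 + φ x ^ 2 := by
    intro x
    have : φ (x + h) * φ x = 0 := by
      by_contra hne
      have h1 := hz _ (left_ne_zero_of_mul hne)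
      have h2 := hz _ (right_ne_zero_of_mul hne)
      have h3 : ‖h‖ ≤ ‖x + h‖ + ‖x‖ := by
        calc ‖h‖ = ‖(x + h) - x‖ := by simp
          _ ≤ _ := norm_sub_le _ _
      rw [hnorm] at h3
      simp only [R'] at h3
      linarith [abs_nonneg R]
    linear_combination (-2) * this
  simp_rw [hcross] at htr
  rw [integral_add (hsq.comp_add_right h) hsq,
    integral_add_right_eq_self (fun x => φ x ^ 2) h, hnorm] at htr
  have : 0 ≤ ∫ x, φ x ^ 2 := integral_nonneg fun x => sq_nonneg _
  linarith

end Translation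

/-! ### Averages over the cells of a grid -/

section Cells

variable {N : ℕ}

/-- The cell of the grid of mesh `ℓ` with index `n`. -/
def gridCell (ℓ : ℝ) (n : Fin N → ℤ) : Set (Space N) := {x | ∀ i, ⌊x i / ℓ⌋ = n i}

theorem gridCell_eq_preimage {ℓ : ℝ} (hℓ : 0 < ℓ) (n : Fin N → ℤ) :
    gridCell ℓ n = (WithLp.ofLp : Space N → Fin N → ℝ) ⁻¹'
      (univ.pi fun i => Ico (ℓ * n i) (ℓ * n i + ℓ)) := by
  ext x
  simp only [gridCell, mem_ofPred_eq, mem_preimage, mem_univ_pi, mem_Ico, Int.floor_eq_iff]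
  refine forall_congr' fun i => ?_
  rw [le_div_iff₀ hℓ, div_lt_iff₀ hℓ]
  constructor <;> rintro ⟨h1, h2⟩ <;> constructor <;> linarith

theorem measurableSet_gridCell {ℓ : ℝ} (hℓ : 0 < ℓ) (n : Fin N → ℤ) :
    MeasurableSet (gridCell ℓ n) := by
  rw [gridCell_eq_preimage hℓ]
  exact (PiLp.volume_preserving_ofLp _).measurable
    (MeasurableSet.univ_pi fun i => measurableSet_Ico)

theorem volume_gridCell {ℓ : ℝ} (hℓ : 0 < ℓ) (n : Fin N → ℤ) :
    volume (gridCell ℓ n) = ENNReal.ofReal (ℓ ^ N) := by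
  rw [gridCell_eq_preimage hℓ, (PiLp.volume_preserving_ofLp _).measure_preimage
    (MeasurableSet.univ_pi fun i => measurableSet_Ico).nullMeasurableSet, Real.volume_pi_Ico]
  simp [ENNReal.ofReal_pow hℓ.le]

/-- The cube of half side `ℓ`. -/
def gridBox (N : ℕ) (ℓ : ℝ) : Set (Space N) :=
  (WithLp.ofLp : Space N → Fin N → ℝ) ⁻¹' (univ.pi fun _ => Icc (-ℓ) ℓ)

theorem measurableSet_gridBox (ℓ : ℝ) : MeasurableSet (gridBox N ℓ) :=
  (PiLp.volume_preserving_ofLp _).measurable (MeasurableSet.univ_pi fun _ => measurableSet_Icc)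

theorem volume_gridBox {ℓ : ℝ} (hℓ : 0 < ℓ) :
    volume (gridBox N ℓ) = ENNReal.ofReal ((2 * ℓ) ^ N) := by
  rw [gridBox, (PiLp.volume_preserving_ofLp _).measure_preimage
    (MeasurableSet.univ_pi fun i => measurableSet_Icc).nullMeasurableSet, volume_pi_pi]
  simp [ENNReal.ofReal_pow (by positivity : 0 ≤ 2 * ℓ), ← two_mul]

theorem norm_sq_le_of_mem_gridBox {ℓ : ℝ} {h : Space N} (hh : h ∈ gridBox N ℓ) :
    ‖h‖ ^ 2 ≤ N * ℓ ^ 2 := by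
  rw [EuclideanSpace.norm_sq_eq]
  have : ∀ i, ‖h i‖ ^ 2 ≤ ℓ ^ 2 := by
    intro i
    have := (hh i (mem_univ i))
    rw [Real.norm_eq_abs, sq_abs]
    exact sq_le_sq' this.1 this.2
  calc ∑ i, ‖h i‖ ^ 2 ≤ ∑ _i : Fin N, ℓ ^ 2 := Finset.sum_le_sum fun i _ => this i
    _ = N * ℓ ^ 2 := by simp

theorem sub_mem_gridBox {ℓ : ℝ} (hℓ : 0 < ℓ) {n : Fin N → ℤ} {x y : Space N}
    (hx : x ∈ gridCell ℓ n) (hy : y ∈ gridCell ℓ n) : y - x ∈ gridBox N ℓ := by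
  rw [gridCell_eq_preimage hℓ] at hx hy
  intro i _
  have h1 := hx i (mem_univ i)
  have h2 := hy i (mem_univ i)
  simp only [mem_Ico, mem_Icc] at h1 h2 ⊢
  have : (y - x).ofLp i = y.ofLp i - x.ofLp i := rfl
  rw [this]
  constructor <;> linarith

/-- Oscillation of a test function around its cell average, pointwise. -/
theorem sq_sub_cellAverage_le {ℓ : ℝ} (hℓ : 0 < ℓ) {φ : Space N → ℝ} (hφ : Continuous φ)
    (hc : HasCompactSupport φ) {n : Fin N → ℤ} {x : Space N} (hx : x ∈ gridCell ℓ n) :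
    (φ x - (ℓ ^ N)⁻¹ * ∫ y in gridCell ℓ n, φ y) ^ 2
      ≤ (ℓ ^ N)⁻¹ * ∫ h in gridBox N ℓ, (φ (x + h) - φ x) ^ 2 := by
  have hm : (0 : ℝ) < ℓ ^ N := by positivity
  have hvol := volume_gridCell hℓ n
  have : IsFiniteMeasure (volume.restrict (gridCell ℓ n)) :=
    ⟨by rw [Measure.restrict_apply_univ, hvol]; exact ENNReal.ofReal_lt_top⟩
  have hreal : (volume.restrict (gridCell ℓ n)).real univ = ℓ ^ N := by
    simp [Measure.real, hvol, hm.le]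
  obtain ⟨M, hM⟩ := hc.exists_bound_of_continuous hφ
  have hM0 : 0 ≤ M := (norm_nonneg _).trans (hM 0)
  have hi : ∀ ν : Measure (Space N), IsFiniteMeasure ν → ∀ k : ℕ, ∀ z : Space N,
      Integrable (fun y => (φ (z + y) - φ x) ^ k) ν := by
    intro ν hν k z
    refine Integrable.of_bound (by
      have : Continuous fun y => (φ (z + y) - φ x) ^ k := by fun_prop
      exact this.aestronglyMeasurable) ((2 * M) ^ k) (Eventually.of_forall fun y => ?_)
    rw [norm_pow]
    gcongr
    exact (norm_sub_le _ _).trans (by linarith [hM (z + y), hM x])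
  have hi1 : Integrable (fun y => φ y - φ x) (volume.restrict (gridCell ℓ n)) := by
    simpa using hi _ this 1 0
  have hi2 : Integrable (fun y => (φ y - φ x) ^ 2) (volume.restrict (gridCell ℓ n)) := by
    simpa using hi _ this 2 0
  have hφi : Integrable φ (volume.restrict (gridCell ℓ n)) :=
    (hφ.integrable_of_hasCompactSupport hc).restrict
  have hI : ∫ y in gridCell ℓ n, (φ y - φ x) = (∫ y in gridCell ℓ n, φ y) - ℓ ^ N * φ x := by
    rw [integral_sub hφi (integrable_const _), integral_const, hreal, smul_eq_mul]
  have h1 := sq_integral_le_measureReal_univ_mul hi1 hi2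
  rw [hI, hreal] at h1
  -- Substitute y = x + h: the cell translated by -x lies inside the box, and the integrand is
  -- nonnegative.
  have h2 : ∫ y in gridCell ℓ n, (φ y - φ x) ^ 2 ≤ ∫ h in gridBox N ℓ, (φ (x + h) - φ x) ^ 2 := by
    have hb : IsFiniteMeasure (volume.restrict (gridBox N ℓ)) :=
      ⟨by rw [Measure.restrict_apply_univ, volume_gridBox hℓ]; exact ENNReal.ofReal_lt_top⟩
    have hib : IntegrableOn (fun h => (φ (x + h) - φ x) ^ 2) (gridBox N ℓ) := hi _ hb 2 x
    rw [← integral_indicator (measurableSet_gridCell hℓ n),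
      ← integral_indicator (measurableSet_gridBox ℓ),
      ← integral_add_left_eq_self _ x]
    refine integral_mono ?_ (hib.integrable_indicator (measurableSet_gridBox ℓ)) fun h => ?_
    · exact ((IntegrableOn.integrable_indicator hi2
        (measurableSet_gridCell hℓ n))).comp_add_left x
    · by_cases hxh : x + h ∈ gridCell ℓ n
      · have : h ∈ gridBox N ℓ := by simpa using sub_mem_gridBox hℓ hx hxh
        simp [hxh, this]
      · simp only [hxh, not_false_eq_true, indicator_of_notMem]
        exact indicator_nonneg (fun _ _ => sq_nonneg _) _
  have h3 : (φ x - (ℓ ^ N)⁻¹ * ∫ y in gridCell ℓ n, φ y) ^ 2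
      = (ℓ ^ N)⁻¹ * ((ℓ ^ N)⁻¹ * ((∫ y in gridCell ℓ n, φ y) - ℓ ^ N * φ x) ^ 2) := by
    field_simp
    ring
  rw [h3]
  gcongr
  rw [inv_mul_le_iff₀ hm]
  exact h1.trans (by gcongr)

/-- Approximation of test functions by their averages on the cells of a grid. -/
theorem exists_finset_cellAverage_approx {Ω : Set (Space N)} (hΩm : MeasurableSet Ω)
    (hΩ : Bornology.IsBounded Ω)
    {ℓ : ℝ} (hℓ : 0 < ℓ) :
    ∃ S : Finset (Fin N → ℤ), ∀ φ : Space N → ℝ, ContDiff ℝ 1 φ → HasCompactSupport φ →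
      tsupport φ ⊆ Ω →
      ∫ x in Ω, (φ x - ∑ n ∈ S, (ℓ ^ N)⁻¹ * (∫ y in gridCell ℓ n, φ y ∂(volume.restrict Ω))
        * (gridCell ℓ n).indicator (fun _ => (1 : ℝ)) x) ^ 2
        ≤ 2 ^ N * (N * ℓ ^ 2) * ∫ x, ‖gradient φ x‖ ^ 2 := by
  classical
  obtain ⟨R, hR⟩ := hΩ.subset_closedBall 0
  -- All cells that can meet the ball of radius R, hence all cells meeting Ω.
  set S : Finset (Fin N → ℤ) := Fintype.piFinset fun _ => Finset.Icc ⌊-R / ℓ⌋ ⌊R / ℓ⌋ with hS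
  refine ⟨S, fun φ hφ hc hs => ?_⟩
  have hfin : IsFiniteMeasure (volume.restrict Ω) :=
    ⟨by rw [Measure.restrict_apply_univ]; exact hΩ.measure_lt_top⟩
  have hbfin : IsFiniteMeasure (volume.restrict (gridBox N ℓ)) :=
    ⟨by rw [Measure.restrict_apply_univ, volume_gridBox hℓ]; exact ENNReal.ofReal_lt_top⟩
  have hφc := hφ.continuous
  have hpt : ∀ x ∈ Ω, (φ x - ∑ n ∈ S, (ℓ ^ N)⁻¹ *
      (∫ y in gridCell ℓ n, φ y ∂(volume.restrict Ω))
        * (gridCell ℓ n).indicator (fun _ => (1 : ℝ)) x) ^ 2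
      ≤ (ℓ ^ N)⁻¹ * ∫ h in gridBox N ℓ, (φ (x + h) - φ x) ^ 2 := by
    intro x hx
    set n₀ : Fin N → ℤ := fun i => ⌊x i / ℓ⌋ with hn₀
    have hxn : x ∈ gridCell ℓ n₀ := fun i => rfl
    have hn₀S : n₀ ∈ S := by
      rw [hS, Fintype.mem_piFinset]
      intro i
      have h1 := hR hx
      rw [mem_closedBall_zero_iff] at h1
      have h2 : |x i| ≤ R := (PiLp.norm_apply_le x i).trans h1
      rw [abs_le] at h2
      rw [Finset.mem_Icc]
      exact ⟨Int.floor_mono (by gcongr; exact h2.1), Int.floor_mono (by gcongr; exact h2.2)⟩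
    rw [Finset.sum_eq_single n₀]
    · rw [indicator_of_mem hxn, mul_one, Measure.restrict_restrict (measurableSet_gridCell hℓ n₀)]
      -- φ vanishes off Ω, so cells crossing the boundary need no special treatment.
      have : ∫ y in gridCell ℓ n₀ ∩ Ω, φ y = ∫ y in gridCell ℓ n₀, φ y := by
        refine (setIntegral_eq_of_subset_of_forall_sdiff_eq_zero (measurableSet_gridCell hℓ n₀)
          inter_subset_left fun y hy => ?_).symm
        by_contra hne
        exact hy.2 ⟨hy.1, hs (subset_tsupport _ hne)⟩
      rw [this]
      exact sq_sub_cellAverage_le hℓ hφc hc hxn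
    · intro n _ hn
      have : x ∉ gridCell ℓ n := fun h => hn (funext fun i => (h i).symm)
      rw [indicator_of_notMem this, mul_zero]
    · exact fun h => absurd hn₀S h
  obtain ⟨M, hM⟩ := hc.exists_bound_of_continuous hφc
  have hprod : Integrable (Function.uncurry fun (x : Space N) (h : Space N) =>
      (φ (x + h) - φ x) ^ 2) ((volume.restrict Ω).prod (volume.restrict (gridBox N ℓ))) := by
    have hcont : Continuous (Function.uncurry fun (x : Space N) (h : Space N) =>
      (φ (x + h) - φ x) ^ 2) := by unfold Function.uncurry; fun_prop
    refine Integrable.of_bound hcont.aestronglyMeasurable ((2 * M) ^ 2)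
      (Eventually.of_forall fun z => ?_)
    simp only [Function.uncurry]
    rw [norm_pow]
    gcongr
    exact (norm_sub_le _ _).trans (by linarith [hM (z.1 + z.2), hM z.1])
  have hinner : ∀ h, ∫ x in Ω, (φ (x + h) - φ x) ^ 2
      ≤ ‖h‖ ^ 2 * ∫ x, ‖gradient φ x‖ ^ 2 := by
    intro h
    refine (setIntegral_le_integral ?_ (Eventually.of_forall fun x => sq_nonneg _)).trans
      (integral_sq_sub_translate_le hφ hc h)
    refine Continuous.integrable_of_hasCompactSupport (by fun_prop) ?_
    have h1 : HasCompactSupport fun x => φ (x + h) := hc.comp_homeomorph (Homeomorph.addRight h)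
    exact (h1.sub hc).sq
  have hG : 0 ≤ ∫ x, ‖gradient φ x‖ ^ 2 := integral_nonneg fun x => sq_nonneg _
  -- The factor 2^N is the ratio of the volumes of box and cell, and N ℓ² bounds ‖h‖² on the box.
  calc _ ≤ ∫ x in Ω, (ℓ ^ N)⁻¹ * ∫ h in gridBox N ℓ, (φ (x + h) - φ x) ^ 2 := by
        refine integral_mono_of_nonneg (Eventually.of_forall fun x => sq_nonneg _)
          (hprod.integral_prod_left.const_mul _) ?_
        exact (ae_restrict_iff' hΩm).2 (Eventually.of_forall hpt)
    _ = (ℓ ^ N)⁻¹ * ∫ h in gridBox N ℓ, ∫ x in Ω, (φ (x + h) - φ x) ^ 2 := by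
        rw [integral_const_mul, integral_integral_swap hprod]
    _ ≤ (ℓ ^ N)⁻¹ * ∫ h in gridBox N ℓ, (N * ℓ ^ 2) * ∫ x, ‖gradient φ x‖ ^ 2 := by
        gcongr ?_ * ?_
        refine setIntegral_mono_on hprod.integral_prod_right (integrable_const _)
          (measurableSet_gridBox ℓ) fun h hh => (hinner h).trans ?_
        gcongr
        exact norm_sq_le_of_mem_gridBox hh
    _ = _ := by
        rw [integral_const, smul_eq_mul]
        have : (volume.restrict (gridBox N ℓ)).real univ = (2 * ℓ) ^ N := by
          simp only [Measure.real, Measure.restrict_apply_univ, volume_gridBox hℓ]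
          exact ENNReal.toReal_ofReal (by positivity)
        rw [this, mul_pow]
        field_simp

end Cells

/-! ### H^1_0 as a space of gradients, and Rellich's theorem -/

noncomputable section

namespace FastDiffusion

section TestFunctions

variable {N : ℕ} {Ω : Set (Space N)}

theorem IsTestFunction.memLp {F : Type*} [NormedAddCommGroup F] [NormedSpace ℝ F]
    [MeasurableSpace F] [OpensMeasurableSpace F] {U : Set F} {ψ : F → ℝ} (h : IsTestFunction U ψ)
    (μ : Measure F) [IsFiniteMeasureOnCompacts μ] {q : ℝ≥0∞} : MemLp ψ q μ :=
  h.1.continuous.memLp_of_hasCompactSupport h.2.1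

theorem IsTestFunction.memLp_gradient {ψ : Space N → ℝ} (h : IsTestFunction Ω ψ)
    (μ : Measure (Space N)) [IsFiniteMeasureOnCompacts μ] {q : ℝ≥0∞} : MemLp (gradient ψ) q μ :=
  (h.1.continuous_gradient (by simp)).memLp_of_hasCompactSupport h.2.1.gradient

theorem gradient_add_apply' {φ ψ : Space N → ℝ} (hφ : Differentiable ℝ φ)
    (hψ : Differentiable ℝ ψ) : gradient (φ + ψ) = gradient φ + gradient ψ := by
  funext x
  simp [gradient, fderiv_add (hφ x) (hψ x)]

theorem gradient_const_smul_apply' {ψ : Space N → ℝ} (c : ℝ) (hψ : Differentiable ℝ ψ) :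
    gradient (c • ψ) = c • gradient ψ := by
  funext x
  simp [gradient, fderiv_const_smul (hψ x)]

theorem IsTestFunction.differentiable {ψ : Space N → ℝ} (h : IsTestFunction Ω ψ) :
    Differentiable ℝ ψ := h.1.differentiable (by simp)

/-- The space `C_c^∞(Ω)`. -/
def testFunctions (Ω : Set (Space N)) : Submodule ℝ (Space N → ℝ) where
  carrier := {ψ | IsTestFunction Ω ψ}
  add_mem' := by
    rintro φ ψ ⟨h1, h2, h3⟩ ⟨k1, k2, k3⟩
    exact ⟨h1.add k1, h2.add k2, (tsupport_add φ ψ).trans (union_subset h3 k3)⟩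
  zero_mem' := ⟨contDiff_const, HasCompactSupport.zero, by simp [tsupport]⟩
  smul_mem' := by
    rintro c ψ ⟨h1, h2, h3⟩
    exact ⟨contDiff_const.smul h1, h2.smul_left (f := fun _ => c),
      (tsupport_smul_subset_right (fun _ => c) ψ).trans h3⟩

/-- Test functions as elements of `L²(Ω)`. -/
def testToL2 (Ω : Set (Space N)) : testFunctions Ω →ₗ[ℝ] Lp ℝ 2 (volume.restrict Ω) where
  toFun ψ := (ψ.2.memLp (volume.restrict Ω)).toLp ψ
  map_add' φ ψ := MemLp.toLp_add (φ.2.memLp _) (ψ.2.memLp _)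
  map_smul' c ψ := MemLp.toLp_const_smul c (ψ.2.memLp _)

theorem IsTestFunction.toLp_gradient_add {φ ψ : Space N → ℝ} (hφ : IsTestFunction Ω φ)
    (hψ : IsTestFunction Ω ψ) (h : MemLp (gradient (φ + ψ)) 2 (volume.restrict Ω)) :
    h.toLp (gradient (φ + ψ)) = (hφ.memLp_gradient (volume.restrict Ω)).toLp (gradient φ)
      + (hψ.memLp_gradient (volume.restrict Ω)).toLp (gradient ψ) := by
  have e := gradient_add_apply' hφ.differentiable hψ.differentiable
  rw [← MemLp.toLp_add]
  congr 1

theorem IsTestFunction.toLp_gradient_smul {ψ : Space N → ℝ} (c : ℝ) (hψ : IsTestFunction Ω ψ)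
    (h : MemLp (gradient (c • ψ)) 2 (volume.restrict Ω)) :
    h.toLp (gradient (c • ψ)) = c • (hψ.memLp_gradient (volume.restrict Ω)).toLp (gradient ψ) := by
  have e := gradient_const_smul_apply' c hψ.differentiable
  rw [← MemLp.toLp_const_smul]
  congr 1

/-- Gradients of test functions as elements of `L²(Ω; ℝ^N)`. -/
def testGradient (Ω : Set (Space N)) :
    testFunctions Ω →ₗ[ℝ] Lp (Space N) 2 (volume.restrict Ω) where
  toFun ψ := MemLp.toLp (gradient (ψ : Space N → ℝ))
    (IsTestFunction.memLp_gradient (Ω := Ω) ψ.2 (volume.restrict Ω))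
  map_add' φ ψ := IsTestFunction.toLp_gradient_add (Ω := Ω) φ.2 ψ.2 _
  map_smul' c ψ := IsTestFunction.toLp_gradient_smul (Ω := Ω) c ψ.2 _

/-- The closed space of gradients of functions in `H^1_0(Ω)`. -/
def gradientSpace (Ω : Set (Space N)) : Submodule ℝ (Lp (Space N) 2 (volume.restrict Ω)) :=
  (LinearMap.range (testGradient Ω)).topologicalClosure

instance : CompleteSpace (gradientSpace Ω) :=
  (Submodule.isClosed_topologicalClosure _).completeSpace_coe

/-- The gradient as a map from test functions to the space of gradients. -/
def testToGradientSpace (Ω : Set (Space N)) : testFunctions Ω →ₗ[ℝ] gradientSpace Ω :=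
  (testGradient Ω).codRestrict (gradientSpace Ω) fun ψ =>
    Submodule.le_topologicalClosure _ (LinearMap.mem_range_self _ ψ)

theorem denseRange_testToGradientSpace : DenseRange (testToGradientSpace Ω) := by
  intro x
  have hx : (x : Lp (Space N) 2 (volume.restrict Ω)) ∈
      closure (LinearMap.range (testGradient Ω) : Set _) := x.2
  rw [closure_subtype]
  convert hx using 2
  ext y
  constructor
  · rintro ⟨_, ⟨ψ, rfl⟩, rfl⟩; exact ⟨ψ, rfl⟩
  · rintro ⟨ψ, rfl⟩; exact ⟨_, ⟨ψ, rfl⟩, rfl⟩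

/-- The embedding `H^1_0(Ω) → L²(Ω)`, as a map on gradients. -/
def gradientToL2 (Ω : Set (Space N)) : gradientSpace Ω →L[ℝ] Lp ℝ 2 (volume.restrict Ω) :=
  (testToL2 Ω).extendOfNorm (testToGradientSpace Ω)

theorem Lp_norm_sq_eq_integral {X E : Type*} [MeasurableSpace X] {μ : Measure X}
    [NormedAddCommGroup E] [InnerProductSpace ℝ E] (f : Lp E 2 μ) :
    ‖f‖ ^ 2 = ∫ x, ‖f x‖ ^ 2 ∂μ := by
  rw [← real_inner_self_eq_norm_sq, L2.inner_def]
  simp_rw [real_inner_self_eq_norm_sq]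

theorem norm_toLp_sq_eq_integral {X E : Type*} [MeasurableSpace X] {μ : Measure X}
    [NormedAddCommGroup E] [InnerProductSpace ℝ E] {f : X → E} (hf : MemLp f 2 μ) :
    ‖hf.toLp f‖ ^ 2 = ∫ x, ‖f x‖ ^ 2 ∂μ := by
  rw [Lp_norm_sq_eq_integral]
  exact integral_congr_ae (hf.coeFn_toLp.mono fun x hx => by simp only [hx])

theorem norm_testToGradientSpace_sq (ψ : testFunctions Ω) :
    ‖testToGradientSpace Ω ψ‖ ^ 2 = ∫ x, ‖gradient (ψ : Space N → ℝ) x‖ ^ 2 := by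
  have h : ‖testToGradientSpace Ω ψ‖ ^ 2
      = ∫ x in Ω, ‖gradient (ψ : Space N → ℝ) x‖ ^ 2 :=
    norm_toLp_sq_eq_integral (ψ.2.memLp_gradient _)
  rw [h]
  refine setIntegral_eq_integral_of_forall_compl_eq_zero fun x hx => ?_
  have : gradient (ψ : Space N → ℝ) x = 0 := by
    by_contra hne
    exact hx (ψ.2.2.2 (tsupport_gradient_subset _ (subset_tsupport _ hne)))
  simp [this]

theorem norm_testToL2_sq (ψ : testFunctions Ω) :
    ‖testToL2 Ω ψ‖ ^ 2 = ∫ x, (ψ : Space N → ℝ) x ^ 2 := by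
  have h : ‖testToL2 Ω ψ‖ ^ 2
      = ∫ x in Ω, ‖(ψ : Space N → ℝ) x‖ ^ 2 :=
    norm_toLp_sq_eq_integral (ψ.2.memLp _)
  simp_rw [Real.norm_eq_abs, sq_abs] at h
  rw [h]
  refine setIntegral_eq_integral_of_forall_compl_eq_zero fun x hx => ?_
  have : (ψ : Space N → ℝ) x = 0 := by
    by_contra hne
    exact hx (ψ.2.2.2 (subset_tsupport _ hne))
  simp [this]

theorem exists_norm_testToL2_le (hN : 1 ≤ N) (hΩ : Bornology.IsBounded Ω) :
    ∃ C : ℝ, ∀ ψ : testFunctions Ω, ‖testToL2 Ω ψ‖ ≤ C * ‖testToGradientSpace Ω ψ‖ := by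
  obtain ⟨C, hC, h⟩ := exists_poincare hN hΩ
  refine ⟨C, fun ψ => ?_⟩
  have := h ψ (ψ.2.1.of_le (by simp)) ψ.2.2.1 ψ.2.2.2
  rw [← norm_testToL2_sq, ← norm_testToGradientSpace_sq, ← mul_pow] at this
  exact (abs_le_of_sq_le_sq' this (by positivity)).2

/-- The Poincaré bound is what makes extension from the dense range of test gradients legitimate. -/
theorem gradientToL2_testToGradientSpace (hN : 1 ≤ N) (hΩ : Bornology.IsBounded Ω)
    (ψ : testFunctions Ω) : gradientToL2 Ω (testToGradientSpace Ω ψ) = testToL2 Ω ψ :=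
  LinearMap.extendOfNorm_eq denseRange_testToGradientSpace (exists_norm_testToL2_le hN hΩ) ψ

/-- Averaging over the cells of a grid. -/
def cellAverage (Ω : Set (Space N)) [IsFiniteMeasure (volume.restrict Ω)] {ℓ : ℝ} (hℓ : 0 < ℓ)
    (S : Finset (Fin N → ℤ)) :
    Lp ℝ 2 (volume.restrict Ω) →L[ℝ] Lp ℝ 2 (volume.restrict Ω) :=
  ∑ n ∈ S, (ℓ ^ N)⁻¹ • (innerSL ℝ (indicatorConstLp 2 (μ := volume.restrict Ω)
    (measurableSet_gridCell hℓ n) (measure_ne_top _ _) (1 : ℝ))).smulRight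
    (indicatorConstLp 2 (measurableSet_gridCell hℓ n) (measure_ne_top _ _) (1 : ℝ))

theorem isCompactOperator_sum {ι E F : Type*} [NormedAddCommGroup E] [NormedSpace ℝ E]
    [NormedAddCommGroup F] [NormedSpace ℝ F] (S : Finset ι) (A : ι → E →L[ℝ] F)
    (h : ∀ i, IsCompactOperator (A i)) : 
    IsCompactOperator ((∑ i ∈ S, A i : E →L[ℝ] F) : E → F) := by
  classical
  induction S using Finset.induction_on with
  | empty => simpa using (isCompactOperator_zero : IsCompactOperator (0 : E → F))
  | insert a s ha ih =>
    rw [Finset.sum_insert ha]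
    exact (h a).add ih

/-- The composites A ∘ J are compact and converge to J in operator norm; the norm bound need only be
checked on a dense set. -/
theorem isCompactOperator_of_forall_exists_approx {D X Y : Type*} [NormedAddCommGroup X]
    [NormedSpace ℝ X] [NormedAddCommGroup Y] [NormedSpace ℝ Y] [CompleteSpace Y] {e : D → X}
    (he : DenseRange e) {J : X →L[ℝ] Y}
    (h : ∀ η : ℝ, 0 < η → ∃ A : Y →L[ℝ] Y, IsCompactOperator A ∧
      ∀ d, ‖J (e d) - A (J (e d))‖ ≤ η * ‖e d‖) : IsCompactOperator J := by
  have hpos : ∀ k : ℕ, (0 : ℝ) < 1 / ((k : ℝ) + 1) := fun k => by positivity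
  choose A hA hAe using fun k : ℕ => h _ (hpos k)
  refine isCompactOperator_of_tendsto (l := atTop) (F := fun k : ℕ => (A k).comp J) ?_
    (Eventually.of_forall fun k => (hA k).comp_clm _)
  rw [tendsto_iff_norm_sub_tendsto_zero]
  refine squeeze_zero (fun _ => norm_nonneg _) (fun k => ?_)
    (tendsto_one_div_add_atTop_nhds_zero_nat (𝕜 := ℝ))
  refine ContinuousLinearMap.opNorm_le_bound _ (hpos k).le fun G => ?_
  refine he.induction_on
    (p := fun G => ‖((A k).comp J - J) G‖ ≤ 1 / ((k : ℝ) + 1) * ‖G‖) G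
    (isClosed_le (by fun_prop) (by fun_prop)) fun d => ?_
  rw [sub_apply, ContinuousLinearMap.comp_apply, norm_sub_rev]
  exact hAe k d

theorem isCompactOperator_cellAverage [IsFiniteMeasure (volume.restrict Ω)] {ℓ : ℝ} (hℓ : 0 < ℓ)
    (S : Finset (Fin N → ℤ)) : IsCompactOperator (cellAverage Ω hℓ S) := by
  unfold cellAverage
  refine isCompactOperator_sum (E := Lp ℝ 2 (volume.restrict Ω))
    (F := Lp ℝ 2 (volume.restrict Ω)) S _ fun n => ?_
  set e := indicatorConstLp 2 (μ := volume.restrict Ω)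
    (measurableSet_gridCell hℓ n) (measure_ne_top _ _) (1 : ℝ)
  have h1 : IsCompactOperator (innerSL ℝ e) :=
    isCompactOperator_of_locallyCompactSpace_dom (innerSL ℝ e)
  have h2 : IsCompactOperator ((innerSL ℝ e).smulRight e) :=
    h1.clm_comp (ContinuousLinearMap.toSpanSingleton ℝ e)
  exact IsCompactOperator.smul h2 ((ℓ ^ N)⁻¹)

theorem cellAverage_coeFn [IsFiniteMeasure (volume.restrict Ω)] {ℓ : ℝ} (hℓ : 0 < ℓ)
    (S : Finset (Fin N → ℤ)) (u : Lp ℝ 2 (volume.restrict Ω)) :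
    cellAverage Ω hℓ S u =ᵐ[volume.restrict Ω] fun x => ∑ n ∈ S,
      (ℓ ^ N)⁻¹ * (∫ y in gridCell ℓ n, u y ∂(volume.restrict Ω))
        * (gridCell ℓ n).indicator (fun _ => (1 : ℝ)) x := by
  have h0 : cellAverage Ω hℓ S u = ∑ n ∈ S,
      ((ℓ ^ N)⁻¹ * ∫ y in gridCell ℓ n, u y ∂(volume.restrict Ω)) •
        indicatorConstLp 2 (μ := volume.restrict Ω)
          (measurableSet_gridCell hℓ n) (measure_ne_top _ _) (1 : ℝ) := by
    simp only [cellAverage, sum_apply, smul_apply,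
      ContinuousLinearMap.smulRight_apply, innerSL_apply_apply, smul_smul]
    refine Finset.sum_congr rfl fun n _ => ?_
    rw [L2.inner_indicatorConstLp_one (𝕜 := ℝ)]
  rw [h0]
  have h1 : ∀ n ∈ S, ((((ℓ ^ N)⁻¹ * ∫ y in gridCell ℓ n, u y ∂(volume.restrict Ω)) •
        indicatorConstLp 2 (μ := volume.restrict Ω)
          (measurableSet_gridCell hℓ n) (measure_ne_top _ _) (1 : ℝ) : Lp ℝ 2 _) : Space N → ℝ)
      =ᵐ[volume.restrict Ω] fun x =>
        (ℓ ^ N)⁻¹ * (∫ y in gridCell ℓ n, u y ∂(volume.restrict Ω))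
        * (gridCell ℓ n).indicator (fun _ => (1 : ℝ)) x := by
    intro n _
    filter_upwards [Lp.coeFn_smul ((ℓ ^ N)⁻¹ * ∫ y in gridCell ℓ n, u y ∂(volume.restrict Ω))
      (indicatorConstLp 2 (μ := volume.restrict Ω)
          (measurableSet_gridCell hℓ n) (measure_ne_top _ _) (1 : ℝ)),
      indicatorConstLp_coeFn (p := 2) (μ := volume.restrict Ω)
          (hs := measurableSet_gridCell hℓ n) (hμs := measure_ne_top _ _) (c := (1 : ℝ))]
      with x hx hx2
    rw [hx, Pi.smul_apply, hx2, smul_eq_mul]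
  have h2 : ∀ S' ⊆ S, ((∑ n ∈ S', ((ℓ ^ N)⁻¹ * ∫ y in gridCell ℓ n, u y ∂(volume.restrict Ω)) •
        indicatorConstLp 2 (μ := volume.restrict Ω)
          (measurableSet_gridCell hℓ n) (measure_ne_top _ _) (1 : ℝ) : Lp ℝ 2 _) : Space N → ℝ)
      =ᵐ[volume.restrict Ω] fun x => ∑ n ∈ S',
        (ℓ ^ N)⁻¹ * (∫ y in gridCell ℓ n, u y ∂(volume.restrict Ω))
        * (gridCell ℓ n).indicator (fun _ => (1 : ℝ)) x := by
    classical
    intro S'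
    induction S' using Finset.induction_on with
    | empty =>
      intro _
      simp only [Finset.sum_empty]
      exact Lp.coeFn_zero _ _ _
    | insert a s ha ih =>
      intro hs
      rw [Finset.sum_insert ha]
      filter_upwards [Lp.coeFn_add (((ℓ ^ N)⁻¹ * ∫ y in gridCell ℓ a, u y ∂(volume.restrict Ω)) •
          indicatorConstLp 2 (μ := volume.restrict Ω)
            (measurableSet_gridCell hℓ a) (measure_ne_top _ _) (1 : ℝ)) _, ih ((Finset.subset_insert _ _).trans hs),
        h1 a (hs (Finset.mem_insert_self _ _))] with x hx1 hx2 hx3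
      rw [hx1, Pi.add_apply, hx2, hx3, Finset.sum_insert ha]
  exact h2 S subset_rfl

theorem norm_sub_cellAverage_testToL2_sq_le [IsFiniteMeasure (volume.restrict Ω)]
    (hΩm : MeasurableSet Ω) (hΩ : Bornology.IsBounded Ω) {ℓ : ℝ} (hℓ : 0 < ℓ) :
    ∃ S : Finset (Fin N → ℤ), ∀ ψ : testFunctions Ω,
      ‖testToL2 Ω ψ - cellAverage Ω hℓ S (testToL2 Ω ψ)‖ ^ 2
        ≤ 2 ^ N * (N * ℓ ^ 2) * ‖testToGradientSpace Ω ψ‖ ^ 2 := by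
  obtain ⟨S, hS⟩ := exists_finset_cellAverage_approx hΩm hΩ hℓ
  refine ⟨S, fun ψ => ?_⟩
  rw [norm_testToGradientSpace_sq]
  refine le_trans (le_of_eq ?_) (hS ψ (ψ.2.1.of_le (by simp)) ψ.2.2.1 ψ.2.2.2)
  have hψ : testToL2 Ω ψ =ᵐ[volume.restrict Ω] ψ := MemLp.coeFn_toLp (ψ.2.memLp _)
  rw [Lp_norm_sq_eq_integral]
  refine integral_congr_ae ?_
  filter_upwards [Lp.coeFn_sub (testToL2 Ω ψ) (cellAverage Ω hℓ S (testToL2 Ω ψ)), hψ,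
    cellAverage_coeFn hℓ S (testToL2 Ω ψ)] with x h1 h2 h3
  rw [h1, Pi.sub_apply, h2, h3, Real.norm_eq_abs, sq_abs]
  congr 3
  ext n
  congr 2
  exact integral_congr_ae (ae_restrict_of_ae hψ)

/-- **Rellich's theorem** for `H^1_0`. -/
theorem isCompactOperator_gradientToL2 (hN : 1 ≤ N) (hΩm : MeasurableSet Ω)
    (hΩ : Bornology.IsBounded Ω) : IsCompactOperator (gradientToL2 Ω) := by
  have hfin : IsFiniteMeasure (volume.restrict Ω) :=
    ⟨by rw [Measure.restrict_apply_univ]; exact hΩ.measure_lt_top⟩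
  refine isCompactOperator_of_forall_exists_approx denseRange_testToGradientSpace fun η hη => ?_
  set K := Real.sqrt (2 ^ N * N)
  have hK : 0 ≤ K := Real.sqrt_nonneg _
  -- The averaging error is K ℓ times the gradient norm, so this mesh brings it below η.
  have hℓ : 0 < η / (K + 1) := by positivity
  obtain ⟨S, hS⟩ := norm_sub_cellAverage_testToL2_sq_le hΩm hΩ hℓ
  refine ⟨cellAverage Ω hℓ S, isCompactOperator_cellAverage hℓ S, fun ψ => ?_⟩
  rw [gradientToL2_testToGradientSpace hN hΩ]
  have h1 : K * (η / (K + 1)) ≤ η := by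
    rw [mul_div_assoc', div_le_iff₀ (by positivity)]
    nlinarith
  refine le_trans (abs_le_of_sq_le_sq' ((hS ψ).trans (le_of_eq ?_)) ?_).2
    (mul_le_mul_of_nonneg_right h1 (norm_nonneg _))
  · rw [mul_pow, mul_pow, Real.sq_sqrt (by positivity)]
    ring
  · exact mul_nonneg (mul_nonneg hK hℓ.le) (norm_nonneg _)

/-- The gradients of the approximating functions converge in the closed space, and continuity of
`gradientToL2` identifies the limit with u. Together with `hasH10Gradient_of_gradientSpace` this
translates between the concrete H^1_0 and the Hilbert space of gradients. -/
theorem HasH10Gradient.exists_gradientSpace (hN : 1 ≤ N) (hΩ : Bornology.IsBounded Ω)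
    {u : Space N → ℝ} {g : Space N → Space N} (h : HasH10Gradient Ω u g) :
    ∃ G : gradientSpace Ω, (G : Lp (Space N) 2 (volume.restrict Ω)) =ᵐ[volume.restrict Ω] g ∧
      gradientToL2 Ω G =ᵐ[volume.restrict Ω] u := by
  obtain ⟨hu, hg, φ, hφ, hlim, hglim⟩ := h
  set ψ : ℕ → testFunctions Ω := fun n => ⟨φ n, hφ n⟩
  have hg' : Tendsto (fun n => testGradient Ω (ψ n)) atTop (𝓝 (hg.toLp g)) := by
    refine (Lp.tendsto_Lp_iff_tendsto_eLpNorm'' _ (fun n => (hφ n).memLp_gradient _) _ hg).2 ?_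
    exact hglim
  have hu' : Tendsto (fun n => testToL2 Ω (ψ n)) atTop (𝓝 (hu.toLp u)) := by
    refine (Lp.tendsto_Lp_iff_tendsto_eLpNorm'' _ (fun n => (hφ n).memLp _) _ hu).2 ?_
    exact hlim
  have hmem : hg.toLp g ∈ gradientSpace Ω :=
    mem_closure_of_tendsto hg' (Eventually.of_forall fun n => LinearMap.mem_range_self _ _)
  refine ⟨⟨hg.toLp g, hmem⟩, hg.coeFn_toLp, ?_⟩
  have h1 : Tendsto (fun n => testToGradientSpace Ω (ψ n)) atTop
      (𝓝 (⟨hg.toLp g, hmem⟩ : gradientSpace Ω)) := tendsto_subtype_rng.2 hg'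
  have h2 := ((gradientToL2 Ω).continuous.tendsto _).comp h1
  have h3 : gradientToL2 Ω ⟨hg.toLp g, hmem⟩ = hu.toLp u := by
    refine tendsto_nhds_unique h2 (hu'.congr fun n => ?_)
    exact (gradientToL2_testToGradientSpace hN hΩ (ψ n)).symm
  rw [h3]
  exact hu.coeFn_toLp

theorem hasH10Gradient_of_gradientSpace (hN : 1 ≤ N) (hΩ : Bornology.IsBounded Ω)
    (G : gradientSpace Ω) : HasH10Gradient Ω (gradientToL2 Ω G)
      (G : Lp (Space N) 2 (volume.restrict Ω)) := by
  refine ⟨Lp.memLp _, Lp.memLp _, ?_⟩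
  obtain ⟨G', hG', hlim⟩ := mem_closure_iff_seq_limit.1 (denseRange_testToGradientSpace G)
  choose ψ hψ using hG'
  refine ⟨fun n => ψ n, fun n => (ψ n).2, ?_, ?_⟩
  · have h2 := ((gradientToL2 Ω).continuous.tendsto _).comp hlim
    have h3 : Tendsto (fun n => testToL2 Ω (ψ n)) atTop (𝓝 (gradientToL2 Ω G)) := by
      refine h2.congr fun n => ?_
      rw [Function.comp_apply, ← hψ, gradientToL2_testToGradientSpace hN hΩ]
    have := (Lp.tendsto_Lp_iff_tendsto_eLpNorm' _ _).1 h3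
    refine this.congr fun n => eLpNorm_congr_ae ?_
    exact (MemLp.coeFn_toLp ((ψ n).2.memLp _)).sub (EventuallyEq.refl _ _)
  · have h3 : Tendsto (fun n => testGradient Ω (ψ n)) atTop
        (𝓝 (G : Lp (Space N) 2 (volume.restrict Ω))) := by
      have := (continuous_subtype_val.tendsto G).comp hlim
      refine this.congr fun n => ?_
      rw [Function.comp_apply, ← hψ]; rfl
    have := (Lp.tendsto_Lp_iff_tendsto_eLpNorm' _ _).1 h3
    refine this.congr fun n => eLpNorm_congr_ae ?_
    exact (MemLp.coeFn_toLp ((ψ n).2.memLp_gradient _)).sub (EventuallyEq.refl _ _)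

end TestFunctions

end FastDiffusion

end

/-! ### The weighted space L²_V and the inverse of the Dirichlet Laplacian -/

noncomputable section

namespace FastDiffusion

section ChangeOfMeasure

variable {X : Type*} [MeasurableSpace X] {μ ν : Measure X}

/-- The inclusion `L²(μ) → L²(ν)` when `ν ≤ c μ`. -/
def LpInclusion {c : ℝ≥0∞} (hc : c ≠ ⊤) (h : ν ≤ c • μ) : Lp ℝ 2 μ →L[ℝ] Lp ℝ 2 ν :=
  have hac : ν ≪ μ := Measure.absolutelyContinuous_of_le_smul h
  LinearMap.mkContinuous
    { toFun := fun u => ((Lp.memLp u).of_measure_le_smul hc h).toLp u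
      map_add' := fun u v => by
        rw [← MemLp.toLp_add]
        exact MemLp.toLp_congr _ _ (hac.ae_le (Lp.coeFn_add u v))
      map_smul' := fun a u => by
        rw [RingHom.id_apply, ← MemLp.toLp_const_smul]
        exact MemLp.toLp_congr _ _ (hac.ae_le (Lp.coeFn_smul a u)) }
    (c ^ (1 / (2 : ℝ))).toReal fun u => by
      simp only [LinearMap.coe_mk, AddHom.coe_mk]
      rw [Lp.norm_toLp, Lp.norm_def, ← ENNReal.toReal_mul]
      refine ENNReal.toReal_mono
        (ENNReal.mul_ne_top (ENNReal.rpow_ne_top_of_nonneg (by norm_num) hc) (Lp.eLpNorm_ne_top u)) ?_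
      refine (eLpNorm_mono_measure _ h).trans (le_of_eq ?_)
      rw [eLpNorm_smul_measure_of_ne_top (by norm_num)]
      simp

theorem LpInclusion_coeFn {c : ℝ≥0∞} (hc : c ≠ ⊤) (h : ν ≤ c • μ) (u : Lp ℝ 2 μ) :
    LpInclusion hc h u =ᵐ[ν] u :=
  MemLp.coeFn_toLp ((Lp.memLp u).of_measure_le_smul hc h)

end ChangeOfMeasure

/-- Standing assumptions: a bounded domain and a positive bounded weight. -/
structure IsBoundedWeight {N : ℕ} (Ω : Set (Space N)) (p M : ℝ) (V : Space N → ℝ) : Prop where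
  one_le : 1 ≤ N
  isOpen : IsOpen Ω
  bounded : Bornology.IsBounded Ω
  one_lt : 1 < p
  bound_pos : 0 < M
  pos : ∀ᵐ x ∂(volume.restrict Ω), 0 < V x
  le : ∀ᵐ x ∂(volume.restrict Ω), V x ≤ M
  meas : AEStronglyMeasurable V (volume.restrict Ω)

namespace IsBoundedWeight

variable {N : ℕ} {Ω : Set (Space N)} {p M : ℝ} {V : Space N → ℝ}

theorem isFiniteMeasure (h : IsBoundedWeight Ω p M V) : IsFiniteMeasure (volume.restrict Ω) :=
  ⟨by rw [Measure.restrict_apply_univ]; exact h.bounded.measure_lt_top⟩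

theorem aemeasurable_density (h : IsBoundedWeight Ω p M V) :
    AEMeasurable (fun x => ENNReal.ofReal (V x ^ (p - 1))) (volume.restrict Ω) :=
  (h.meas.aemeasurable.pow_const (p - 1)).ennreal_ofReal

theorem weightedMeasure_le (h : IsBoundedWeight Ω p M V) :
    weightedMeasure Ω p V ≤ ENNReal.ofReal (M ^ (p - 1)) • volume.restrict Ω := by
  rw [← withDensity_const]
  refine withDensity_mono ?_
  filter_upwards [h.pos, h.le] with x h1 h2
  exact ENNReal.ofReal_le_ofReal
    (Real.rpow_le_rpow h1.le h2 (by linarith [h.one_lt]))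

theorem weightedMeasure_ac (_h : IsBoundedWeight Ω p M V) :
    weightedMeasure Ω p V ≪ volume.restrict Ω := withDensity_absolutelyContinuous _ _

/-- Positivity of V gives the two measures the same null sets, so almost-everywhere statements
transfer in both directions. -/
theorem ac_weightedMeasure (h : IsBoundedWeight Ω p M V) :
    volume.restrict Ω ≪ weightedMeasure Ω p V := by
  refine withDensity_absolutelyContinuous' h.aemeasurable_density ?_
  filter_upwards [h.pos] with x hx
  exact (ENNReal.ofReal_pos.2 (Real.rpow_pos_of_pos hx _)).ne'

theorem integral_weightedMeasure (h : IsBoundedWeight Ω p M V) (f : Space N → ℝ) :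
    ∫ x, f x ∂(weightedMeasure Ω p V) = ∫ x in Ω, V x ^ (p - 1) * f x := by
  rw [weightedMeasure, integral_withDensity_eq_integral_toReal_smul₀ h.aemeasurable_density
    (Eventually.of_forall fun _ => ENNReal.ofReal_lt_top)]
  refine integral_congr_ae ?_
  filter_upwards [h.pos] with x hx
  rw [ENNReal.toReal_ofReal (Real.rpow_nonneg hx.le _), smul_eq_mul]

/-- The compact embedding `H^1_0(Ω) → L²_V`, as a map on gradients. -/
def embedding (h : IsBoundedWeight Ω p M V) : gradientSpace Ω →L[ℝ] L2V Ω p V :=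
  (LpInclusion ENNReal.ofReal_ne_top h.weightedMeasure_le).comp (gradientToL2 Ω)

theorem embedding_coeFn (h : IsBoundedWeight Ω p M V) (G : gradientSpace Ω) :
    h.embedding G =ᵐ[volume.restrict Ω] gradientToL2 Ω G :=
  h.ac_weightedMeasure.ae_le
    (LpInclusion_coeFn ENNReal.ofReal_ne_top h.weightedMeasure_le (gradientToL2 Ω G))

theorem embedding_test_coeFn (h : IsBoundedWeight Ω p M V) (ψ : testFunctions Ω) :
    h.embedding (testToGradientSpace Ω ψ) =ᵐ[volume.restrict Ω] ψ := by
  refine (h.embedding_coeFn _).trans ?_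
  rw [gradientToL2_testToGradientSpace h.one_le h.bounded]
  exact MemLp.coeFn_toLp (ψ.2.memLp _)

/-- The adjoint of the embedding: `q ↦ ∇u`, where `-Δu = V^{p-1} q`. -/
def solutionGradient (h : IsBoundedWeight Ω p M V) : L2V Ω p V →L[ℝ] gradientSpace Ω :=
  h.embedding.adjoint

theorem inner_solutionGradient (h : IsBoundedWeight Ω p M V) (q : L2V Ω p V)
    (G : gradientSpace Ω) : inner ℝ (h.solutionGradient q) G = inner ℝ q (h.embedding G) :=
  ContinuousLinearMap.adjoint_inner_left _ _ _

/-- The inverse `T` of the Dirichlet Laplacian on `L²_V`: `-Δ (T q) = V^{p-1} q`. -/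
def solutionOperator (h : IsBoundedWeight Ω p M V) : L2V Ω p V →L[ℝ] L2V Ω p V :=
  h.embedding.comp h.solutionGradient

/-- This is T = J J* in bilinear form; symmetry and positivity of T follow at once. -/
theorem inner_solutionOperator (h : IsBoundedWeight Ω p M V) (x y : L2V Ω p V) :
    inner ℝ x (h.solutionOperator y) = inner ℝ (h.solutionGradient x) (h.solutionGradient y) :=
  (h.inner_solutionGradient x (h.solutionGradient y)).symm

theorem isSymmetric_solutionOperator (h : IsBoundedWeight Ω p M V) :
    (h.solutionOperator : L2V Ω p V →ₗ[ℝ] L2V Ω p V).IsSymmetric := by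
  intro x y
  exact (real_inner_comm _ _).trans ((h.inner_solutionOperator y x).trans
    ((real_inner_comm _ _).trans (h.inner_solutionOperator x y).symm))

theorem inner_solutionOperator_self_nonneg (h : IsBoundedWeight Ω p M V) (x : L2V Ω p V) :
    0 ≤ inner ℝ (h.solutionOperator x) x := by
  rw [real_inner_comm, h.inner_solutionOperator]
  exact real_inner_self_nonneg

theorem isCompactOperator_solutionOperator (h : IsBoundedWeight Ω p M V) :
    IsCompactOperator h.solutionOperator := by
  have h1 : IsCompactOperator h.embedding :=
    (isCompactOperator_gradientToL2 h.one_le h.isOpen.measurableSet h.bounded).clm_comp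
      (LpInclusion ENNReal.ofReal_ne_top h.weightedMeasure_le)
  exact h1.comp_clm h.solutionGradient

theorem inner_eq_integral (h : IsBoundedWeight Ω p M V) (x y : L2V Ω p V) :
    inner ℝ x y = ∫ z in Ω, V z ^ (p - 1) * (x z * y z) := by
  rw [L2.inner_def, h.integral_weightedMeasure]
  refine integral_congr_ae (Eventually.of_forall fun z => ?_)
  simp [mul_comm]

theorem inner_embedding_test (h : IsBoundedWeight Ω p M V) (q : L2V Ω p V)
    (ψ : testFunctions Ω) : inner ℝ q (h.embedding (testToGradientSpace Ω ψ))
      = ∫ x in Ω, V x ^ (p - 1) * q x * (ψ : Space N → ℝ) x := by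
  rw [h.inner_eq_integral]
  refine integral_congr_ae ?_
  filter_upwards [h.embedding_test_coeFn ψ] with x hx
  rw [hx, mul_assoc]

theorem inner_testToGradientSpace (G : gradientSpace Ω) {g : Space N → Space N}
    (hg : (G : Lp (Space N) 2 (volume.restrict Ω)) =ᵐ[volume.restrict Ω] g)
    (ψ : testFunctions Ω) : inner ℝ G (testToGradientSpace Ω ψ)
      = ∫ x in Ω, inner ℝ (g x) (gradient (ψ : Space N → ℝ) x) := by
  have e : inner ℝ G (testToGradientSpace Ω ψ)
      = ∫ x in Ω, inner ℝ ((G : Lp (Space N) 2 (volume.restrict Ω)) x)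
          (testGradient Ω ψ x) := by
    rw [← L2.inner_def]; rfl
  rw [e]
  have h2 : testGradient Ω ψ =ᵐ[volume.restrict Ω] gradient (ψ : Space N → ℝ) :=
    MemLp.coeFn_toLp (IsTestFunction.memLp_gradient (Ω := Ω) ψ.2 (volume.restrict Ω))
  refine integral_congr_ae ?_
  filter_upwards [hg, h2] with x h1 h2
  rw [h1, h2]

/-- Weak solutions of `-Δu = V^{p-1} q` in terms of the embedding. -/
theorem eq_adjoint_of_forall_test (h : IsBoundedWeight Ω p M V) {G : gradientSpace Ω}
    {q : L2V Ω p V} (hG : ∀ ψ : testFunctions Ω, inner ℝ G (testToGradientSpace Ω ψ)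
      = inner ℝ q (h.embedding (testToGradientSpace Ω ψ))) : G = h.solutionGradient q := by
  refine denseRange_testToGradientSpace.eq_of_inner_left (𝕜 := ℝ) fun ψ => ?_
  rw [hG, h.inner_solutionGradient]

/-- The weak equation says that the gradient of φ is J*(μ φ); applying J gives the claim. -/
theorem eq_smul_solutionOperator (h : IsBoundedWeight Ω p M V) {μ : ℝ} {φ : L2V Ω p V}
    (hφ : SolvesEigenvalueEquation Ω p V μ φ) : φ = μ • h.solutionOperator φ := by
  obtain ⟨Dφ, hH, heq⟩ := hφ
  obtain ⟨G, hG, hu⟩ := hH.exists_gradientSpace h.one_le h.bounded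
  have hJ : h.embedding G = φ := by
    refine Lp.ext (h.weightedMeasure_ac.ae_le ?_)
    exact (h.embedding_coeFn G).trans hu
  have hadj : G = h.solutionGradient (μ • φ) := by
    refine h.eq_adjoint_of_forall_test fun ψ => ?_
    rw [inner_testToGradientSpace G hG, heq ψ ψ.2, real_inner_smul_left, h.inner_embedding_test,
      ← integral_const_mul]
    refine integral_congr_ae (Eventually.of_forall fun x => ?_)
    simp only; ring
  have : h.embedding (h.solutionGradient (μ • φ)) = φ := by rw [← hadj, hJ]
  rw [map_smul, map_smul] at this
  exact this.symm

/-- This turns (H2) into a spectral condition: u = T φ solves -Δu = V^{p-1} φ, and φ = p c u makes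
this the problem excluded by (H2). -/
theorem eq_zero_of_nondegenerate (h : IsBoundedWeight Ω p M V) {c : ℝ} (hc : 0 < c)
    (hnd : Nondegenerate Ω p c V) {φ : L2V Ω p V}
    (hφ : h.solutionOperator φ = (1 / (p * c)) • φ) : φ = 0 := by
  have hp : 0 < p := by linarith [h.one_lt]
  set G := h.solutionGradient φ with hG
  have hH := hasH10Gradient_of_gradientSpace h.one_le h.bounded G
  have hu : gradientToL2 Ω G =ᵐ[volume.restrict Ω] fun x => 1 / (p * c) * φ x := by
    refine (h.embedding_coeFn G).symm.trans ?_
    have : h.embedding G = (1 / (p * c)) • φ := hφ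
    rw [this]
    exact h.ac_weightedMeasure.ae_le (Lp.coeFn_smul _ _)
  have h0 := hnd _ _ ⟨hH, fun ψ hψ => by
    rw [← inner_testToGradientSpace G (EventuallyEq.refl _ _) ⟨ψ, hψ⟩, hG,
      h.inner_solutionGradient, h.inner_embedding_test]
    refine integral_congr_ae ?_
    filter_upwards [hu] with x hx
    rw [← hG, hx]
    field_simp⟩
  refine (Lp.eq_zero_iff_ae_eq_zero).2 (h.weightedMeasure_ac.ae_le ?_)
  filter_upwards [hu, h0] with x h1 h2
  rw [h2, Pi.zero_apply] at h1
  have : 1 / (p * c) ≠ 0 := by positivity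
  exact (mul_eq_zero.1 h1.symm).resolve_left this

/-- Pairing φ = μ T φ with φ ≠ 0 and using T ≥ 0 forces μ > 0; hence T φ = μ⁻¹ φ with μ⁻¹ > 1 / (p
c), an unstable mode. -/
theorem projection_eq_self_of_solvesEigenvalueEquation (h : IsBoundedWeight Ω p M V) {c μ : ℝ}
    (hc : 0 < c) (hμ : μ < p * c) {P : L2V Ω p V →L[ℝ] L2V Ω p V}
    (hP : ∀ θ, 1 / (p * c) < θ → ∀ x, h.solutionOperator x = θ • x → P x = x) {φ : L2V Ω p V}
    (hφ : SolvesEigenvalueEquation Ω p V μ φ) : P φ = φ := by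
  have hp : 0 < p := by linarith [h.one_lt]
  by_cases h0 : φ = 0
  · simp [h0]
  have e := h.eq_smul_solutionOperator hφ
  have hμ0 : 0 < μ := by
    have h1 : 0 < inner ℝ φ φ := real_inner_self_pos.2 h0
    nth_rw 1 [e] at h1
    rw [real_inner_smul_left] at h1
    exact pos_of_mul_pos_left h1 (h.inner_solutionOperator_self_nonneg φ)
  refine hP μ⁻¹ ?_ φ ?_
  · rw [one_div]
    exact (inv_lt_inv₀ (by positivity) hμ0).2 hμ
  · nth_rw 2 [e]
    rw [smul_smul, inv_mul_cancel₀ hμ0.ne', one_smul]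

end IsBoundedWeight

/-! ### The enumeration of the eigenvalues -/

section Eigenvalues

variable {N : ℕ} {Ω : Set (Space N)} {p : ℝ} {V : Space N → ℝ}

/-- Each value depends only on its predecessor, so a value 0 (such as the infimum of an empty set)
restarts the enumeration from its placeholder. -/
theorem eigenvalue_add_of_eigenvalue_eq_zero {j : ℕ} (hj : eigenvalue Ω p V j = 0) (i : ℕ) :
    eigenvalue Ω p V (j + i) = eigenvalue Ω p V i := by
  induction i with
  | zero => simpa [eigenvalue] using hj
  | succ i ih =>
    rw [← add_assoc]
    simp only [eigenvalue]
    rw [ih]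

/-- The eigenvalues up to the index `k_p` lie below `p c`. -/
theorem eigenvalue_lt_of_le_kMax {c : ℝ} (hpc : 0 < p * c) {k : ℕ} (hk : 1 ≤ k)
    (hkm : k ≤ kMax Ω p c V) : eigenvalue Ω p V k < p * c := by
  set A : Set ℕ := {k : ℕ | 1 ≤ k ∧ eigenvalue Ω p V k < p * c} with hA
  have hkA : k ≤ sSup A := hkm
  -- An unbounded set of naturals has `sSup` equal to 0, which contradicts 1 ≤ k.
  have hbdd : BddAbove A := by
    by_contra hn
    rw [Nat.sSup_of_not_bddAbove hn] at hkA
    omega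
  have hne : A.Nonempty := by
    by_contra hn
    rw [Set.not_nonempty_iff_eq_empty] at hn
    rw [hn] at hkA
    simp at hkA
    omega
  have hmem : sSup A ∈ A := Nat.sSup_mem hne hbdd
  -- A zero value at j would recur at every multiple of j, putting all positive multiples in A and
  -- making A unbounded.
  have hnz : ∀ j, 1 ≤ j → eigenvalue Ω p V j ≠ 0 := by
    intro j hj h0
    have hper : ∀ n : ℕ, eigenvalue Ω p V (j * n) = 0 := by
      intro n
      induction n with
      | zero => simp [eigenvalue]
      | succ n ih =>
        rw [Nat.mul_succ, add_comm, eigenvalue_add_of_eigenvalue_eq_zero h0, ih]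
    obtain ⟨B, hB⟩ := hbdd
    have hm : j * (B + 1) ∈ A :=
      ⟨Nat.mul_pos hj (Nat.succ_pos B), by rw [hper]; exact hpc⟩
    have := hB hm
    nlinarith
  -- A nonzero value is not the infimum of the empty set, so it is the infimum of numbers above the
  -- preceding one.
  have hmono : ∀ j, eigenvalue Ω p V j ≤ eigenvalue Ω p V (j + 1) := by
    intro j
    have h1 := hnz (j + 1) (by omega)
    simp only [eigenvalue] at h1 ⊢
    refine le_csInf ?_ fun μ hμ => hμ.2.le
    by_contra hn
    rw [Set.not_nonempty_iff_eq_empty] at hn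
    rw [hn, Real.sInf_empty] at h1
    exact h1 rfl
  exact (monotone_nat_of_le_succ hmono hkA).trans_lt hmem.2

end Eigenvalues

end FastDiffusion

end

/-! ### Continuous functions with a continuous weak derivative -/

section WeakDerivative

/-- A test function with vanishing integral has a test function as primitive. -/
theorem exists_primitive_of_integral_eq_zero {χ : ℝ → ℝ} (hχ : ContDiff ℝ ∞ χ) {a b : ℝ}
    (hs : Function.support χ ⊆ Icc a b) (h0 : ∫ τ, χ τ = 0) :
    ∃ η : ℝ → ℝ, ContDiff ℝ ∞ η ∧ tsupport η ⊆ Icc a b ∧ deriv η = χ := by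
  have hd : ∀ τ, HasDerivAt (fun τ => ∫ x in a..τ, χ x) (χ τ) τ := fun τ =>
    hχ.continuous.integral_hasStrictDerivAt a τ |>.hasDerivAt
  have hderiv : deriv (fun τ => ∫ x in a..τ, χ x) = χ := funext fun τ => (hd τ).deriv
  refine ⟨fun τ => ∫ x in a..τ, χ x, ?_, ?_, hderiv⟩
  · rw [contDiff_infty_iff_deriv, hderiv]
    exact ⟨fun τ => (hd τ).differentiableAt, hχ⟩
  · refine closure_minimal (fun τ hτ => ?_) isClosed_Icc
    by_contra hn
    refine hτ ?_
    rcases lt_or_ge τ a with h | h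
    · have : ∫ x in a..τ, χ x = ∫ x in a..τ, (0 : ℝ) := by
        rw [intervalIntegral.integral_symm, intervalIntegral.integral_symm τ a]
        congr 1
        rw [intervalIntegral.integral_of_le h.le, intervalIntegral.integral_of_le h.le,
          ← integral_Ico_eq_integral_Ioc, ← integral_Ico_eq_integral_Ioc]
        refine setIntegral_congr_fun measurableSet_Ico fun x hx => ?_
        by_contra hne
        exact absurd (hs hne).1 (not_le.2 hx.2)
      simpa using this
    · have hbτ : b < τ := by
        by_contra hb
        exact hn ⟨h, not_lt.1 hb⟩
      change ∫ x in a..τ, χ x = 0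
      rw [intervalIntegral.integral_of_le h, ← integral_Icc_eq_integral_Ioc, ← h0]
      refine setIntegral_eq_integral_of_forall_compl_eq_zero fun x hx => ?_
      by_contra hne
      exact hx ⟨(hs hne).1, (hs hne).2.trans hbτ.le⟩

/-- A continuous function with continuous weak derivative `n` is a primitive of `n`. -/
theorem sub_eq_integral_of_weak_deriv {α n : ℝ → ℝ} {t₀ : ℝ} (hα : ContinuousOn α (Ioi t₀))
    (hn : ContinuousOn n (Ioi t₀))
    (hw : ∀ (η : ℝ → ℝ) (a b : ℝ), t₀ < a → a ≤ b → ContDiff ℝ ∞ η → tsupport η ⊆ Ioo a b →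
      ∫ τ in a..b, (deriv η τ * α τ + η τ * n τ) = 0)
    {s t : ℝ} (hs : t₀ < s) (hst : s ≤ t) : α t - α s = ∫ τ in s..t, n τ := by
  have hni : ∀ a b, t₀ < a → t₀ < b → IntervalIntegrable n volume a b := fun a b ha hb =>
    (hn.mono fun x hx => lt_of_lt_of_le (lt_min ha hb) hx.1).intervalIntegrable
  have hNd : ∀ τ, t₀ < τ → HasDerivAt (fun τ => ∫ x in s..τ, n x) (n τ) τ := fun τ hτ =>
    intervalIntegral.integral_hasDerivAt_right (hni s τ hs hτ)
      (hn.stronglyMeasurableAtFilter isOpen_Ioi τ hτ) (hn.continuousAt (Ioi_mem_nhds hτ))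
  set k : ℝ → ℝ := fun τ => α τ - ∫ x in s..τ, n x with hk
  have hNc : ContinuousOn (fun τ => ∫ x in s..τ, n x) (Ioi t₀) := fun τ hτ =>
    (hNd τ hτ).continuousAt.continuousWithinAt
  have hkc : ContinuousOn k (Ioi t₀) := hα.sub hNc
  -- Integration by parts on a slightly larger interval shows that k has weak derivative zero.
  have hwk : ∀ (η : ℝ → ℝ) (a b : ℝ), t₀ < a → a ≤ b → ContDiff ℝ ∞ η → tsupport η ⊆ Icc a b →
      ∃ a' b', t₀ < a' ∧ a' < a ∧ b < b' ∧ ∫ τ in a'..b', deriv η τ * k τ = 0 := by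
    intro η a b ha hab hη hsup
    obtain ⟨a', ha', haa'⟩ := exists_between ha
    refine ⟨a', b + 1, ha', haa', by linarith, ?_⟩
    have hab' : a' ≤ b + 1 := by linarith
    have hsub : uIcc a' (b + 1) ⊆ Ioi t₀ := by
      rw [uIcc_of_le hab']; exact fun x hx => lt_of_lt_of_le ha' hx.1
    have hη' : Continuous (deriv η) := hη.continuous_deriv (by simp)
    have hza : η a' = 0 := by
      by_contra hne
      exact absurd (hsup (subset_tsupport _ hne)).1 (not_le.2 haa')
    have hzb : η (b + 1) = 0 := by
      by_contra hne
      have := (hsup (subset_tsupport _ hne)).2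
      linarith
    have h1 := hw η a' (b + 1) ha' hab' hη
      (hsup.trans (Icc_subset_Ioo haa' (by linarith)))
    have h2 := intervalIntegral.integral_deriv_mul_eq_sub
      (fun x _ => (hη.differentiable (by simp) x).hasDerivAt) (fun x hx => hNd x (hsub hx))
      (hη'.intervalIntegrable a' (b + 1)) (hni a' (b + 1) ha' (by linarith))
    rw [hza, hzb, zero_mul, zero_mul, sub_zero] at h2
    have i1 : IntervalIntegrable (fun τ => deriv η τ * α τ + η τ * n τ) volume a' (b + 1) :=
      ((hη'.continuousOn.mul (hα.mono hsub)).add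
        (hη.continuous.continuousOn.mul (hn.mono hsub))).intervalIntegrable
    have i2 : IntervalIntegrable (fun τ => deriv η τ * (∫ x in s..τ, n x) + η τ * n τ)
        volume a' (b + 1) :=
      ((hη'.continuousOn.mul (hNc.mono hsub)).add
        (hη.continuous.continuousOn.mul (hn.mono hsub))).intervalIntegrable
    have h3 := intervalIntegral.integral_sub i1 i2
    rw [h1, h2, sub_zero] at h3
    rw [← h3]
    refine intervalIntegral.integral_congr fun τ _ => ?_
    simp only [hk]; ring
  -- A reference bump of integral 1 inside (t₀, ∞); its pairing with k defines the constant C that k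
  -- must equal.
  let bump : ContDiffBump (t₀ + 2) := ⟨1 / 2, 1, by norm_num, by norm_num⟩
  set g₀ : ℝ → ℝ := bump.normed volume with hg₀
  have hg₀c : ContDiff ℝ ∞ g₀ := bump.contDiff_normed
  have hg₀s : tsupport g₀ = Metric.closedBall (t₀ + 2) 1 := bump.tsupport_normed_eq
  have hg₀1 : ∫ τ, g₀ τ = 1 := bump.integral_normed
  set C := ∫ τ, g₀ τ * k τ with hC
  have hball : Metric.closedBall (t₀ + 2) 1 ⊆ Ioi t₀ := by
    intro x hx
    rw [Metric.mem_closedBall, Real.dist_eq, abs_le] at hx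
    simp only [mem_Ioi]; linarith [hx.1]
  have hprodint : ∀ g : ℝ → ℝ, Continuous g → HasCompactSupport g → tsupport g ⊆ Ioi t₀ →
      ∀ k : ℝ → ℝ, ContinuousOn k (Ioi t₀) → Integrable fun τ => g τ * k τ := by
    intro g hg hgc hgs k hk
    have h1 : IntegrableOn (fun τ => g τ * k τ) (tsupport g) :=
      (hg.continuousOn.mul (hk.mono hgs)).integrableOn_compact hgc
    refine (integrableOn_iff_integrable_of_support_subset fun x hx => ?_).1 h1
    exact subset_tsupport _ (left_ne_zero_of_mul hx)
  have hae : ∀ᵐ x, x ∈ Ioi t₀ → k x - C = 0 := by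
    refine isOpen_Ioi.ae_eq_zero_of_integral_contDiff_smul_eq_zero
      ((hkc.sub continuousOn_const).locallyIntegrableOn measurableSet_Ioi) fun g hg hgc hgs => ?_
    set I := ∫ τ, g τ
    have hg₀cs : HasCompactSupport g₀ := bump.hasCompactSupport_normed
    -- Subtracting I g₀ from g makes the integral vanish, so the difference is the derivative of a
    -- test function and pairs to zero with k. Thus ∫ g k = I C = ∫ g C.
    have hχc : ContDiff ℝ ∞ fun τ => g τ - I * g₀ τ := hg.sub (contDiff_const.mul hg₀c)
    have hK : IsCompact (tsupport g ∪ tsupport g₀) := hgc.union hg₀cs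
    have hKne : (tsupport g ∪ tsupport g₀).Nonempty :=
      ⟨t₀ + 2, Or.inr (by rw [hg₀s]; simp)⟩
    obtain ⟨a, haK, ha⟩ := hK.exists_isLeast hKne
    obtain ⟨b, hbK, hb⟩ := hK.exists_isGreatest hKne
    have hKsub : tsupport g ∪ tsupport g₀ ⊆ Ioi t₀ :=
      union_subset hgs (by rw [hg₀s]; exact hball)
    have hsup : Function.support (fun τ => g τ - I * g₀ τ) ⊆ Icc a b := by
      intro x hx
      have hxK : x ∈ tsupport g ∪ tsupport g₀ := by
        by_contra hn
        rw [mem_union, not_or] at hn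
        exact hx (by simp [image_eq_zero_of_notMem_tsupport hn.1,
          image_eq_zero_of_notMem_tsupport hn.2])
      exact ⟨ha hxK, hb hxK⟩
    have hgi : Integrable g := hg.continuous.integrable_of_hasCompactSupport hgc
    have hg₀i : Integrable g₀ := hg₀c.continuous.integrable_of_hasCompactSupport hg₀cs
    have hint0 : ∫ τ, (g τ - I * g₀ τ) = 0 := by
      rw [integral_sub hgi (hg₀i.const_mul _), integral_const_mul, hg₀1, mul_one, sub_self]
    obtain ⟨η, hη, hηs, hηd⟩ := exists_primitive_of_integral_eq_zero hχc hsup hint0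
    obtain ⟨a', b', ha', haa', hbb', hz⟩ := hwk η a b (hKsub haK) (hb haK) hη hηs
    rw [hηd] at hz
    have hab : a ≤ b := hb haK
    rw [intervalIntegral.integral_of_le (by linarith), ← integral_Icc_eq_integral_Ioc,
      setIntegral_eq_integral_of_forall_compl_eq_zero] at hz
    · have e1 : ∀ τ, (g τ - I * g₀ τ) * k τ = g τ * k τ - I * (g₀ τ * k τ) := fun τ => by ring
      have j1 := hprodint g hg.continuous hgc hgs k hkc
      have j2 := hprodint g₀ hg₀c.continuous hg₀cs (by rw [hg₀s]; exact hball) k hkc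
      simp_rw [e1] at hz
      rw [integral_sub j1 (j2.const_mul _), integral_const_mul] at hz
      have e2 : ∀ τ, g τ • (k τ - C) = g τ * k τ - g τ * C := fun τ => by
        rw [smul_eq_mul]; ring
      simp_rw [e2]
      rw [integral_sub j1 (hgi.mul_const _), integral_mul_const]
      exact hz
    · intro x hx
      have : g x - I * g₀ x = 0 := by
        by_contra hne
        have := hsup hne
        exact hx ⟨haa'.le.trans this.1, this.2.trans hbb'.le⟩
      simp only [this, zero_mul]
  have hEq : EqOn k (fun _ => C) (Ioi t₀) := by
    refine Measure.eqOn_open_of_ae_eq (μ := volume) ?_ isOpen_Ioi hkc continuousOn_const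
    exact (ae_restrict_iff' measurableSet_Ioi).2 (hae.mono fun x hx hxt => sub_eq_zero.1 (hx hxt))
  have h1 : k s = k t := (hEq hs).trans (hEq (lt_of_lt_of_le hs hst)).symm
  simp only [hk, intervalIntegral.integral_same, sub_zero] at h1
  linarith

end WeakDerivative

/-! ### From the weak formulation to an evolution equation in L²_V -/

noncomputable section

namespace FastDiffusion

section WeakEquation

variable {N : ℕ} {Ω : Set (Space N)}

theorem isTestFunction_mul {η : ℝ → ℝ} {a b : ℝ} (ha : 0 < a) (hη : ContDiff ℝ ∞ η)
    (hs : tsupport η ⊆ Ioo a b) {ψ : Space N → ℝ} (hψ : IsTestFunction Ω ψ) :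
    IsTestFunction (Ioi (0 : ℝ) ×ˢ Ω) fun z : ℝ × Space N => η z.1 * ψ z.2 := by
  have hsub : tsupport (fun z : ℝ × Space N => η z.1 * ψ z.2) ⊆ tsupport η ×ˢ tsupport ψ := by
    refine closure_minimal (fun z hz => ?_) ((isClosed_tsupport η).prod (isClosed_tsupport ψ))
    exact ⟨subset_tsupport _ (left_ne_zero_of_mul hz), subset_tsupport _ (right_ne_zero_of_mul hz)⟩
  have hηc : IsCompact (tsupport η) :=
    isCompact_Icc.of_isClosed_subset (isClosed_tsupport η) (hs.trans Ioo_subset_Icc_self)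
  refine ⟨(hη.comp contDiff_fst).mul (hψ.1.comp contDiff_snd),
    (hηc.prod hψ.2.1).of_isClosed_subset (isClosed_tsupport _) hsub, hsub.trans ?_⟩
  exact prod_mono (fun x hx => ha.trans (hs hx).1) hψ.2.2

theorem integrable_inner_gradient {a b : ℝ} {v : ℝ → Space N → ℝ} {Dv : ℝ → Space N → Space N}
    (hfin : IsFiniteMeasure (volume.restrict Ω))
    (hDm : AEStronglyMeasurable (fun z : ℝ × Space N => Dv z.1 z.2)
      ((volume.restrict (Icc a b)).prod (volume.restrict Ω)))
    (hDi : Integrable (fun z : ℝ × Space N => v z.1 z.2 ^ 2 + ‖Dv z.1 z.2‖ ^ 2)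
      ((volume.restrict (Icc a b)).prod (volume.restrict Ω)))
    {ψ : Space N → ℝ} (hψ : IsTestFunction Ω ψ) :
    Integrable (fun z : ℝ × Space N => inner ℝ (Dv z.1 z.2) (gradient ψ z.2))
      ((volume.restrict (Icc a b)).prod (volume.restrict Ω)) := by
  have hgc : Continuous (gradient ψ) := hψ.1.continuous_gradient (by simp)
  obtain ⟨C, hC⟩ := hψ.2.1.gradient.exists_bound_of_continuous hgc
  refine Integrable.mono' ((hDi.add (integrable_const (1 : ℝ))).const_mul C)
    (hDm.inner (hgc.comp continuous_snd).aestronglyMeasurable) (Eventually.of_forall fun z => ?_)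
  have hC0 : 0 ≤ C := (norm_nonneg _).trans (hC z.2)
  refine (norm_inner_le_norm _ _).trans ?_
  calc ‖Dv z.1 z.2‖ * ‖gradient ψ z.2‖ ≤ ‖Dv z.1 z.2‖ * C := by gcongr; exact hC _
    _ ≤ (v z.1 z.2 ^ 2 + ‖Dv z.1 z.2‖ ^ 2 + 1) * C := by
        gcongr
        nlinarith [sq_nonneg (v z.1 z.2), sq_nonneg (‖Dv z.1 z.2‖ - 1)]
    _ = _ := by simp only [Pi.add_apply]; ring

/-- The weak formulation against products of test functions of time and space. -/
theorem weak_equation_of_product_test {p c K t₀ a b : ℝ} {v : ℝ → Space N → ℝ}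
    {Dv : ℝ → Space N → Space N} (hΩ : MeasurableSet Ω)
    (hfin : IsFiniteMeasure (volume.restrict Ω)) (ht₀ : 0 ≤ t₀) (ha : t₀ < a)
    (hvm : AEStronglyMeasurable (fun z : ℝ × Space N => v z.1 z.2)
      ((volume.restrict (Icc a b)).prod (volume.restrict Ω)))
    (hK : ∀ᵐ z ∂((volume.restrict (Icc a b)).prod (volume.restrict Ω)), |v z.1 z.2 ^ p| ≤ K)
    (hDm : AEStronglyMeasurable (fun z : ℝ × Space N => Dv z.1 z.2)
      ((volume.restrict (Icc a b)).prod (volume.restrict Ω)))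
    (hDi : Integrable (fun z : ℝ × Space N => v z.1 z.2 ^ 2 + ‖Dv z.1 z.2‖ ^ 2)
      ((volume.restrict (Icc a b)).prod (volume.restrict Ω)))
    (hw : ∀ ψ : ℝ × Space N → ℝ, IsTestFunction (Ioi (0 : ℝ) ×ˢ Ω) ψ →
      ∫ z, (v z.1 z.2 ^ p * deriv (fun s => ψ (s, z.2)) z.1
            - inner ℝ (Dv z.1 z.2) (gradient (fun y => ψ (z.1, y)) z.2)
            + c * v z.1 z.2 ^ p * ψ z)
        ∂((volume.restrict (Ioi (0 : ℝ))).prod (volume.restrict Ω)) = 0)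
    {η : ℝ → ℝ} (hη : ContDiff ℝ ∞ η) (hs : tsupport η ⊆ Ioo a b)
    {ψ : Space N → ℝ} (hψ : IsTestFunction Ω ψ) :
    ∫ τ in Icc a b, (deriv η τ * (∫ x in Ω, v τ x ^ p * ψ x)
      - η τ * (∫ x in Ω, inner ℝ (Dv τ x) (gradient ψ x))
      + c * η τ * (∫ x in Ω, v τ x ^ p * ψ x)) = 0 := by
  have ha0 : 0 < a := lt_of_le_of_lt ht₀ ha
  have hη' : Continuous (deriv η) := hη.continuous_deriv (by simp)
  have hηz : ∀ τ, τ ∉ Icc a b → η τ = 0 ∧ deriv η τ = 0 := by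
    intro τ hτ
    have h1 : τ ∉ tsupport η := fun h => hτ (Ioo_subset_Icc_self (hs h))
    refine ⟨image_eq_zero_of_notMem_tsupport h1, ?_⟩
    by_contra hne
    exact h1 (support_deriv_subset hne)
  have hηcs : HasCompactSupport η :=
    isCompact_Icc.of_isClosed_subset (isClosed_tsupport η) (hs.trans Ioo_subset_Icc_self)
  obtain ⟨C0, hC0⟩ := hηcs.exists_bound_of_continuous hη.continuous
  obtain ⟨C1, hC1⟩ := hηcs.deriv.exists_bound_of_continuous hη'
  obtain ⟨Cψ, hCψ⟩ := hψ.2.1.exists_bound_of_continuous hψ.1.continuous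
  have hvp : AEStronglyMeasurable (fun z : ℝ × Space N => v z.1 z.2 ^ p)
      ((volume.restrict (Icc a b)).prod (volume.restrict Ω)) :=
    (hvm.aemeasurable.pow_const p).aestronglyMeasurable
  have hA : ∀ θ : ℝ → ℝ, Continuous θ → (∃ C, ∀ τ, ‖θ τ‖ ≤ C) →
      Integrable (fun z : ℝ × Space N => θ z.1 * (v z.1 z.2 ^ p * ψ z.2))
      ((volume.restrict (Icc a b)).prod (volume.restrict Ω)) := by
    rintro θ hθ ⟨C, hC⟩
    refine Integrable.of_bound ((hθ.comp continuous_fst).aestronglyMeasurable.mul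
      (hvp.mul (hψ.1.continuous.comp continuous_snd).aestronglyMeasurable)) (C * (K * Cψ)) ?_
    filter_upwards [hK] with z hz
    rw [norm_mul, norm_mul]
    have := (norm_nonneg _).trans (hC z.1)
    have := (abs_nonneg _).trans hz
    gcongr
    · exact hC _
    · exact hz
    · exact hCψ _
  have hB0 := integrable_inner_gradient hfin hDm hDi hψ
  have hB : Integrable (fun z : ℝ × Space N => η z.1 * inner ℝ (Dv z.1 z.2) (gradient ψ z.2))
      ((volume.restrict (Icc a b)).prod (volume.restrict Ω)) :=
    hB0.bdd_mul (hη.continuous.comp continuous_fst).aestronglyMeasurable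
      (Eventually.of_forall fun z => hC0 z.1)
  have hA1 := hA _ hη' ⟨C1, hC1⟩
  have hA2 := (hA _ hη.continuous ⟨C0, hC0⟩).const_mul c
  have h0 := hw _ (isTestFunction_mul ha0 hη hs hψ)
  -- As η is supported in (a, b), the time domain shrinks to [a, b], where the integrability bounds
  -- are available.
  rw [Measure.prod_restrict, setIntegral_eq_of_subset_of_forall_sdiff_eq_zero
    (s := Icc a b ×ˢ Ω) (measurableSet_Ioi.prod hΩ) (prod_mono (fun x hx => ha0.trans_le hx.1)
      subset_rfl), ← Measure.prod_restrict] at h0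
  · have e1 : ∀ z : ℝ × Space N, v z.1 z.2 ^ p * deriv (fun s => η s * ψ z.2) z.1
            - inner ℝ (Dv z.1 z.2) (gradient (fun y => η z.1 * ψ y) z.2)
            + c * v z.1 z.2 ^ p * (η z.1 * ψ z.2)
        = deriv η z.1 * (v z.1 z.2 ^ p * ψ z.2)
          - η z.1 * inner ℝ (Dv z.1 z.2) (gradient ψ z.2)
          + c * (η z.1 * (v z.1 z.2 ^ p * ψ z.2)) := by
      intro z
      have d1 : deriv (fun s => η s * ψ z.2) z.1 = deriv η z.1 * ψ z.2 :=
        deriv_mul_const ((hη.differentiable (by simp)) z.1) _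
      have d2 : gradient (fun y => η z.1 * ψ y) z.2 = η z.1 • gradient ψ z.2 := by
        have := congrFun (gradient_const_smul_apply' (η z.1) hψ.differentiable) z.2
        exact this
      rw [d1, d2, real_inner_smul_right]
      ring
    simp_rw [e1] at h0
    have hF : Integrable (fun z : ℝ × Space N => deriv η z.1 * (v z.1 z.2 ^ p * ψ z.2)
          - η z.1 * inner ℝ (Dv z.1 z.2) (gradient ψ z.2)
          + c * (η z.1 * (v z.1 z.2 ^ p * ψ z.2)))
        ((volume.restrict (Icc a b)).prod (volume.restrict Ω)) := (hA1.sub hB).add hA2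
    rw [integral_prod _ hF] at h0
    rw [← h0]
    refine integral_congr_ae ?_
    filter_upwards [hA1.prod_right_ae, hB.prod_right_ae, hA2.prod_right_ae] with τ j1 j2 j3
    rw [integral_add (by exact j1.sub j2) j3, integral_sub j1 j2, integral_const_mul,
      integral_const_mul, integral_const_mul, integral_const_mul]
    ring
  · intro z hz
    have hz1 : z.1 ∉ Icc a b := fun h => hz.2 ⟨h, hz.1.2⟩
    have d1 : deriv (fun s => η s * ψ z.2) z.1 = deriv η z.1 * ψ z.2 :=
      deriv_mul_const ((hη.differentiable (by simp)) z.1) _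
    simp [d1, (hηz z.1 hz1).1, (hηz z.1 hz1).2]

/-- Gradients of `v(t)` as elements of the space of gradients. -/
theorem exists_gradient_curve (hN : 1 ≤ N) (hΩ : Bornology.IsBounded Ω) {v : ℝ → Space N → ℝ}
    {Dv : ℝ → Space N → Space N}
    (hDH : ∀ᵐ t ∂(volume.restrict (Ioi (0 : ℝ))), HasH10Gradient Ω (v t) (Dv t)) :
    ∃ G : ℝ → gradientSpace Ω, ∀ᵐ t ∂(volume.restrict (Ioi (0 : ℝ))),
      (G t : Lp (Space N) 2 (volume.restrict Ω)) =ᵐ[volume.restrict Ω] Dv t ∧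
      gradientToL2 Ω (G t) =ᵐ[volume.restrict Ω] v t ∧
      ‖G t‖ ^ 2 ≤ ∫ x in Ω, (v t x ^ 2 + ‖Dv t x‖ ^ 2) := by
  have hex : ∀ t, ∃ G : gradientSpace Ω, HasH10Gradient Ω (v t) (Dv t) →
      (G : Lp (Space N) 2 (volume.restrict Ω)) =ᵐ[volume.restrict Ω] Dv t ∧
      gradientToL2 Ω G =ᵐ[volume.restrict Ω] v t := fun t => by
    by_cases ht : HasH10Gradient Ω (v t) (Dv t)
    · obtain ⟨G, hG⟩ := ht.exists_gradientSpace hN hΩ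
      exact ⟨G, fun _ => hG⟩
    · exact ⟨0, fun h => absurd h ht⟩
  -- The choice carries no measurability in t; the measurability needed later comes from pairings
  -- with test gradients, which agree almost everywhere with measurable integrals.
  choose G hG using hex
  refine ⟨G, ?_⟩
  filter_upwards [hDH] with t ht
  obtain ⟨hG, hu⟩ := hG t ht
  refine ⟨hG, hu, ?_⟩
  have e : ‖G t‖ ^ 2 = ∫ x in Ω, ‖(G t : Lp (Space N) 2 (volume.restrict Ω)) x‖ ^ 2 :=
    Lp_norm_sq_eq_integral _
  rw [e, integral_congr_ae (g := fun x => ‖Dv t x‖ ^ 2) (hG.mono fun x hx => by simp only [hx])]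
  have i1 : Integrable (fun x => ‖Dv t x‖ ^ 2) (volume.restrict Ω) := ht.2.1.integrable_norm_pow (by simp)
  have i2 : Integrable (fun x => v t x ^ 2) (volume.restrict Ω) := ht.1.integrable_sq
  exact integral_mono i1 (i2.add i1) fun x => by
    simpa using sq_nonneg (v t x)

namespace IsBoundedWeight

variable {p M : ℝ} {V : Space N → ℝ}

set_option maxHeartbeats 4000000 in
/-- Energy solutions close to `V` satisfy `(T q)' = c T q - f` weakly in `L²_V`, where
`q = (v^p - V^p) / V^{p-1}` and `f = v - V`. -/
theorem evolution_identity (h : IsBoundedWeight Ω p M V) {c : ℝ} {DV : Space N → Space N}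
    (hDV : IsWeakDirichletSolution Ω V DV fun x => c * V x ^ p) {u₀ : Space N → ℝ}
    {v : ℝ → Space N → ℝ} (hv : IsRCDPSolution Ω p c u₀ v) {t₀ K : ℝ} (ht₀ : 0 ≤ t₀)
    (hK : ∀ᵐ z ∂((volume.restrict (Ici t₀)).prod (volume.restrict Ω)), |v z.1 z.2 ^ p| ≤ K)
    {q f : ℝ → L2V Ω p V} (hq : ContinuousOn q (Ioi t₀)) (hf : ContinuousOn f (Ioi t₀))
    (hqv : ∀ t, t₀ < t → q t =ᵐ[volume.restrict Ω]
      fun x => (v t x ^ p - V x ^ p) / V x ^ (p - 1))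
    (hfv : ∀ t, t₀ < t → f t =ᵐ[volume.restrict Ω] fun x => v t x - V x)
    (y : L2V Ω p V) (s t : ℝ) (hs : t₀ < s) (hst : s ≤ t) :
    inner ℝ (q t) (h.solutionOperator y) - inner ℝ (q s) (h.solutionOperator y)
      = ∫ τ in s..t, (c * inner ℝ (q τ) (h.solutionOperator y) - inner ℝ (f τ) y) := by
  have hfin := h.isFiniteMeasure
  obtain ⟨Dv, hDm, hDH, hDi, hw⟩ := hv.weak
  obtain ⟨G₁, hG₁⟩ := exists_gradient_curve h.one_le h.bounded hDH
  obtain ⟨G₂, hG₂, hu₂⟩ := hDV.1.exists_gradientSpace h.one_le h.bounded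
  have hqc : ∀ x, ContinuousOn (fun τ => inner ℝ (q τ) (h.embedding x)) (Ioi t₀) := fun x =>
    hq.inner continuousOn_const
  have hVp : Integrable (fun x => V x ^ p) (volume.restrict Ω) := by
    refine Integrable.of_bound (h.meas.aemeasurable.pow_const p).aestronglyMeasurable (M ^ p) ?_
    filter_upwards [h.pos, h.le] with x h1 h2
    rw [Real.norm_eq_abs, abs_of_nonneg (Real.rpow_nonneg h1.le _)]
    exact Real.rpow_le_rpow h1.le h2 (by linarith [h.one_lt])
  have hqψ : ∀ τ, t₀ < τ → ∀ ψ : testFunctions Ω,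
      inner ℝ (q τ) (h.embedding (testToGradientSpace Ω ψ))
        = (∫ x in Ω, v τ x ^ p * (ψ : Space N → ℝ) x)
          - ∫ x in Ω, V x ^ p * (ψ : Space N → ℝ) x := by
    intro τ hτ ψ
    obtain ⟨C, hC⟩ := ψ.2.2.1.exists_bound_of_continuous ψ.2.1.continuous
    have hψm : AEStronglyMeasurable (ψ : Space N → ℝ) (volume.restrict Ω) :=
      ψ.2.1.continuous.aestronglyMeasurable
    have i1 : Integrable (fun x => v τ x ^ p * (ψ : Space N → ℝ) x) (volume.restrict Ω) :=
      Integrable.mul_bdd (hv.integrable τ (ht₀.trans_lt hτ)) hψm (Eventually.of_forall hC)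
    have i2 : Integrable (fun x => V x ^ p * (ψ : Space N → ℝ) x) (volume.restrict Ω) :=
      Integrable.mul_bdd hVp hψm (Eventually.of_forall hC)
    rw [h.inner_embedding_test, ← integral_sub i1 i2]
    refine integral_congr_ae ?_
    filter_upwards [hqv τ hτ, h.pos] with x hx hpos
    rw [hx, mul_div_cancel₀ _ (Real.rpow_pos_of_pos hpos _).ne', sub_mul]
  have hGψ : ∀ᵐ τ ∂(volume.restrict (Ioi (0 : ℝ))), ∀ ψ : testFunctions Ω,
      inner ℝ (G₁ τ) (testToGradientSpace Ω ψ)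
        = ∫ x in Ω, inner ℝ (Dv τ x) (gradient (ψ : Space N → ℝ) x) := by
    filter_upwards [hG₁] with τ hτ ψ
    exact inner_testToGradientSpace _ hτ.1 ψ
  have hG₂ψ : ∀ ψ : testFunctions Ω, inner ℝ G₂ (testToGradientSpace Ω ψ)
      = c * ∫ x in Ω, V x ^ p * (ψ : Space N → ℝ) x := by
    intro ψ
    rw [inner_testToGradientSpace _ hG₂ ψ, hDV.2 ψ ψ.2, ← integral_const_mul]
    simp_rw [mul_assoc]
  have hJG : ∀ᵐ τ ∂(volume.restrict (Ioi t₀)), h.embedding (G₁ τ - G₂) = f τ := by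
    have hG₁' := ae_restrict_of_ae_restrict_of_subset (Ioi_subset_Ioi ht₀) hG₁
    filter_upwards [hG₁', ae_restrict_mem measurableSet_Ioi] with τ hτ hτ0
    refine Lp.ext (h.weightedMeasure_ac.ae_le ?_)
    rw [map_sub]
    have := h.ac_weightedMeasure.ae_le (Lp.coeFn_sub (h.embedding (G₁ τ)) (h.embedding G₂))
    filter_upwards [this, h.embedding_coeFn (G₁ τ), h.embedding_coeFn G₂, hτ.2.1, hu₂, hfv τ hτ0]
      with x h1 h2 h3 h4 h5 h6
    rw [h1, h6, Pi.sub_apply, h2, h3, h4, h5]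
  have hqS : ContinuousOn (fun τ => inner ℝ (q τ) (h.solutionOperator y)) (Ioi t₀) :=
    hq.inner continuousOn_const
  have hnc : ContinuousOn (fun τ => c * inner ℝ (q τ) (h.solutionOperator y) - inner ℝ (f τ) y)
      (Ioi t₀) := (continuousOn_const.mul hqS).sub (hf.inner continuousOn_const)
  refine sub_eq_integral_of_weak_deriv hqS hnc ?_ hs hst
  intro η a b ha hab hη hηs
  have ha0 : 0 < a := ht₀.trans_lt ha
  have hsub : Icc a b ⊆ Ioi t₀ := fun x hx => ha.trans_le hx.1
  have hsub0 : Icc a b ⊆ Ioi 0 := fun x hx => ha0.trans_le hx.1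
  have hη' : Continuous (deriv η) := hη.continuous_deriv (by simp)
  have hle : (volume.restrict (Icc a b)).prod (volume.restrict Ω)
      ≤ (volume.restrict (Ioi (0 : ℝ))).prod (volume.restrict Ω) :=
    Measure.prod_mono (Measure.restrict_mono hsub0 le_rfl) le_rfl
  have hle' : (volume.restrict (Icc a b)).prod (volume.restrict Ω)
      ≤ (volume.restrict (Ici t₀)).prod (volume.restrict Ω) :=
    Measure.prod_mono (Measure.restrict_mono (hsub.trans Ioi_subset_Ici_self) le_rfl) le_rfl
  have hDia : Integrable (fun z : ℝ × Space N => v z.1 z.2 ^ 2 + ‖Dv z.1 z.2‖ ^ 2)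
      ((volume.restrict (Icc a b)).prod (volume.restrict Ω)) := by
    refine (hDi a (b + 1) ha0 (by linarith)).mono_measure
      (Measure.prod_mono (Measure.restrict_mono (Icc_subset_Icc le_rfl (by linarith)) le_rfl) le_rfl)
  have hηza : η a = 0 := image_eq_zero_of_notMem_tsupport fun hx => lt_irrefl _ (hηs hx).1
  have hηzb : η b = 0 := image_eq_zero_of_notMem_tsupport fun hx => lt_irrefl _ (hηs hx).2
  have hηint : ∫ τ in Icc a b, deriv η τ = 0 := by
    rw [integral_Icc_eq_integral_Ioc, ← intervalIntegral.integral_of_le hab,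
      intervalIntegral.integral_deriv_eq_sub (fun x _ => hη.differentiable (by simp) x)
        (hη'.intervalIntegrable _ _), hηza, hηzb, sub_zero]
  -- the identity tested against an element of the gradient space
  set Φ : gradientSpace Ω → ℝ → ℝ := fun x τ => deriv η τ * inner ℝ (q τ) (h.embedding x)
    - η τ * inner ℝ (G₁ τ - G₂) x + c * η τ * inner ℝ (q τ) (h.embedding x) with hΦ
  have hG₁i : ∀ ψ : testFunctions Ω, IntegrableOn
      (fun τ => inner ℝ (G₁ τ - G₂) (testToGradientSpace Ω ψ)) (Icc a b) := by
    intro ψ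
    have h1 := (integrable_inner_gradient hfin (hDm.mono_measure hle) hDia ψ.2).integral_prod_left
    refine (h1.sub (integrable_const (inner ℝ G₂ (testToGradientSpace Ω ψ)))).congr ?_
    filter_upwards [ae_restrict_of_ae_restrict_of_subset hsub0 hGψ] with τ hτ
    rw [inner_sub_left, hτ ψ, Pi.sub_apply]
  have hqi : ∀ θ : ℝ → ℝ, Continuous θ → ∀ x, IntegrableOn
      (fun τ => θ τ * inner ℝ (q τ) (h.embedding x)) (Icc a b) := fun θ hθ x =>
    (hθ.continuousOn.mul ((hqc x).mono hsub)).integrableOn_compact isCompact_Icc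
  obtain ⟨C0, hC0⟩ := isCompact_Icc.exists_bound_of_continuousOn
    (s := Icc a b) hη.continuous.continuousOn
  obtain ⟨C1, hC1⟩ := isCompact_Icc.exists_bound_of_continuousOn
    (s := Icc a b) hη'.continuousOn
  have hηG : ∀ ψ : testFunctions Ω, IntegrableOn
      (fun τ => η τ * inner ℝ (G₁ τ - G₂) (testToGradientSpace Ω ψ)) (Icc a b) := fun ψ =>
    (hG₁i ψ).bdd_mul hη.continuous.aestronglyMeasurable
      ((ae_restrict_iff' measurableSet_Icc).2 (Eventually.of_forall hC0))
  -- Subtracting the stationary profile leaves only the term mV η', since the two terms c mV η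
  -- cancel; and η' has integral zero.
  have hΦtest : ∀ ψ : testFunctions Ω,
      ∫ τ in Icc a b, Φ (testToGradientSpace Ω ψ) τ = 0 := by
    intro ψ
    have hwe := weak_equation_of_product_test h.isOpen.measurableSet hfin ht₀ ha
      (hv.measurable.mono_measure hle) (hle'.absolutelyContinuous.ae_le hK)
      (hDm.mono_measure hle) hDia hw hη hηs ψ.2
    set mV := ∫ x in Ω, V x ^ p * (ψ : Space N → ℝ) x with hmV
    have e : ∫ τ in Icc a b, Φ (testToGradientSpace Ω ψ) τ = ∫ τ in Icc a b,
        ((deriv η τ * (∫ x in Ω, v τ x ^ p * (ψ : Space N → ℝ) x)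
      - η τ * (∫ x in Ω, inner ℝ (Dv τ x) (gradient (ψ : Space N → ℝ) x))
      + c * η τ * (∫ x in Ω, v τ x ^ p * (ψ : Space N → ℝ) x)) - mV * deriv η τ) := by
      refine integral_congr_ae ?_
      filter_upwards [ae_restrict_of_ae_restrict_of_subset hsub0 hGψ,
        ae_restrict_mem measurableSet_Icc] with τ hτ hτ'
      simp only [hΦ]
      rw [hqψ τ (hsub hτ') ψ, inner_sub_left, hτ ψ, hG₂ψ ψ]
      ring
    have hi : IntegrableOn (fun τ => deriv η τ * (∫ x in Ω, v τ x ^ p * (ψ : Space N → ℝ) x)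
      - η τ * (∫ x in Ω, inner ℝ (Dv τ x) (gradient (ψ : Space N → ℝ) x))
      + c * η τ * (∫ x in Ω, v τ x ^ p * (ψ : Space N → ℝ) x)) (Icc a b) := by
      have i0 : IntegrableOn (Φ (testToGradientSpace Ω ψ)) (Icc a b) :=
        ((hqi _ hη' _).sub (hηG ψ)).add (hqi (fun τ => c * η τ) (by fun_prop) _)
      refine (i0.add ((hη'.continuousOn.integrableOn_compact isCompact_Icc).const_mul mV)).congr ?_
      filter_upwards [ae_restrict_of_ae_restrict_of_subset hsub0 hGψ,
        ae_restrict_mem measurableSet_Icc] with τ hτ hτ'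
      simp only [hΦ, Pi.add_apply]
      rw [hqψ τ (hsub hτ') ψ, inner_sub_left, hτ ψ, hG₂ψ ψ]
      ring
    rw [e, integral_sub hi ((hη'.continuousOn.integrableOn_compact isCompact_Icc).const_mul mV),
      hwe, integral_const_mul, hηint, mul_zero, sub_zero]
  -- Test gradients are dense. The limit passes under the time integral because ‖G₁‖ ≤ 1 + ‖G₁‖²,
  -- which is dominated by the integrable energy.
  have hΦall : ∀ x : gradientSpace Ω, ∫ τ in Icc a b, Φ x τ = 0 := by
    intro x
    obtain ⟨x', hx', hlim⟩ := mem_closure_iff_seq_limit.1 (denseRange_testToGradientSpace x)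
    choose ψ hψ using hx'
    obtain ⟨R, hR⟩ := hlim.norm.bddAbove_range
    have hR' : ∀ n, ‖x' n‖ ≤ R := fun n => hR ⟨n, rfl⟩
    have hR0 : 0 ≤ R := (norm_nonneg _).trans (hR' 0)
    obtain ⟨Q, hQ⟩ := isCompact_Icc.exists_bound_of_continuousOn (hq.mono hsub)
    have hlimΦ : Tendsto (fun n => ∫ τ in Icc a b, Φ (x' n) τ) atTop
        (𝓝 (∫ τ in Icc a b, Φ x τ)) := by
      refine tendsto_integral_of_dominated_convergence (fun τ => C1 * (Q * (‖h.embedding‖ * R))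
        + C0 * ((1 + (∫ x in Ω, (v τ x ^ 2 + ‖Dv τ x‖ ^ 2)) + ‖G₂‖) * R)
        + |c| * C0 * (Q * (‖h.embedding‖ * R))) (fun n => ?_) ?_ (fun n => ?_) ?_
      · rw [← hψ]
        have i0 : IntegrableOn (Φ (testToGradientSpace Ω (ψ n))) (Icc a b) :=
          ((hqi _ hη' _).sub (hηG _)).add (hqi (fun τ => c * η τ) (by fun_prop) _)
        exact i0.aestronglyMeasurable
      · exact ((integrable_const _).add (((((integrable_const _).add
          hDia.integral_prod_left).add (integrable_const _)).mul_const _).const_mul _)).add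
          (integrable_const _)
      · filter_upwards [ae_restrict_of_ae_restrict_of_subset hsub0 hG₁,
          ae_restrict_mem measurableSet_Icc] with τ hτ hτ'
        have b1 : |inner ℝ (q τ) (h.embedding (x' n))| ≤ Q * (‖h.embedding‖ * R) := by
          refine (abs_real_inner_le_norm _ _).trans ?_
          have := (norm_nonneg _).trans (hQ τ hτ')
          gcongr
          · exact hQ τ hτ'
          · exact (h.embedding.le_opNorm _).trans (by gcongr; exact hR' n)
        have b2 : |inner ℝ (G₁ τ - G₂) (x' n)|
            ≤ (1 + (∫ x in Ω, (v τ x ^ 2 + ‖Dv τ x‖ ^ 2)) + ‖G₂‖) * R := by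
          refine (abs_real_inner_le_norm _ _).trans ?_
          have b3 : ‖G₁ τ‖ ≤ 1 + ∫ x in Ω, (v τ x ^ 2 + ‖Dv τ x‖ ^ 2) := by
            nlinarith [hτ.2.2, sq_nonneg (‖G₁ τ‖ - 1)]
          have b4 := (norm_nonneg _).trans b3
          gcongr
          · exact (norm_sub_le _ _).trans (by gcongr)
          · exact hR' n
        have c0 := hC0 τ hτ'
        have c1 := hC1 τ hτ'
        rw [Real.norm_eq_abs] at c0 c1 ⊢
        simp only [hΦ]
        refine (abs_add_le _ _).trans (add_le_add ((abs_sub _ _).trans (add_le_add ?_ ?_)) ?_)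
        · rw [abs_mul]
          exact mul_le_mul c1 b1 (abs_nonneg _) ((abs_nonneg _).trans c1)
        · rw [abs_mul]
          exact mul_le_mul c0 b2 (abs_nonneg _) ((abs_nonneg _).trans c0)
        · rw [abs_mul, abs_mul]
          exact mul_le_mul (by gcongr) b1 (abs_nonneg _)
            (mul_nonneg (abs_nonneg _) ((abs_nonneg _).trans c0))
      · refine Eventually.of_forall fun τ => ?_
        have l1 : Tendsto (fun n => inner ℝ (q τ) (h.embedding (x' n))) atTop
            (𝓝 (inner ℝ (q τ) (h.embedding x))) :=
          tendsto_const_nhds.inner ((h.embedding.continuous.tendsto x).comp hlim)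
        have l2 : Tendsto (fun n => inner ℝ (G₁ τ - G₂) (x' n)) atTop
            (𝓝 (inner ℝ (G₁ τ - G₂) x)) := tendsto_const_nhds.inner hlim
        exact ((l1.const_mul _).sub (l2.const_mul _)).add (l1.const_mul _)
    refine tendsto_nhds_unique hlimΦ (tendsto_const_nhds.congr fun n => ?_)
    rw [← hψ, hΦtest]
  -- The choice x = J* y turns the gradient pairing into ⟨J(G₁ - G₂), y⟩ = ⟨f, y⟩ and J x into T y.
  rw [intervalIntegral.integral_of_le hab, ← integral_Icc_eq_integral_Ioc,
    ← hΦall (h.solutionGradient y)]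
  refine integral_congr_ae ?_
  filter_upwards [ae_restrict_of_ae_restrict_of_subset hsub hJG] with τ hτ
  have e1 : inner ℝ (G₁ τ - G₂) (h.solutionGradient y) = inner ℝ (f τ) y := by
    rw [real_inner_comm, h.inner_solutionGradient, hτ, real_inner_comm]
  have e2 : h.embedding (h.solutionGradient y) = h.solutionOperator y := rfl
  simp only [hΦ]
  rw [e1, e2]
  ring

end IsBoundedWeight

end WeakEquation

end FastDiffusion

end

/-! ### Pointwise inequalities for powers -/

noncomputable section

namespace FastDiffusion

section PowerInequalities

variable {p : ℝ}

theorem mul_abs_sub_le_abs_rpow_sub (hp : 1 < p) {a b : ℝ} (ha : 1 / 2 ≤ a) (hb : 1 / 2 ≤ b) :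
    p * (1 / 2) ^ (p - 1) * |a - b| ≤ |a ^ p - b ^ p| := by
  wlog hab : b ≤ a generalizing a b
  · rw [abs_sub_comm a, abs_sub_comm (a ^ p)]
    exact this hb ha (le_of_not_ge hab)
  have hd : ∀ x : ℝ, HasDerivAt (fun x : ℝ => x ^ p) (p * x ^ (p - 1)) x := fun x =>
    Real.hasDerivAt_rpow_const (Or.inr hp.le)
  have key := (convex_Ici (1 / 2 : ℝ)).mul_sub_le_image_sub_of_le_deriv
    (f := fun x : ℝ => x ^ p) (fun x _ => (hd x).continuousAt.continuousWithinAt)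
    (fun x _ => (hd x).differentiableAt.differentiableWithinAt) (C := p * (1 / 2) ^ (p - 1))
    (fun x hx => by
      rw [(hd x).deriv]
      rw [interior_Ici, mem_Ioi] at hx
      exact mul_le_mul_of_nonneg_left (Real.rpow_le_rpow (by norm_num) hx.le (by linarith))
        (by linarith)) b hb a ha hab
  rw [abs_of_nonneg (sub_nonneg.2 hab)]
  exact key.trans (le_abs_self _)

/-- A second-order Taylor bound obtained by two mean value estimates: first for the derivative p
s^{p-1} - p, then for s^p - p s. -/
theorem exists_abs_rpow_sub_one_sub_le (p : ℝ) :
    ∃ C : ℝ, 0 < C ∧ ∀ s : ℝ, |s - 1| ≤ 1 / 2 → |s ^ p - 1 - p * (s - 1)| ≤ C * |s - 1| ^ 2 := by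
  have hmem : ∀ {s : ℝ}, |s - 1| ≤ 1 / 2 ↔ s ∈ Icc (1 / 2 : ℝ) (3 / 2) := fun {s} => by
    rw [abs_le, mem_Icc]
    constructor <;> rintro ⟨h1, h2⟩ <;> constructor <;> linarith
  have hpos : ∀ s ∈ Icc (1 / 2 : ℝ) (3 / 2), s ≠ 0 := fun s hs => by linarith [hs.1]
  obtain ⟨K, hK⟩ := isCompact_Icc.exists_bound_of_continuousOn
    (f := fun s : ℝ => p * ((p - 1) * s ^ (p - 1 - 1))) (s := Icc (1 / 2 : ℝ) (3 / 2))
    (continuousOn_const.mul (continuousOn_const.mul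
      (continuousOn_id.rpow_const fun s hs => Or.inl (hpos s hs))))
  have hone : (1 : ℝ) ∈ Icc (1 / 2 : ℝ) (3 / 2) := by constructor <;> norm_num
  have h1 : ∀ s ∈ Icc (1 / 2 : ℝ) (3 / 2), |p * s ^ (p - 1) - p| ≤ K * |s - 1| := by
    intro s hs
    have := Convex.norm_image_sub_le_of_norm_hasDerivWithin_le
      (f := fun s : ℝ => p * s ^ (p - 1)) (s := Icc (1 / 2 : ℝ) (3 / 2))
      (fun x hx => ((Real.hasDerivAt_rpow_const (Or.inl (hpos x hx))).const_mul p).hasDerivWithinAt)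
      hK (convex_Icc _ _) hone hs
    simpa using this
  have hK0 : 0 ≤ K := (norm_nonneg _).trans (hK 1 hone)
  refine ⟨K + 1, by linarith, fun s hs => ?_⟩
  have hsub : ∀ x ∈ uIcc 1 s, x ∈ Icc (1 / 2 : ℝ) (3 / 2) ∧ |x - 1| ≤ |s - 1| := fun x hx =>
    ⟨OrdConnected.uIcc_subset ordConnected_Icc hone (hmem.1 hs) hx, abs_sub_left_of_mem_uIcc hx⟩
  have h2 := Convex.norm_image_sub_le_of_norm_hasDerivWithin_le
      (f := fun s : ℝ => s ^ p - p * s) (s := uIcc 1 s) (x := 1) (y := s) (C := K * |s - 1|)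
      (fun x hx => ((Real.hasDerivAt_rpow_const (Or.inl (hpos x (hsub x hx).1))).sub
        ((hasDerivAt_id x).const_mul p)).hasDerivWithinAt)
      (fun x hx => by
        rw [mul_one]
        exact (h1 x (hsub x hx).1).trans (mul_le_mul_of_nonneg_left (hsub x hx).2 hK0))
      (convex_uIcc _ _) left_mem_uIcc right_mem_uIcc
  simp only [Real.norm_eq_abs, Real.one_rpow] at h2
  rw [show s ^ p - 1 - p * (s - 1) = s ^ p - p * s - (1 - p * 1) by ring]
  refine h2.trans ?_
  nlinarith [sq_nonneg |s - 1|]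

/-- The difference of the two sides has derivative (p + 1)(x - 1)(x^{p-1} - (1/2)^{p-1}), which has
the sign of x - 1 on [1/2, ∞); its minimum there is 0, at x = 1. -/
theorem sq_sub_one_le_entropy_density (hp : 1 < p) {s : ℝ} (hs : 1 / 2 ≤ s) :
    (p + 1) / 2 * (1 / 2) ^ (p - 1) * (s - 1) ^ 2
      ≤ s ^ (p + 1) - 1 - (p + 1) / p * (s ^ p - 1) := by
  set c : ℝ := (p + 1) / 2 * (1 / 2) ^ (p - 1) with hc
  set g : ℝ → ℝ := fun s => s ^ (p + 1) - 1 - (p + 1) / p * (s ^ p - 1) - c * (s - 1) ^ 2 with hg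
  have hp0 : p ≠ 0 := by linarith
  have hd : ∀ x : ℝ, 1 / 2 ≤ x → HasDerivAt g
      ((p + 1) * (x - 1) * (x ^ (p - 1) - (1 / 2) ^ (p - 1))) x := by
    intro x hx
    have hx0 : 0 < x := by linarith
    have h1 : HasDerivAt (fun x : ℝ => x ^ (p + 1)) ((p + 1) * x ^ (p + 1 - 1)) x :=
      Real.hasDerivAt_rpow_const (Or.inl hx0.ne')
    have h2 : HasDerivAt (fun x : ℝ => x ^ p) (p * x ^ (p - 1)) x :=
      Real.hasDerivAt_rpow_const (Or.inl hx0.ne')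
    have h3 : HasDerivAt (fun x : ℝ => (x - 1) ^ 2) (2 * (x - 1)) x := by
      refine (((hasDerivAt_id x).sub_const 1).pow 2).congr_deriv ?_
      simp
    have h4 := ((h1.sub_const 1).sub ((h2.sub_const 1).const_mul ((p + 1) / p))).sub
      (h3.const_mul c)
    refine h4.congr_deriv ?_
    have e : x ^ (p + 1 - 1) = x * x ^ (p - 1) := by
      rw [← Real.rpow_one_add' hx0.le (by linarith)]
      congr 1
      ring
    rw [e, hc]
    field_simp
  have hmono : ∀ x : ℝ, 1 / 2 ≤ x → 0 ≤ x ^ (p - 1) - (1 / 2) ^ (p - 1) := fun x hx =>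
    sub_nonneg.2 (Real.rpow_le_rpow (by norm_num) hx (by linarith))
  have hg1 : g 1 = 0 := by simp [hg]
  suffices 0 ≤ g s by
    simp only [hg] at this
    linarith
  rw [← hg1]
  rcases le_total s 1 with h | h
  · refine antitoneOn_of_deriv_nonpos (convex_Icc (1 / 2 : ℝ) 1)
      (fun x hx => (hd x hx.1).continuousAt.continuousWithinAt)
      (fun x hx => ?_) (fun x hx => ?_) ⟨hs, h⟩ ⟨by norm_num, le_rfl⟩ h
    · exact (hd x (interior_subset hx).1).differentiableAt.differentiableWithinAt
    · have hx' := interior_subset hx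
      rw [(hd x hx'.1).deriv]
      exact mul_nonpos_of_nonpos_of_nonneg
        (mul_nonpos_of_nonneg_of_nonpos (by linarith) (by linarith [hx'.2])) (hmono x hx'.1)
  · have hI : ∀ x ∈ Ici (1 : ℝ), (1 / 2 : ℝ) ≤ x := fun x hx => by
      rw [mem_Ici] at hx
      linarith
    refine monotoneOn_of_deriv_nonneg (convex_Ici (1 : ℝ))
      (fun x hx => (hd x (hI x hx)).continuousAt.continuousWithinAt)
      (fun x hx => ?_) (fun x hx => ?_) self_mem_Ici h h
    · exact (hd x (hI x (interior_subset hx))).differentiableAt.differentiableWithinAt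
    · have hx' : x ∈ Ici (1 : ℝ) := interior_subset hx
      rw [(hd x (hI x hx')).deriv]
      exact mul_nonneg (mul_nonneg (by linarith) (by linarith [mem_Ici.1 hx']))
        (hmono x (hI x hx'))

/-- Homogeneity reduces estimates in w and V to one variable s = w / V near 1. -/
theorem rpow_sub_rpow_div_eq {w V : ℝ} (hw : 0 ≤ w) (hV : 0 < V) :
    (w ^ p - V ^ p) / V ^ (p - 1) = V * ((w / V) ^ p - 1) := by
  have h1 : V ^ p = V * V ^ (p - 1) := by
    rw [Real.rpow_sub_one hV.ne']
    field_simp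
  have h2 : 0 < V ^ (p - 1) := Real.rpow_pos_of_pos hV _
  rw [Real.div_rpow hw hV.le, h1]
  field_simp

theorem abs_div_sub_one_le {w V δ : ℝ} (hV : 0 < V) (h : |w - V| ≤ δ * V) :
    |w / V - 1| ≤ δ := by
  rw [show w / V - 1 = (w - V) / V by field_simp, abs_div, abs_of_pos hV, div_le_iff₀ hV]
  exact h

theorem nonneg_of_abs_sub_le {w V δ : ℝ} (hV : 0 < V) (hδ : δ ≤ 1 / 2) (h : |w - V| ≤ δ * V) :
    0 ≤ w := by
  have := (abs_le.1 h).1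
  nlinarith

theorem half_le_div_of_abs_sub_le {w V : ℝ} (hV : 0 < V) (h : |w - V| ≤ 1 / 2 * V) :
    1 / 2 ≤ w / V := by
  have := (abs_le.1 (abs_div_sub_one_le hV h)).1
  linarith

theorem mul_abs_sub_le_abs_relative_sub (hp : 1 < p) {w₁ w₂ V : ℝ} (hV : 0 < V)
    (h₁ : |w₁ - V| ≤ 1 / 2 * V) (h₂ : |w₂ - V| ≤ 1 / 2 * V) :
    p * (1 / 2) ^ (p - 1) * |w₁ - w₂|
      ≤ |(w₁ ^ p - V ^ p) / V ^ (p - 1) - (w₂ ^ p - V ^ p) / V ^ (p - 1)| := by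
  rw [rpow_sub_rpow_div_eq (nonneg_of_abs_sub_le hV le_rfl h₁) hV,
    rpow_sub_rpow_div_eq (nonneg_of_abs_sub_le hV le_rfl h₂) hV, ← mul_sub, abs_mul, abs_of_pos hV]
  have := mul_le_mul_of_nonneg_left (mul_abs_sub_le_abs_rpow_sub hp
    (half_le_div_of_abs_sub_le hV h₁) (half_le_div_of_abs_sub_le hV h₂)) hV.le
  have e : |w₁ - w₂| = V * |w₁ / V - w₂ / V| := by
    rw [← sub_div, abs_div, abs_of_pos hV]
    field_simp
  rw [e, show (w₁ / V) ^ p - 1 - ((w₂ / V) ^ p - 1) = (w₁ / V) ^ p - (w₂ / V) ^ p by ring]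
  linarith

/-- One factor |w / V - 1| of the quadratic remainder is bounded by δ; this is how δ becomes the
relative error between q and p f. -/
theorem exists_abs_relative_sub_le (p : ℝ) : ∃ C : ℝ, 0 < C ∧ ∀ w V δ : ℝ, 0 < V → δ ≤ 1 / 2 →
    |w - V| ≤ δ * V →
      |(w ^ p - V ^ p) / V ^ (p - 1) - p * (w - V)| ≤ C * δ * |w - V| := by
  obtain ⟨C, hC0, hC⟩ := exists_abs_rpow_sub_one_sub_le p
  refine ⟨C, hC0, fun w V δ hV hδ h => ?_⟩
  have h1 := abs_div_sub_one_le hV h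
  have h2 := hC (w / V) (h1.trans hδ)
  rw [rpow_sub_rpow_div_eq (nonneg_of_abs_sub_le hV hδ h) hV]
  have e : w - V = V * (w / V - 1) := by field_simp
  have e2 : V * ((w / V) ^ p - 1) - p * (w - V)
      = V * ((w / V) ^ p - 1 - p * (w / V - 1)) := by
    field_simp
  rw [e2, e, abs_mul, abs_mul, abs_of_pos hV]
  refine (mul_le_mul_of_nonneg_left h2 hV.le).trans ?_
  rw [show C * δ * (V * |w / V - 1|) = V * (C * (δ * |w / V - 1|)) by ring, sq]
  gcongr

theorem sq_le_entropy_integrand (hp : 1 < p) {w V : ℝ} (hV : 0 < V) (h : |w - V| ≤ 1 / 2 * V) :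
    (p + 1) / 2 * (1 / 2) ^ (p - 1) * (V ^ (p - 1) * ((w - V) * (w - V)))
      ≤ (w ^ (p + 1) - V ^ (p + 1)) - (p + 1) / p * (w ^ p - V ^ p) * V := by
  have hw := nonneg_of_abs_sub_le hV le_rfl h
  have h1 := mul_le_mul_of_nonneg_left
    (sq_sub_one_le_entropy_density hp (half_le_div_of_abs_sub_le hV h))
    (Real.rpow_pos_of_pos hV (p + 1)).le
  have e1 : V ^ (p + 1) = V ^ (p - 1) * V ^ 2 := by
    rw [← Real.rpow_natCast, ← Real.rpow_add hV]
    congr 1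
    push_cast
    ring
  have e2 : V ^ (p + 1) * (w / V) ^ (p + 1) = w ^ (p + 1) := by
    rw [← Real.mul_rpow hV.le (div_nonneg hw hV.le)]
    congr 1
    field_simp
  have e3 : V ^ (p + 1) * (w / V) ^ p = w ^ p * V := by
    rw [Real.rpow_add_one hV.ne', mul_right_comm, ← Real.mul_rpow hV.le (div_nonneg hw hV.le)]
    congr 2
    field_simp
  have e4 : V ^ (p + 1) = V ^ p * V := Real.rpow_add_one hV.ne' p
  have e5 : V ^ (p - 1) * ((w - V) * (w - V)) = V ^ (p + 1) * (w / V - 1) ^ 2 := by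
    rw [e1]
    field_simp
  rw [e5]
  calc _ = V ^ (p + 1) * ((p + 1) / 2 * (1 / 2) ^ (p - 1) * (w / V - 1) ^ 2) := by ring
    _ ≤ _ := h1
    _ = V ^ (p + 1) * (w / V) ^ (p + 1) - V ^ (p + 1)
        - (p + 1) / p * (V ^ (p + 1) * (w / V) ^ p - V ^ (p + 1)) := by ring
    _ = _ := by rw [e2, e3, e4]; ring

end PowerInequalities

end FastDiffusion

end

/-! ### The curves q and f, and the entropy bound -/

noncomputable section

namespace FastDiffusion

namespace IsBoundedWeight

variable {N : ℕ} {Ω : Set (Space N)} {p M : ℝ} {V : Space N → ℝ}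

theorem integrable_rpow (h : IsBoundedWeight Ω p M V) {r : ℝ} (hr : 0 ≤ r) :
    Integrable (fun x => V x ^ r) (volume.restrict Ω) := by
  have := h.isFiniteMeasure
  refine Integrable.of_bound (h.meas.aemeasurable.pow_const r).aestronglyMeasurable (M ^ r) ?_
  filter_upwards [h.pos, h.le] with x h1 h2
  rw [Real.norm_eq_abs, abs_of_nonneg (Real.rpow_nonneg h1.le _)]
  exact Real.rpow_le_rpow h1.le h2 hr

/-- Relative closeness, assumed for almost every time, holds at every time. -/
theorem ae_abs_sub_le_of_relativelyClose (h : IsBoundedWeight Ω p M V) {c : ℝ}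
    {u₀ : Space N → ℝ} {v : ℝ → Space N → ℝ} (hv : IsRCDPSolution Ω p c u₀ v) {t₀ δ : ℝ}
    (ht₀ : 0 ≤ t₀) (hδ0 : 0 ≤ δ) (hδ : δ ≤ 1) (hcl : RelativelyClose Ω V δ t₀ v) {t : ℝ}
    (ht : t₀ < t) : ∀ᵐ x ∂(volume.restrict Ω), |v t x - V x| ≤ δ * V x := by
  have hp : 0 < p := by linarith [h.one_lt]
  have hVp := h.integrable_rpow hp.le
  have hvt := hv.integrable t (ht₀.trans_lt ht)
  -- D measures by how much v(t)^p leaves the admissible band. At a time s where closeness holds,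
  -- v(s)^p lies in the band, so D ≤ |v(s)^p - v(t)^p|; such s are dense, and L¹ continuity gives ∫
  -- D = 0.
  set D : Space N → ℝ := fun x => max 0 (max (v t x ^ p - (1 + δ) ^ p * V x ^ p)
    ((1 - δ) ^ p * V x ^ p - v t x ^ p)) with hD
  have hDi : Integrable D (volume.restrict Ω) :=
    (integrable_zero _ _ _).sup ((hvt.sub (hVp.const_mul _)).sup ((hVp.const_mul _).sub hvt))
  have hD0 : ∀ x, 0 ≤ D x := fun x => le_max_left _ _
  have hfreq : ∃ᶠ s in 𝓝 t, ∫ x in Ω, D x ≤ ∫ x in Ω, |v s x ^ p - v t x ^ p| := by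
    have h1 := (ae_restrict_iff' measurableSet_Ici).1 (Measure.ae_ae_of_ae_prod hcl)
    have h2 := mem_closure_iff_frequently.1 (Measure.dense_of_ae h1 t)
    refine (h2.and_eventually (Ioi_mem_nhds ht)).mono fun s hs => ?_
    have hs0 : t₀ < s := hs.2
    refine integral_mono_ae hDi ((hv.integrable s (ht₀.trans_lt hs0)).sub hvt).abs ?_
    filter_upwards [hs.1 hs0.le, h.pos] with x hx hpos
    have hab := abs_le.1 hx
    have hlow : 0 ≤ (1 - δ) * V x := mul_nonneg (by linarith) hpos.le
    have hvs : (1 - δ) * V x ≤ v s x := by linarith [hab.1]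
    have hup : v s x ^ p ≤ (1 + δ) ^ p * V x ^ p := by
      rw [← Real.mul_rpow (by linarith) hpos.le]
      exact Real.rpow_le_rpow (hlow.trans hvs) (by linarith [hab.2]) hp.le
    have hlo : (1 - δ) ^ p * V x ^ p ≤ v s x ^ p := by
      rw [← Real.mul_rpow (by linarith) hpos.le]
      exact Real.rpow_le_rpow hlow hvs hp.le
    have h3 := neg_abs_le (v s x ^ p - v t x ^ p)
    have h4 := le_abs_self (v s x ^ p - v t x ^ p)
    exact max_le (abs_nonneg _) (max_le (by linarith) (by linarith))
  have hint : ∫ x in Ω, D x = 0 := le_antisymm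
    (ge_of_tendsto_of_frequently (hv.continuous t (ht₀.trans_lt ht)) hfreq) (integral_nonneg hD0)
  have hDz := (integral_eq_zero_iff_of_nonneg hD0 hDi).1 hint
  filter_upwards [hDz, h.pos, hv.nonneg t (ht₀.trans_lt ht)] with x hx hpos hvx
  have hle := max_le_iff.1 ((le_max_right 0 _).trans_eq hx)
  rw [Pi.zero_apply] at hle
  have h1 : v t x ≤ (1 + δ) * V x := by
    refine (Real.rpow_le_rpow_iff hvx (mul_nonneg (by linarith) hpos.le) hp).1 ?_
    rw [Real.mul_rpow (by linarith) hpos.le]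
    linarith [hle.1]
  have h2 : (1 - δ) * V x ≤ v t x := by
    refine (Real.rpow_le_rpow_iff (mul_nonneg (by linarith) hpos.le) hvx hp).1 ?_
    rw [Real.mul_rpow (by linarith) hpos.le]
    linarith [hle.2]
  exact abs_le.2 ⟨by linarith, by linarith⟩

theorem abs_relative_le (h : IsBoundedWeight Ω p M V) {w : Space N → ℝ}
    (hw : ∀ᵐ x ∂(volume.restrict Ω), |w x - V x| ≤ 1 / 2 * V x) :
    ∀ᵐ x ∂(volume.restrict Ω), |(w x ^ p - V x ^ p) / V x ^ (p - 1)| ≤ (3 / 2) ^ p * M := by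
  have hp : 0 < p := by linarith [h.one_lt]
  filter_upwards [hw, h.pos, h.le] with x hx hpos hle
  have hw0 := nonneg_of_abs_sub_le hpos le_rfl hx
  rw [rpow_sub_rpow_div_eq hw0 hpos, abs_mul, abs_of_pos hpos, mul_comm]
  have h1 : w x / V x ≤ 3 / 2 := by
    have := (abs_le.1 (abs_div_sub_one_le hpos hx)).2
    linarith
  have h2 : (w x / V x) ^ p ≤ (3 / 2) ^ p := Real.rpow_le_rpow (by positivity) h1 hp.le
  have h3 : 0 ≤ (w x / V x) ^ p := by positivity
  have h4 : (1 : ℝ) ≤ (3 / 2) ^ p := Real.one_le_rpow (by norm_num) hp.le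
  exact mul_le_mul (abs_le.2 ⟨by linarith, by linarith⟩) hle hpos.le (by linarith)

theorem norm_le_mul_norm (h : IsBoundedWeight Ω p M V) {x y : L2V Ω p V} {C : ℝ}
    (hxy : ∀ᵐ z ∂(volume.restrict Ω), |x z| ≤ C * |y z|) : ‖x‖ ≤ C * ‖y‖ :=
  Lp.norm_le_mul_norm_of_ae_le_mul (h.weightedMeasure_ac.ae_le hxy)

theorem isFiniteMeasure_weightedMeasure (h : IsBoundedWeight Ω p M V) :
    IsFiniteMeasure (weightedMeasure Ω p V) := by
  have := h.isFiniteMeasure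
  refine ⟨(h.weightedMeasure_le univ).trans_lt ?_⟩
  rw [Measure.smul_apply, smul_eq_mul]
  exact ENNReal.mul_lt_top ENNReal.ofReal_lt_top (measure_lt_top _ _)

/-- The curves `q = (v^p - V^p) / V^{p-1}` and `f = v - V` in `L²_V`. -/
theorem exists_relative_curves (h : IsBoundedWeight Ω p M V) {c : ℝ}
    {u₀ : Space N → ℝ} {v : ℝ → Space N → ℝ} (hv : IsRCDPSolution Ω p c u₀ v) {t₀ : ℝ}
    (ht₀ : 0 ≤ t₀)
    (hcl : ∀ t, t₀ < t → ∀ᵐ x ∂(volume.restrict Ω), |v t x - V x| ≤ 1 / 2 * V x) :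
    ∃ q f : ℝ → L2V Ω p V, ContinuousOn q (Ioi t₀) ∧ ContinuousOn f (Ioi t₀) ∧
      (∀ t, t₀ < t → q t =ᵐ[volume.restrict Ω] fun x => (v t x ^ p - V x ^ p) / V x ^ (p - 1)) ∧
      (∀ t, t₀ < t → f t =ᵐ[volume.restrict Ω] fun x => v t x - V x) ∧
      ∃ B, ∀ t, t₀ < t → ‖q t‖ ≤ B := by
  have hp : 0 < p := by linarith [h.one_lt]
  have hfin := h.isFiniteMeasure
  have hfinw := h.isFiniteMeasure_weightedMeasure
  have hVp := h.integrable_rpow hp.le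
  have hvpm : ∀ t, t₀ < t → AEStronglyMeasurable (fun x => v t x ^ p) (volume.restrict Ω) :=
    fun t ht => (hv.integrable t (ht₀.trans_lt ht)).aestronglyMeasurable
  have hvm : ∀ t, t₀ < t → AEStronglyMeasurable (v t) (volume.restrict Ω) := fun t ht => by
    refine ((hvpm t ht).aemeasurable.pow_const p⁻¹).aestronglyMeasurable.congr ?_
    filter_upwards [hv.nonneg t (ht₀.trans_lt ht)] with x hx
    exact Real.rpow_rpow_inv hx hp.ne'
  have hqm : ∀ t, t₀ < t → MemLp (fun x => (v t x ^ p - V x ^ p) / V x ^ (p - 1)) 2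
      (weightedMeasure Ω p V) := fun t ht => by
    refine MemLp.of_bound (AEStronglyMeasurable.mono_ac h.weightedMeasure_ac
      (((hvpm t ht).aemeasurable.sub hVp.1.aemeasurable).div
        (h.meas.aemeasurable.pow_const (p - 1))).aestronglyMeasurable) ((3 / 2) ^ p * M)
      (h.weightedMeasure_ac.ae_le (h.abs_relative_le (hcl t ht)))
  have hfm : ∀ t, t₀ < t → MemLp (fun x => v t x - V x) 2 (weightedMeasure Ω p V) := fun t ht => by
    refine MemLp.of_bound (AEStronglyMeasurable.mono_ac h.weightedMeasure_ac
      ((hvm t ht).sub h.meas)) (1 / 2 * M) (h.weightedMeasure_ac.ae_le ?_)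
    filter_upwards [hcl t ht, h.le] with x hx hle
    exact hx.trans (by linarith)
  classical
  set q : ℝ → L2V Ω p V := fun t => if ht : t₀ < t then (hqm t ht).toLp else 0 with hq
  set f : ℝ → L2V Ω p V := fun t => if ht : t₀ < t then (hfm t ht).toLp else 0 with hf
  have hqv : ∀ t, t₀ < t →
      q t =ᵐ[volume.restrict Ω] fun x => (v t x ^ p - V x ^ p) / V x ^ (p - 1) := fun t ht => by
    simp only [hq, dif_pos ht]
    exact h.ac_weightedMeasure.ae_le (hqm t ht).coeFn_toLp
  have hfv : ∀ t, t₀ < t → f t =ᵐ[volume.restrict Ω] fun x => v t x - V x := fun t ht => by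
    simp only [hf, dif_pos ht]
    exact h.ac_weightedMeasure.ae_le (hfm t ht).coeFn_toLp
  -- L¹ continuity of v^p becomes L²_V continuity of q: one factor of |q(s) - q(t)|² is bounded by
  -- K, and V^{p-1} times the other is |v(s)^p - v(t)^p|.
  have hqd : ∀ t, t₀ < t → Tendsto (fun s => ‖q s - q t‖) (𝓝 t) (𝓝 0) := by
    intro t ht
    set K : ℝ := 2 * (3 / 2) ^ p * M with hK
    have hlim : Tendsto (fun s => √(K * ∫ x in Ω, |v s x ^ p - v t x ^ p|)) (𝓝 t) (𝓝 0) := by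
      have := ((hv.continuous t (ht₀.trans_lt ht)).const_mul K).sqrt
      simpa using this
    refine squeeze_zero' (Eventually.of_forall fun s => norm_nonneg _) ?_ hlim
    filter_upwards [Ioi_mem_nhds ht] with s hs
    refine Real.le_sqrt_of_sq_le ?_
    rw [← real_inner_self_eq_norm_sq, h.inner_eq_integral, ← integral_const_mul]
    have hi := ((hv.integrable s (ht₀.trans_lt hs)).sub (hv.integrable t (ht₀.trans_lt ht))).abs
    refine integral_mono_of_nonneg ?_ (hi.const_mul K) ?_
    · filter_upwards [h.pos] with x hx
      exact mul_nonneg (Real.rpow_nonneg hx.le _) (mul_self_nonneg _)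
    · filter_upwards [h.pos, h.ac_weightedMeasure.ae_le (Lp.coeFn_sub (q s) (q t)), hqv s hs,
        hqv t ht, h.abs_relative_le (hcl s hs), h.abs_relative_le (hcl t ht)]
        with x hpos hx hs1 ht1 hs2 ht2
      rw [hx, Pi.sub_apply, hs1, ht1]
      have hV : 0 < V x ^ (p - 1) := Real.rpow_pos_of_pos hpos _
      set X := (v s x ^ p - V x ^ p) / V x ^ (p - 1) with hX
      set Y := (v t x ^ p - V x ^ p) / V x ^ (p - 1) with hY
      have e : v s x ^ p - v t x ^ p = V x ^ (p - 1) * (X - Y) := by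
        rw [hX, hY]
        field_simp
        ring
      rw [e, abs_mul, abs_of_pos hV, ← abs_mul_abs_self (X - Y)]
      have hXY : |X - Y| ≤ K := (abs_sub _ _).trans (by rw [hK]; linarith)
      nlinarith [mul_le_mul_of_nonneg_right hXY (mul_nonneg hV.le (abs_nonneg (X - Y)))]
  have hC : 0 < p * (1 / 2 : ℝ) ^ (p - 1) := by positivity
  -- f inherits continuity from q, because on the range w / V ≥ 1/2 the power map expands distances
  -- by a fixed factor.
  have hfq : ∀ s t, t₀ < s → t₀ < t →
      ‖f s - f t‖ ≤ (p * (1 / 2 : ℝ) ^ (p - 1))⁻¹ * ‖q s - q t‖ := by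
    intro s t hs ht
    refine h.norm_le_mul_norm ?_
    filter_upwards [h.pos, h.ac_weightedMeasure.ae_le (Lp.coeFn_sub (q s) (q t)), hqv s hs,
      hqv t ht, hcl s hs, hcl t ht, h.ac_weightedMeasure.ae_le (Lp.coeFn_sub (f s) (f t)),
      hfv s hs, hfv t ht] with x hpos hx hs1 ht1 hs2 ht2 hx' hs3 ht3
    rw [hx, hx', Pi.sub_apply, Pi.sub_apply, hs1, ht1, hs3, ht3, inv_mul_eq_div, le_div_iff₀ hC,
      sub_sub_sub_cancel_right, mul_comm]
    exact mul_abs_sub_le_abs_relative_sub h.one_lt hpos hs2 ht2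
  refine ⟨q, f, fun t ht => ContinuousAt.continuousWithinAt
    (tendsto_iff_norm_sub_tendsto_zero.2 (hqd t ht)), fun t ht => ContinuousAt.continuousWithinAt
    (tendsto_iff_norm_sub_tendsto_zero.2 ?_), hqv, hfv, ?_⟩
  · have hlim := (hqd t ht).const_mul (p * (1 / 2 : ℝ) ^ (p - 1))⁻¹
    rw [mul_zero] at hlim
    refine squeeze_zero' (Eventually.of_forall fun s => norm_nonneg _) ?_ hlim
    filter_upwards [Ioi_mem_nhds ht] with s hs using hfq s t hs ht
  · refine ⟨_, fun t ht => Lp.norm_le_of_ae_bound (C := (3 / 2) ^ p * M)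
      (mul_nonneg (by positivity) h.bound_pos.le) (h.weightedMeasure_ac.ae_le ?_)⟩
    filter_upwards [hqv t ht, h.abs_relative_le (hcl t ht)] with x h1 h2
    rw [h1]
    exact h2

theorem norm_sq_le_entropy (h : IsBoundedWeight Ω p M V) {w : Space N → ℝ}
    (hw : ∀ᵐ x ∂(volume.restrict Ω), |w x - V x| ≤ 1 / 2 * V x) {f : L2V Ω p V}
    (hf : f =ᵐ[volume.restrict Ω] fun x => w x - V x) :
    (p + 1) / 2 * (1 / 2) ^ (p - 1) * ‖f‖ ^ 2 ≤ entropy Ω p V w := by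
  have hp : 0 < p := by linarith [h.one_lt]
  have hfin := h.isFiniteMeasure
  have hwm : AEMeasurable w (volume.restrict Ω) := by
    refine (((Lp.aestronglyMeasurable f).mono_ac h.ac_weightedMeasure).add
      h.meas).aemeasurable.congr ?_
    filter_upwards [hf] with x hx
    rw [Pi.add_apply, hx, sub_add_cancel]
  have hwi : ∀ r : ℝ, 0 ≤ r → Integrable (fun x => w x ^ r) (volume.restrict Ω) := fun r hr => by
    refine Integrable.of_bound (hwm.pow_const r).aestronglyMeasurable ((3 / 2 * M) ^ r) ?_
    filter_upwards [hw, h.pos, h.le] with x hx hpos hle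
    have hw0 := nonneg_of_abs_sub_le hpos le_rfl hx
    rw [Real.norm_eq_abs, abs_of_nonneg (Real.rpow_nonneg hw0 _)]
    exact Real.rpow_le_rpow hw0 (by linarith [(abs_le.1 hx).2]) hr
  have hi : Integrable (fun x => (w x ^ (p + 1) - V x ^ (p + 1))
      - (p + 1) / p * (w x ^ p - V x ^ p) * V x) (volume.restrict Ω) := by
    refine ((hwi _ (by linarith)).sub (h.integrable_rpow (by linarith))).sub
      (Integrable.mul_bdd (c := M) (((hwi _ hp.le).sub (h.integrable_rpow hp.le)).const_mul _)
        h.meas ?_)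
    filter_upwards [h.pos, h.le] with x hpos hle
    rwa [Real.norm_eq_abs, abs_of_pos hpos]
  rw [← real_inner_self_eq_norm_sq, h.inner_eq_integral, ← integral_const_mul]
  refine integral_mono_of_nonneg ?_ hi ?_
  · filter_upwards [h.pos] with x hx
    exact mul_nonneg (by positivity) (mul_nonneg (Real.rpow_nonneg hx.le _) (mul_self_nonneg _))
  · filter_upwards [h.pos, hw, hf] with x hpos hx hfx
    rw [hfx]
    exact sq_le_entropy_integrand h.one_lt hpos hx

theorem integral_eq_inner (h : IsBoundedWeight Ω p M V) {w : Space N → ℝ} {q : L2V Ω p V}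
    (hq : q =ᵐ[volume.restrict Ω] fun x => (w x ^ p - V x ^ p) / V x ^ (p - 1))
    (φ : L2V Ω p V) : ∫ x in Ω, (w x ^ p - V x ^ p) * φ x = inner ℝ q φ := by
  rw [h.inner_eq_integral]
  refine integral_congr_ae ?_
  filter_upwards [hq, h.pos] with x hx hpos
  have : 0 < V x ^ (p - 1) := Real.rpow_pos_of_pos hpos _
  rw [hx]
  field_simp

end IsBoundedWeight

end FastDiffusion

end

/-! ### Norm comparison and invariance of the eigenspaces -/

noncomputable section

namespace FastDiffusion

section Main

variable {N : ℕ} {Ω : Set (Space N)} {p M : ℝ} {V : Space N → ℝ}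

theorem IsStationaryProfile.exists_isBoundedWeight {c : ℝ} (hN : 1 ≤ N) (hΩ : IsOpen Ω)
    (hb : Bornology.IsBounded Ω) (hp : 1 < p) (hV : IsStationaryProfile Ω p c V) :
    ∃ M, IsBoundedWeight Ω p M V := by
  obtain ⟨hpos, ⟨M, hM⟩, DV, hDV⟩ := hV
  refine ⟨max M 1, hN, hΩ, hb, hp, lt_max_of_lt_right one_pos, hpos, ?_,
    hDV.1.1.aestronglyMeasurable⟩
  filter_upwards [hM] with x hx using hx.trans (le_max_left _ _)

namespace IsBoundedWeight

theorem ae_abs_rpow_le (h : IsBoundedWeight Ω p M V) {v : ℝ → Space N → ℝ} {t₀ δ : ℝ}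
    (hδ : δ ≤ 1 / 2) (hcl : RelativelyClose Ω V δ t₀ v) :
    ∀ᵐ z ∂((volume.restrict (Ici t₀)).prod (volume.restrict Ω)),
      |v z.1 z.2 ^ p| ≤ (3 / 2 * M) ^ p := by
  have hs : ∀ {P : Space N → Prop}, (∀ᵐ x ∂(volume.restrict Ω), P x) →
      ∀ᵐ z ∂((volume.restrict (Ici t₀)).prod (volume.restrict Ω)), P z.2 := fun hP =>
    Measure.quasiMeasurePreserving_snd.ae hP
  filter_upwards [hcl, hs h.pos, hs h.le] with z hz hpos hle
  have hw0 := nonneg_of_abs_sub_le hpos hδ hz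
  have h1 : v z.1 z.2 ≤ 3 / 2 * M := by
    have := (abs_le.1 hz).2
    nlinarith
  rw [abs_of_nonneg (Real.rpow_nonneg hw0 _)]
  exact Real.rpow_le_rpow hw0 h1 (by linarith [h.one_lt])

/-- Everything is compared with ‖f‖: the error q - p f is at most C δ ‖f‖, while ‖q‖ and ℰ^{1/2}
both dominate ‖f‖. The first bound feeds the cone argument, the second passes from ‖q‖ to the
entropy. -/
theorem norm_bounds_of_relativelyClose (h : IsBoundedWeight Ω p M V) : ∃ C₁ C₂ : ℝ, 0 < C₁ ∧
    0 < C₂ ∧ ∀ (w : Space N → ℝ) (q f : L2V Ω p V) (δ : ℝ), 0 ≤ δ → δ ≤ 1 / 2 →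
      (∀ᵐ x ∂(volume.restrict Ω), |w x - V x| ≤ δ * V x) →
      (q =ᵐ[volume.restrict Ω] fun x => (w x ^ p - V x ^ p) / V x ^ (p - 1)) →
      (f =ᵐ[volume.restrict Ω] fun x => w x - V x) →
      ‖q - p • f‖ ≤ C₁ * δ * ‖q‖ ∧ ‖q‖ ≤ C₂ * Real.sqrt (entropy Ω p V w) := by
  have hp : 0 < p := by linarith [h.one_lt]
  obtain ⟨C, hC0, hC⟩ := exists_abs_relative_sub_le p
  set a : ℝ := p * (1 / 2) ^ (p - 1) with ha
  have ha0 : 0 < a := by positivity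
  set b : ℝ := (p + 1) / 2 * (1 / 2) ^ (p - 1) with hb
  have hb0 : 0 < b := by positivity
  refine ⟨C / a, (C + p) / √b, by positivity, by positivity, fun w q f δ hδ0 hδ hw hq hf => ?_⟩
  have hw' : ∀ᵐ x ∂(volume.restrict Ω), |w x - V x| ≤ 1 / 2 * V x := by
    filter_upwards [hw, h.pos] with x hx hpos
    exact hx.trans (mul_le_mul_of_nonneg_right hδ hpos.le)
  have h1 : ‖q - p • f‖ ≤ C * δ * ‖f‖ := by
    refine h.norm_le_mul_norm ?_
    filter_upwards [h.ac_weightedMeasure.ae_le (Lp.coeFn_sub q (p • f)),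
      h.ac_weightedMeasure.ae_le (Lp.coeFn_smul p f), h.pos, hw, hq, hf]
      with x hx hx' hpos hwx hqx hfx
    rw [hx, Pi.sub_apply, hx', Pi.smul_apply, hqx, hfx, smul_eq_mul]
    exact hC _ _ _ hpos hδ hwx
  have h2 : a * ‖f‖ ≤ ‖q‖ := by
    rw [← le_inv_mul_iff₀ ha0]
    refine h.norm_le_mul_norm ?_
    filter_upwards [h.pos, hw', hq, hf] with x hpos hwx hqx hfx
    rw [le_inv_mul_iff₀ ha0, hqx, hfx]
    -- Comparison with the profile itself, for which q and f vanish.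
    have hVV : |V x - V x| ≤ 1 / 2 * V x := by simpa using hpos.le
    have := mul_abs_sub_le_abs_relative_sub h.one_lt hpos hwx hVV
    rwa [sub_self (V x ^ p), zero_div, sub_zero] at this
  have h3 : √b * ‖f‖ ≤ √(entropy Ω p V w) := by
    refine Real.le_sqrt_of_sq_le ?_
    rw [mul_pow, Real.sq_sqrt hb0.le]
    exact h.norm_sq_le_entropy hw' hf
  constructor
  · calc ‖q - p • f‖ ≤ C * δ * ‖f‖ := h1
      _ = C / a * δ * (a * ‖f‖) := by field_simp
      _ ≤ _ := by gcongr
  · have h4 : ‖q‖ ≤ (C + p) * ‖f‖ := by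
      have h5 := norm_sub_norm_le q (p • f)
      rw [norm_smul, Real.norm_eq_abs, abs_of_pos hp] at h5
      have h6 : C * δ * ‖f‖ ≤ C * 1 * ‖f‖ := by gcongr; linarith
      linarith
    calc ‖q‖ ≤ (C + p) * ‖f‖ := h4
      _ = (C + p) / √b * (√b * ‖f‖) := by field_simp
      _ ≤ _ := by gcongr

/-- The fixed points of P form a subspace, so it suffices to treat the eigenfunctions that span. -/
theorem projection_eq_self_of_mem_eigenspace (h : IsBoundedWeight Ω p M V) {c : ℝ} (hc : 0 < c)
    {P : L2V Ω p V →L[ℝ] L2V Ω p V}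
    (hP : ∀ θ, 1 / (p * c) < θ → ∀ x, h.solutionOperator x = θ • x → P x = x) {k : ℕ} (hk : 1 ≤ k)
    (hkm : k ≤ kMax Ω p c V) {φ : L2V Ω p V} (hφ : φ ∈ eigenspace Ω p V k) : P φ = φ := by
  have hlt := eigenvalue_lt_of_le_kMax (mul_pos (by linarith [h.one_lt]) hc) hk hkm
  have hle : eigenspace Ω p V k ≤ LinearMap.eqLocus (P : L2V Ω p V →ₗ[ℝ] L2V Ω p V)
      LinearMap.id := Submodule.span_le.2 fun ψ hψ =>
    h.projection_eq_self_of_solvesEigenvalueEquation hc hlt hP hψ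
  exact hle hφ

end IsBoundedWeight

end Main

end FastDiffusion

end

/-! ### Proof of the theorem -/

theorem mainTheorem5 {N : ℕ} (hN : 1 ≤ N) {α : ℝ≥0} (hα₀ : 0 < α) (hα₁ : α < 1)
    {Ω : Set (Space N)} (hΩ : IsC2AlphaDomain α Ω)
    {p : ℝ} (hp : 1 < p) (hps : 3 ≤ N → p < ((N : ℝ) + 2) / ((N : ℝ) - 2))
    {T : ℝ} (hT : 0 < T)
    {V : Space N → ℝ} (hV : IsStationaryProfile Ω p (cConst p T) V)
    (hH2 : Nondegenerate Ω p (cConst p T) V) :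
    ∃ κ₀ : ℝ, 0 < κ₀ ∧ ∃ ε₀ : ℝ, 0 < ε₀ ∧
      ∀ φ : (k : ℕ) → OrthonormalBasis (Fin (eigenDim Ω p V k)) ℝ (eigenspace Ω p V k),
      ∀ (u₀ : Space N → ℝ) (v : ℝ → Space N → ℝ),
        IsAdmissibleDatum Ω p u₀ → IsRCDPSolution Ω p (cConst p T) u₀ v →
      ∀ ε : ℝ, 0 < ε → ε < ε₀ →
      ∀ t₀ : ℝ, 0 ≤ t₀ →
      ∃ tε : ℝ, t₀ ≤ tε ∧
        ∀ δ : ℝ, 0 < δ → δ < κ₀ * ε → RelativelyClose Ω V δ t₀ v →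
          ∀ t : ℝ, tε ≤ t →
          ∀ k : ℕ, 1 ≤ k → k ≤ kMax Ω p (cConst p T) V →
          ∀ j : Fin (eigenDim Ω p V k),
            nonlinearQuotient Ω p V (φ k j : L2V Ω p V) (v t) ≤ ε := by
  obtain ⟨M, h⟩ := hV.exists_isBoundedWeight hN hΩ.1 hΩ.2.1 hp
  obtain ⟨-, -, DV, hDV⟩ := hV
  have hp0 : 0 < p := by linarith
  have hc : 0 < cConst p T := div_pos hp0 (mul_pos (by linarith) hT)
  set c := cConst p T with hcdef
  have hpc : 0 < p * c := mul_pos hp0 hc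
  obtain ⟨P, g, hg, hPP, hPs, hTP, hlow, hhigh, hP⟩ := exists_spectral_splitting
    h.isCompactOperator_solutionOperator h.isSymmetric_solutionOperator
    (one_div_pos.2 hpc).ne' (fun x hx => h.eq_zero_of_nondegenerate hc hH2 hx)
  obtain ⟨C₁, C₂, hC₁, hC₂, hbd⟩ := h.norm_bounds_of_relativelyClose
  -- The cone argument is run with aperture m ε: the factor C₂⁻¹ pays for ‖q‖ ≤ C₂ ℰ^{1/2}, and m ≤
  -- 1 keeps the aperture at most 1.
  set m : ℝ := min C₂⁻¹ 1 with hm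
  have hm0 : 0 < m := lt_min (inv_pos.2 hC₂) one_pos
  -- The first entry of κ₀ ensures δ ≤ 1/2 (with ε < 1), the second C₁ δ ≤ (p c g / 4) m ε. The time
  -- t₀ + 1 only serves to have t > t₀ strictly.
  refine ⟨min (1 / 2) (p * c * g / 4 * m / C₁), lt_min (by norm_num) (by positivity), 1, one_pos,
    fun φ u₀ v _ hv ε hε hε1 t₀ ht₀ => ⟨t₀ + 1, by linarith,
      fun δ hδ hδκ hcl t ht k hk hkm j => ?_⟩⟩
  have hδ2 : δ ≤ 1 / 2 := by
    refine hδκ.le.trans ((mul_le_mul_of_nonneg_right (min_le_left _ _) hε.le).trans ?_)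
    linarith
  have hδ3 : C₁ * δ ≤ p * c * g / 4 * (m * ε) := by
    have := hδκ.le.trans (mul_le_mul_of_nonneg_right (min_le_right _ _) hε.le)
    calc C₁ * δ ≤ C₁ * (p * c * g / 4 * m / C₁ * ε) := by gcongr
      _ = _ := by field_simp
  have hall : ∀ s, t₀ < s → ∀ᵐ x ∂(volume.restrict Ω), |v s x - V x| ≤ δ * V x := fun s hs =>
    h.ae_abs_sub_le_of_relativelyClose hv ht₀ hδ.le (by linarith) hcl hs
  obtain ⟨q, f, hq, hf, hqv, hfv, B, hB⟩ := h.exists_relative_curves hv ht₀ fun s hs => by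
    filter_upwards [hall s hs, h.pos] with x hx hpos
    exact hx.trans (mul_le_mul_of_nonneg_right hδ2 hpos.le)
  have hts : t₀ < t := by linarith
  have hmain : ‖P (q t)‖ ≤ m * ε * ‖q t‖ :=
    norm_projection_le_of_evolution h.isSymmetric_solutionOperator
      h.inner_solutionOperator_self_nonneg hg hp0 hc (by field_simp) hPP hPs hTP hlow hhigh
      hq hf hB (mul_pos hm0 hε) (mul_le_one₀ (min_le_right _ _) hε.le hε1.le)
      (by positivity) hδ3 (fun s hs => (hbd (v s) (q s) (f s) δ hδ.le hδ2 (hall s hs) (hqv s hs)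
        (hfv s hs)).1)
      (fun y s s' hs hss => h.evolution_identity hDV hv ht₀ (h.ae_abs_rpow_le hδ2 hcl) hq hf
        hqv hfv y s s' hs hss) hts
  have hPφ : P (φ k j : L2V Ω p V) = φ k j :=
    h.projection_eq_self_of_mem_eigenspace hc hP hk hkm (φ k j).2
  have hnorm : ‖(φ k j : L2V Ω p V)‖ = 1 := (φ k).orthonormal.1 j
  rw [nonlinearQuotient, h.integral_eq_inner (hqv t hts)]
  -- Zero entropy is covered as well, since division by zero gives 0.
  refine div_le_of_le_mul₀ (Real.sqrt_nonneg _) hε.le ?_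
  have hE := (hbd (v t) (q t) (f t) δ hδ.le hδ2 (hall t hts) (hqv t hts) (hfv t hts)).2
  calc |inner ℝ (q t) (φ k j : L2V Ω p V)| = |inner ℝ (P (q t)) (φ k j : L2V Ω p V)| := by
        rw [hPs, hPφ]
    _ ≤ ‖P (q t)‖ := by simpa [hnorm] using abs_real_inner_le_norm (P (q t)) (φ k j : L2V Ω p V)
    _ ≤ m * ε * ‖q t‖ := hmain
    _ ≤ C₂⁻¹ * ε * (C₂ * √(entropy Ω p V (v t))) := by
        gcongr
        exact min_le_left _ _
    _ = ε * √(entropy Ω p V (v t)) := by field_simp
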